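/- Throughout, manifolds are smooth, connected, Hausdorff and second countable. An immersed hypersurface $f\colon M^n\to\mathbb{R}^{n+1}$ is a cyclide of Dupin of characteristic $(m,n-m)$, $1\le m\le n-1$, if it has everywhere exactly two distinct principal curvatures, of multiplicities $m$ and $n-m$, each of them constant along its eigenbundle; $M^n$ carries the metric induced by $f$. Let $\mathbb{Q}^k_c$ be the standard complete simply connected space form of dimension $k$ and curvature $c$ (for $k=1$: the circle of radius $1/\sqrt c$ if $c>0$, a complete line if $c\le 0$), $\mathbb{S}^m$ the unit sphere in $\mathbb{R}^{m+1}$ and $\mathbb{H}^{k+1}=\{X\in\mathbb{L}^{k+2}:\langle X,X\rangle=-1\}$ (one sheet) hyperbolic space. For $c>-1$, a spherical inclusion $f_1\colon\mathbb{Q}^k_c\to\mathbb{H}^{k+1}$ is an isometric immersion that is umbilical with constant principal curvature $\sqrt{c+1}$ with respect to a unit normal field. (For $k\ge 2$ this value is forced, up to sign, by the Gauss equation; for $k=1$ it is part of the definition.) For $N=k+m+1$, a map $\Theta\colon\mathbb{H}^{k+1}\times\mathbb{S}^m\to\mathbb{R}^N$ is given as follows. Choose light-like vectors $p_0,w\in\mathbb{L}^{N+2}$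 with $\langle p_0,w\rangle=1$, a linear isometry $A$ of $\mathbb{R}^N$ onto $\{p_0,w\}^\perp$, and linear isometries $C\colon\mathbb{L}^{k+2}\to V$, $D\colon\mathbb{R}^{m+1}\to V^\perp$ for a time-like subspace $V\subset\mathbb{L}^{N+2}$. Put $\Psi(x)=p_0+Ax-\tfrac12\|x\|^2w$, and let $\Theta(X,Y)$ be the point with $\Psi(\Theta(X,Y))=Z/\langle Z,w\rangle$, where $Z=CX+DY$. It is defined where $\langle Z,w\rangle\ne 0$, that is, except for at most one point (sent to infinity), and it is a conformal diffeomorphism onto the complement of a $k$-dimensional sphere or affine subspace. Say that $f\colon M^n\to\mathbb{R}^{n+1}$ has normal form $(m,c)$ if, with $k=n-m$, there are a conformal local diffeomorphism $\varphi\colon M^n\to\mathbb{Q}^{n-m}_c\times\mathbb{S}^m$ (Riemannian product), a spherical inclusion $f_1\colon\mathbb{Q}^{n-m}_c\to\mathbb{H}^{n-m+1}$ and a map $\Theta\colon\mathbb{H}^{n-m+1}\times\mathbb{S}^m\to\mathbb{R}^{n+1}$ as above such that $\Theta$ is defined on the image of $(f_1\times\mathrm{id})\circ\varphi$ and $f=\Theta\circ(f_1\times\mathrm{id})\circ\varphi$,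 and such that, if $f$ is injective, $\varphi$ is a diffeomorphism onto an open subset $W$, so that with $\psi=\varphi^{-1}\colon W\to M^n$ one has $f\circ\psi=\Theta\circ(f_1\times\mathrm{id})|_W$. (a) If $f\colon M^n\to\mathbb{R}^{n+1}$ is a cyclide of Dupin of characteristic $(m,n-m)$, then, after interchanging its two principal curvatures (that is, $m$ and $n-m$) if necessary, $f$ has normal form $(m,c)$ for some $c>-1$. (b) For all $1\le m\le n-1$ and $c>-1$ there is a cyclide of Dupin of characteristic $(m,n-m)$, defined on $\mathbb{R}^n$, with normal form $(m,c)$. (c) Call $f\colon M\to\mathbb{R}^{n+1}$ and $f'\colon M'\to\mathbb{R}^{n+1}$ conformally congruent if there are a homeomorphism $e$ between nonempty open subsets $U\subset M$, $U'\subset M'$ and a Möbius transformation $T$ (a similarity, or an inversion followed by a similarity) whose pole, if any, is not in $f(U)$, such that $f'\circ e=T\circ f$ on $U$. Let $f,f'$ be cyclides of Dupin of characteristics $(m,n-m)$, $(m',n-m')$ with normal forms $(m,c)$, $(m',c')$, $c,c'>-1$. Then $f$ and $f'$ are conformally congruent if and only if either $m=m'$ and $c=c'$, or $m+m'=n$ and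 $cc'=1$. -/

import Mathlib

open scoped Manifold ContDiff

universe u v

namespace DupinCyclide

noncomputable section

/-- Euclidean space `ℝ^d`. -/
abbrev Euc (d : ℕ) : Type := EuclideanSpace ℝ (Fin d)

/-- The vector space `ℝ^d × ℝ`. With `lorentz` it is Minkowski space `𝕃^{d+1}`. -/
abbrev Mink (d : ℕ) : Type := Euc d × ℝ

/-- The Lorentz scalar product of signature `(+, …, +, -)`. -/
def lorentz {d : ℕ} (X Y : Mink d) : ℝ := inner ℝ X.1 Y.1 - X.2 * Y.2

theorem lorentz_comm {d : ℕ} (X Y : Mink d) : lorentz X Y = lorentz Y X := by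
  simp only [lorentz, real_inner_comm Y.1 X.1]; ring

theorem lorentz_add_left {d : ℕ} (X Y Z : Mink d) :
    lorentz (X + Y) Z = lorentz X Z + lorentz Y Z := by
  simp only [lorentz, Prod.fst_add, Prod.snd_add, inner_add_left]; ring

theorem lorentz_smul_left {d : ℕ} (r : ℝ) (X Z : Mink d) :
    lorentz (r • X) Z = r * lorentz X Z := by
  simp only [lorentz, Prod.smul_fst, Prod.smul_snd, real_inner_smul_left, smul_eq_mul]; ring

theorem lorentz_add_right {d : ℕ} (X Y Z : Mink d) :
    lorentz X (Y + Z) = lorentz X Y + lorentz X Z := by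
  rw [lorentz_comm, lorentz_add_left, lorentz_comm Y, lorentz_comm Z]

theorem lorentz_smul_right {d : ℕ} (r : ℝ) (X Z : Mink d) :
    lorentz X (r • Z) = r * lorentz X Z := by
  rw [lorentz_comm, lorentz_smul_left, lorentz_comm]

/-- Hyperbolic space `ℍ^d` of curvature `-1`: the upper sheet of the hyperboloid in `𝕃^{d+1}`. -/
def hyperbolic (d : ℕ) : Set (Mink d) := {X | lorentz X X = -1 ∧ 0 < X.2}

/-! ### The space forms -/

/-- The bilinear form on `ℝ^d × ℝ` that is Euclidean for `c > 0`, Lorentzian for `c < 0`, and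
degenerate in the last direction for `c = 0`. -/
def formOf {d : ℕ} (c : ℝ) (u v : Euc d × ℝ) : ℝ := inner ℝ u.1 v.1 + Real.sign c * (u.2 * v.2)

/-- The complete space form of dimension `d` and curvature `c` in its standard model: the sphere of
radius `1/√c` in `ℝ^{d+1}` for `c > 0`, the space `ℝ^d × {0}` for `c = 0`, and the upper sheet of
the hyperboloid `⟨q, q⟩ = 1/c` in `𝕃^{d+1}` for `c < 0`. Its metric is induced by `formOf c`. -/
def spaceForm (d : ℕ) (c : ℝ) : Set (Euc d × ℝ) :=
  {q | (c ≠ 0 → formOf c q q = 1 / c) ∧ (c = 0 → q.2 = 0) ∧ (c < 0 → 0 < q.2)}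

/-- The tangent space of `spaceForm d c` at the point `q`. -/
def spaceFormTangent {d : ℕ} (c : ℝ) (q : Euc d × ℝ) : Set (Euc d × ℝ) :=
  {x | (c ≠ 0 → formOf c q x = 0) ∧ (c = 0 → x.2 = 0)}

/-- The unit sphere `𝕊^d` in `ℝ^{d+1}`. -/
abbrev unitSphere (d : ℕ) : Set (Euc (d + 1)) := Metric.sphere 0 1

/-- `f₁` restricts to a spherical inclusion of the `k`-dimensional space form of curvature `c` into
`ℍ^{k+1}`: it is a smooth isometric immersion that is umbilical with constant principal curvature
`√(c+1)` with respect to a unit normal field `ν`. By the Gauss equation the absolute value of a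
constant principal curvature of an isometric immersion of a space form of curvature `c` must be
`√(c+1)` if `k ≥ 2`; for `k = 1` this is what the index `c` means. The maps `f₁` and `ν` are
extended smoothly from the closed submanifold `spaceForm k c` to the surrounding vector space; only
their values on `spaceForm k c` matter. -/
def IsSphericalInclusion (k : ℕ) (c : ℝ) (f₁ : Euc k × ℝ → Mink (k + 1)) : Prop :=
  ContDiff ℝ ∞ f₁ ∧
  (∀ q ∈ spaceForm k c, f₁ q ∈ hyperbolic (k + 1)) ∧
  (∀ q ∈ spaceForm k c, ∀ x ∈ spaceFormTangent c q, ∀ y ∈ spaceFormTangent c q,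
    lorentz (fderiv ℝ f₁ q x) (fderiv ℝ f₁ q y) = formOf c x y) ∧
  ∃ ν : Euc k × ℝ → Mink (k + 1), ContDiff ℝ ∞ ν ∧
    ∀ q ∈ spaceForm k c,
      lorentz (ν q) (ν q) = 1 ∧ lorentz (ν q) (f₁ q) = 0 ∧
      ∀ x ∈ spaceFormTangent c q,
        lorentz (ν q) (fderiv ℝ f₁ q x) = 0 ∧
        fderiv ℝ ν q x = -(Real.sqrt (c + 1)) • fderiv ℝ f₁ q x

/-! ### The light cone model of Euclidean space and the conformal diffeomorphisms `Θ` -/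

/-- A triple `(p₀, w, A)` where `p₀, w` are light-like vectors of `𝕃^{N+2}` with `⟨p₀, w⟩ = 1` and
`A` is a linear isometry of `ℝ^N` onto the orthogonal complement of `span {p₀, w}`. -/
structure LightConeModel (N : ℕ) where
  p₀ : Mink (N + 1)
  w : Mink (N + 1)
  A : Euc N →ₗ[ℝ] Mink (N + 1)
  p₀_null : lorentz p₀ p₀ = 0
  w_null : lorentz w w = 0
  p₀_w : lorentz p₀ w = 1
  A_isometry : ∀ x y, lorentz (A x) (A y) = inner ℝ x y
  A_p₀ : ∀ x, lorentz (A x) p₀ = 0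
  A_w : ∀ x, lorentz (A x) w = 0

/-- The isometry `Ψ` of `ℝ^N` onto `{p | ⟨p, p⟩ = 0, ⟨p, w⟩ = 1}`. -/
def LightConeModel.psi {N : ℕ} (τ : LightConeModel N) (x : Euc N) : Mink (N + 1) :=
  τ.p₀ + τ.A x - ((1 / 2) * ‖x‖ ^ 2) • τ.w

/-- The inverse of `Ψ` preceded by the radial projection `F ↦ F / ⟨F, w⟩`, in coordinates;
meaningful for a light-like vector `F` with `⟨F, w⟩ ≠ 0`, see `psi_proj`. -/
def LightConeModel.proj {N : ℕ} (τ : LightConeModel N) (F : Mink (N + 1)) : Euc N :=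
  WithLp.toLp 2 fun i => lorentz F (τ.A (EuclideanSpace.single i 1)) / lorentz F τ.w

/-- Every vector of `𝕃^{N+2}` decomposes along `p₀`, `w` and the image of `A`. -/
theorem LightConeModel.exists_decomp {N : ℕ} (τ : LightConeModel N) (F : Mink (N + 1)) :
    ∃ (x : Euc N) (s t : ℝ), F = τ.A x + s • τ.p₀ + t • τ.w := by
  have hAA := τ.A_isometry
  have hAp := τ.A_p₀
  have hAw := τ.A_w
  have hpw := τ.p₀_w
  have hpp := τ.p₀_null
  have hww := τ.w_null
  have hwp : lorentz τ.w τ.p₀ = 1 := by rw [lorentz_comm, hpw]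
  let L : (Euc N × ℝ × ℝ) →ₗ[ℝ] Mink (N + 1) :=
    τ.A.coprod ((LinearMap.toSpanSingleton ℝ _ τ.p₀).coprod (LinearMap.toSpanSingleton ℝ _ τ.w))
  have hL : ∀ x s t, L (x, s, t) = τ.A x + s • τ.p₀ + t • τ.w := by
    intro x s t
    simp [L, add_assoc]
  have hinj : Function.Injective L := by
    rw [← LinearMap.ker_eq_bot, LinearMap.ker_eq_bot']
    rintro ⟨x, s, t⟩ h
    rw [hL] at h
    have h0 : ∀ Z : Mink (N + 1), lorentz (0 : Mink (N + 1)) Z = 0 := by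
      intro Z; simp [lorentz]
    have h1 := h0 τ.w
    have h2 := h0 τ.p₀
    have h3 := h0 (τ.A x)
    rw [← h] at h1 h2 h3
    simp only [lorentz_add_left, lorentz_smul_left, hAA, hAp, hAw, hpw, hpp, hww, hwp] at h1 h2 h3
    rw [lorentz_comm τ.p₀, lorentz_comm τ.w, hAp, hAw] at h3
    have hs : s = 0 := by linarith
    have ht : t = 0 := by linarith
    have hx : x = 0 := by
      rw [← inner_self_eq_zero (𝕜 := ℝ)]; linarith
    simp [hs, ht, hx]
  have hdim : Module.finrank ℝ (Euc N × ℝ × ℝ) = Module.finrank ℝ (Mink (N + 1)) := by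
    simp [Module.finrank_prod]
  obtain ⟨⟨x, s, t⟩, h⟩ := (LinearMap.injective_iff_surjective_of_finrank_eq_finrank hdim).1 hinj F
  exact ⟨x, s, t, by rw [← h, hL]⟩

/-- `Ψ (proj F) = F / ⟨F, w⟩` for a light-like vector `F` with `⟨F, w⟩ ≠ 0`. -/
theorem LightConeModel.psi_proj {N : ℕ} (τ : LightConeModel N) (F : Mink (N + 1))
    (hF : lorentz F F = 0) (hw : lorentz F τ.w ≠ 0) :
    τ.psi (τ.proj F) = (lorentz F τ.w)⁻¹ • F := by
  obtain ⟨x, s, t, rfl⟩ := τ.exists_decomp F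
  have hwp : lorentz τ.w τ.p₀ = 1 := by rw [lorentz_comm, τ.p₀_w]
  have hpA : ∀ x, lorentz τ.p₀ (τ.A x) = 0 := fun x => by rw [lorentz_comm, τ.A_p₀]
  have hwA : ∀ x, lorentz τ.w (τ.A x) = 0 := fun x => by rw [lorentz_comm, τ.A_w]
  have hs : lorentz (τ.A x + s • τ.p₀ + t • τ.w) τ.w = s := by
    simp only [lorentz_add_left, lorentz_smul_left, τ.A_w, τ.p₀_w, τ.w_null]; ring
  have hp : τ.proj (τ.A x + s • τ.p₀ + t • τ.w) = s⁻¹ • x := by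
    ext i
    simp only [LightConeModel.proj, hs, lorentz_add_left, lorentz_smul_left, hpA, hwA,
      τ.A_isometry, EuclideanSpace.inner_single_right]
    simp
    ring
  rw [hs] at hw ⊢
  rw [hp]
  have hnull : ‖x‖ ^ 2 + 2 * s * t = 0 := by
    simp only [lorentz_add_left, lorentz_smul_left, lorentz_add_right, lorentz_smul_right, hpA, hwA,
      hwp, τ.A_isometry, τ.A_w, τ.A_p₀, τ.p₀_w, τ.p₀_null, τ.w_null,
      real_inner_self_eq_norm_sq] at hF
    linarith
  have hn : (1 / 2) * ‖s⁻¹ • x‖ ^ 2 = -(s⁻¹ * t) := by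
    rw [norm_smul, mul_pow, Real.norm_eq_abs, sq_abs]
    field_simp
    linarith
  simp only [LightConeModel.psi, hn, map_smul, smul_add, smul_smul, inv_mul_cancel₀ hw, one_smul,
    neg_smul, sub_neg_eq_add]
  abel

/-- The data that determine a conformal diffeomorphism `Θ` from `ℍ^{k+1} × 𝕊^m` (without at most
one point, which goes to infinity) onto the complement in `ℝ^N` of a `k`-dimensional sphere or
affine subspace, `N = k + m + 1`: a triple `(p₀, w, A)` and linear isometries `C : 𝕃^{k+2} → V`,
`D : ℝ^{m+1} → W` where `𝕃^{N+2} = V ⊕ W` is an orthogonal decomposition with `V` time-like. -/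
structure ThetaMap (N k m : ℕ) extends LightConeModel N where
  C : Mink (k + 1) →ₗ[ℝ] Mink (N + 1)
  D : Euc (m + 1) →ₗ[ℝ] Mink (N + 1)
  C_isometry : ∀ X X', lorentz (C X) (C X') = lorentz X X'
  D_isometry : ∀ Y Y', lorentz (D Y) (D Y') = inner ℝ Y Y'
  C_D : ∀ X Y, lorentz (C X) (D Y) = 0

/-- The isometric immersion `(X, Y) ↦ C X + D Y` of `ℍ^{k+1} × 𝕊^m` into the light cone. -/
def ThetaMap.lift {N k m : ℕ} (Θ : ThetaMap N k m) (X : Mink (k + 1)) (Y : Euc (m + 1)) :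
    Mink (N + 1) := Θ.C X + Θ.D Y

/-- `Θ` is defined at the point `(X, Y)`, that is, `(X, Y)` is not sent to infinity. -/
def ThetaMap.DefinedAt {N k m : ℕ} (Θ : ThetaMap N k m) (X : Mink (k + 1)) (Y : Euc (m + 1)) :
    Prop := lorentz (Θ.lift X Y) Θ.w ≠ 0

/-- The map `Θ` itself. -/
def ThetaMap.toFun {N k m : ℕ} (Θ : ThetaMap N k m) (X : Mink (k + 1)) (Y : Euc (m + 1)) : Euc N :=
  Θ.toLightConeModel.proj (Θ.lift X Y)

/-- `Ψ (Θ(X, Y))` is the radial projection of `C X + D Y` wherever `Θ` is defined. -/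
theorem ThetaMap.psi_toFun {N k m : ℕ} (Θ : ThetaMap N k m) {X : Mink (k + 1)} {Y : Euc (m + 1)}
    (hX : X ∈ hyperbolic (k + 1)) (hY : Y ∈ unitSphere m) (h : Θ.DefinedAt X Y) :
    Θ.psi (Θ.toFun X Y) = (lorentz (Θ.lift X Y) Θ.w)⁻¹ • Θ.lift X Y := by
  refine Θ.toLightConeModel.psi_proj _ ?_ h
  have hY' : ‖Y‖ = 1 := by simpa using hY
  simp only [ThetaMap.lift, lorentz_add_left, lorentz_add_right, Θ.C_isometry, Θ.D_isometry, Θ.C_D,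
    lorentz_comm (Θ.D Y) (Θ.C X), hX.1, real_inner_self_eq_norm_sq, hY']
  norm_num

/-! ### Cyclides of Dupin -/

section Hypersurfaces

variable {M : Type u} [TopologicalSpace M]

/-- The differential of a vector valued map on an `n`-dimensional manifold. -/
def differential (n : ℕ) [ChartedSpace (Euc n) M] {F : Type*} [NormedAddCommGroup F]
    [NormedSpace ℝ F] (g : M → F) (x : M) : TangentSpace (𝓡 n) x →L[ℝ] F :=
  mfderiv (𝓡 n) 𝓘(ℝ, F) g x

/-- `f` is a smooth immersion of an `n`-dimensional manifold into `ℝ^d`. -/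
def IsSmoothImmersion (n : ℕ) [ChartedSpace (Euc n) M] {d : ℕ} (f : M → Euc d) : Prop :=
  ContMDiff (𝓡 n) 𝓘(ℝ, Euc d) ∞ f ∧ ∀ x, Function.Injective (differential n f x)

/-- `ν` is a smooth unit normal field of the hypersurface `f` on the set `U`. -/
def IsUnitNormalOn (n : ℕ) [ChartedSpace (Euc n) M] {d : ℕ} (f ν : M → Euc d) (U : Set M) : Prop :=
  ContMDiffOn (𝓡 n) 𝓘(ℝ, Euc d) ∞ ν U ∧
  ∀ x ∈ U, ‖ν x‖ = 1 ∧ ∀ t, inner ℝ (ν x) (differential n f x t) = 0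

/-- The eigenspace at `x` of the shape operator `S`, `df ∘ S = -dν`, for the principal
curvature `a`. -/
def principalSpace (n : ℕ) [ChartedSpace (Euc n) M] {d : ℕ} (f ν : M → Euc d) (a : ℝ) (x : M) :
    Submodule ℝ (TangentSpace (𝓡 n) x) :=
  LinearMap.ker ((differential n ν x + a • differential n f x).toLinearMap)

/-- The hypersurface `f : M^n → ℝ^{n+1}` is a cyclide of Dupin of characteristic `(m, k)`: it has
everywhere exactly two distinct principal curvatures, of multiplicities `m` and `k`, and each of
them is constant along its eigenbundle. The unit normal is only chosen locally, so `M` need not be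
orientable. -/
def IsDupinCyclide (n m k : ℕ) [ChartedSpace (Euc n) M] (f : M → Euc (n + 1)) : Prop :=
  0 < m ∧ 0 < k ∧ m + k = n ∧ IsSmoothImmersion n f ∧
  ∀ p : M, ∃ U : Set M, IsOpen U ∧ p ∈ U ∧ ∃ ν : M → Euc (n + 1), IsUnitNormalOn n f ν U ∧
    ∃ a b : M → ℝ, ContMDiffOn (𝓡 n) 𝓘(ℝ, ℝ) ∞ a U ∧ ContMDiffOn (𝓡 n) 𝓘(ℝ, ℝ) ∞ b U ∧
      ∀ x ∈ U, a x ≠ b x ∧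
        Module.finrank ℝ (principalSpace n f ν (a x) x) = m ∧
        Module.finrank ℝ (principalSpace n f ν (b x) x) = k ∧
        (∀ t ∈ principalSpace n f ν (a x) x, differential n a x t = 0) ∧
        (∀ t ∈ principalSpace n f ν (b x) x, differential n b x t = 0)

/-- The map `φ` from `M` (with the metric induced by the immersion `f`) to the Riemannian product
of the `k`-dimensional space form of curvature `c` and of `𝕊^m` is a smooth conformal local
diffeomorphism. -/
def IsConformalLocalDiffeo (n m k : ℕ) (c : ℝ) [ChartedSpace (Euc n) M] {d : ℕ} (f : M → Euc d)
    (φ : M → spaceForm k c × unitSphere m) : Prop :=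
  ContMDiff (𝓡 n) 𝓘(ℝ, Euc k × ℝ) ∞ (fun p => ((φ p).1 : Euc k × ℝ)) ∧
  ContMDiff (𝓡 n) 𝓘(ℝ, Euc (m + 1)) ∞ (fun p => ((φ p).2 : Euc (m + 1))) ∧
  IsLocalHomeomorph φ ∧
  ∃ ρ : M → ℝ, (∀ p, 0 < ρ p) ∧ ∀ (p : M) (t : TangentSpace (𝓡 n) p),
    formOf c (differential n (fun p => ((φ p).1 : Euc k × ℝ)) p t)
        (differential n (fun p => ((φ p).1 : Euc k × ℝ)) p t)
      + ‖differential n (fun p => ((φ p).2 : Euc (m + 1))) p t‖ ^ 2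
      = ρ p ^ 2 * ‖differential n f p t‖ ^ 2

/-- `f` is, up to a conformal reparametrization by an open subset of the product of the
`k`-dimensional space form of curvature `c` and of `𝕊^m`, of the form `Θ ∘ (f₁ × id)`, where `f₁`
is a spherical inclusion into `ℍ^{k+1}`. The reparametrization is given by its inverse `φ`, which
is a local diffeomorphism since `f` need not be injective; if `f` is injective, then `φ` is a
diffeomorphism onto an open subset. -/
def HasNormalForm (n m k : ℕ) (c : ℝ) [ChartedSpace (Euc n) M] (f : M → Euc (n + 1)) : Prop :=
  ∃ (φ : M → spaceForm k c × unitSphere m) (f₁ : Euc k × ℝ → Mink (k + 1))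
    (Θ : ThetaMap (n + 1) k m),
    IsConformalLocalDiffeo n m k c f φ ∧
    (Function.Injective f → Topology.IsOpenEmbedding φ) ∧
    IsSphericalInclusion k c f₁ ∧
    ∀ p, Θ.DefinedAt (f₁ (φ p).1) (φ p).2 ∧ f p = Θ.toFun (f₁ (φ p).1) (φ p).2

end Hypersurfaces

/-! ### Conformal congruence -/

/-- `T` is on the set `S` a conformal (Möbius) transformation of `ℝ^d ∪ {∞}` without a pole in `S`:
a similarity, or an inversion followed by a similarity. -/
def IsMoebiusOn {d : ℕ} (T : Euc d → Euc d) (S : Set (Euc d)) : Prop :=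
  ∃ (r : ℝ) (U : Euc d ≃ₗᵢ[ℝ] Euc d) (b : Euc d), 0 < r ∧
    ((∀ x ∈ S, T x = r • U x + b) ∨
      ∃ a : Euc d, a ∉ S ∧ ∀ x ∈ S, T x = r • U (EuclideanGeometry.inversion a 1 x) + b)

/-- Two connected cyclides `f` and `f'` are conformally congruent if a Möbius transformation carries
a nonempty open piece of `f` to an open piece of `f'`, up to a change of parameters. -/
def ConformallyCongruent {M : Type u} {M' : Type v} [TopologicalSpace M] [TopologicalSpace M']
    {d : ℕ} (f : M → Euc d) (f' : M' → Euc d) : Prop :=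
  ∃ (e : OpenPartialHomeomorph M M') (T : Euc d → Euc d), e.source.Nonempty ∧
    IsMoebiusOn T (f '' e.source) ∧ ∀ x ∈ e.source, f' (e x) = T (f x)

end

end DupinCyclide

/-! In the light cone model a hypersurface `f` has the lift F = Ψ ∘ f, and oriented hyperspheres are
unit vectors of Minkowski space. A sphere K is tangent to `f` at x when K is orthogonal to F(x) and
to the image of dF; the tangent spheres at x are ±K_a + βF. The principal curvatures a, b single out
K_a and K_b = K_a + δF with δ = b - a. The kernel of dK_a consists of the principal vectors for a
along which a is constant (`dif_sphere_eq_zero`), so the condition of Dupin says that the kernels of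
dK_a and dK_b have the complementary dimensions m and k. The lift determines both families up to a
common sign and their order (`CurvPair.unique`).

Locally K_a therefore depends on k coordinates and K_b on the m others, whence ⟨K_a(x), K_b(x')⟩ = 1
for all x, x' (`CurvPair.exists_box`). So the differences of the K_a are orthogonal to those of the
K_b. Orthogonal vectors of Minkowski space that are not space-like are proportional, and this forces
one of the two spans of differences to be Euclidean (`CurvPair.exists_adapted`), say that of the
K_b. Call it range D and let κ be the common component of the K_b orthogonal to it; then K_b ∈ κ +
range D, K_a ⊥ range D and ⟨K_a, κ⟩ = 1 (`Adapted`), and range D has dimension m + 1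
(`Adapted.dim_eq`).

Put c = -⟨κ, κ⟩ and r = √(1 + c). The rescaled lift (K_b - K_a)/r splits as C X + D Y, where Y is a
unit vector and X lies in hyperbolic space and in the hyperplane ⟨X, ξ⟩ = -r, with C ξ = κ. This
hyperplane section is the image of a spherical inclusion with unit normal ξ - rX
(`isSphericalInclusion_stdIncl`, `stdInv_mem`), and the splitting is the normal form. On a connected
manifold one pair (D, κ) serves everywhere by unique continuation (`Adapted.extend`,
`hasNormalForm_of_adapted`). Conversely every such product immersion has the two curvature spheres
C(ξ - rX) and C ξ + r D Y (`ProductImm.curvPair`), which yields the examples.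

A Möbius transformation is a change of the light cone model, so congruent cyclides have adapted
pairs for the same lift. If the order of the curvature spheres is kept, then ⟨κ, κ⟩ is the same; if
it is reversed, the vectors κ, κ' are proportional with product ±1, so that cc' = 1
(`eq_or_mul_eq_one_of_adapted`). In the other direction, for c > 0 the reversed pair is adapted to
κ/c, which replaces c by 1/c (`Adapted.exists_swap`). Two lifts with equal m and c can be put into a
standard position where the maps (X, Y) parametrize neighbourhoods of the same point in the same
set, and a linear isometry matches them (`StandardAt.conformallyCongruent`). -/

namespace DupinCyclide

noncomputable section

/-! ### Linear algebra in Minkowski space -/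

section Linear

variable {d j k m : ℕ}

/-- The Lorentz scalar product as a bilinear form. -/
def lorentzForm (d : ℕ) : LinearMap.BilinForm ℝ (Mink d) :=
  LinearMap.mk₂ ℝ lorentz lorentz_add_left lorentz_smul_left lorentz_add_right lorentz_smul_right

theorem lorentzForm_apply (X Y : Mink d) : lorentzForm d X Y = lorentz X Y := rfl

theorem lorentz_zero_left (X : Mink d) : lorentz 0 X = 0 := by simp [lorentz]

theorem lorentz_zero_right (X : Mink d) : lorentz X 0 = 0 := by simp [lorentz]

theorem lorentz_neg_left (X Y : Mink d) : lorentz (-X) Y = -lorentz X Y := by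
  simp only [lorentz, Prod.fst_neg, Prod.snd_neg, inner_neg_left]; ring

theorem lorentz_neg_right (X Y : Mink d) : lorentz X (-Y) = -lorentz X Y := by
  rw [lorentz_comm, lorentz_neg_left, lorentz_comm]

theorem lorentz_sub_left (X Y Z : Mink d) : lorentz (X - Y) Z = lorentz X Z - lorentz Y Z := by
  rw [sub_eq_add_neg, lorentz_add_left, lorentz_neg_left]; ring

theorem lorentz_sub_right (X Y Z : Mink d) : lorentz X (Y - Z) = lorentz X Y - lorentz X Z := by
  rw [sub_eq_add_neg, lorentz_add_right, lorentz_neg_right]; ring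

theorem lorentz_nondegenerate {v : Mink d} (h : ∀ X, lorentz v X = 0) : v = 0 := by
  -- Reflecting the time coordinate turns the Lorentz square into the Euclidean one.
  have := h (v.1, -v.2)
  simp only [lorentz, real_inner_self_eq_norm_sq] at this
  have h1 : ‖v.1‖ ^ 2 = 0 := by nlinarith [sq_nonneg ‖v.1‖, sq_nonneg v.2]
  have h2 : v.2 ^ 2 = 0 := by nlinarith [sq_nonneg ‖v.1‖, sq_nonneg v.2]
  ext1
  · simpa using h1
  · simpa using h2

theorem lorentzForm_nondegenerate (d : ℕ) : (lorentzForm d).Nondegenerate :=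
  ⟨fun _ h => lorentz_nondegenerate h, fun v h => lorentz_nondegenerate fun X => by
    rw [lorentz_comm]; exact h X⟩

theorem finrank_mink (d : ℕ) : Module.finrank ℝ (Mink d) = d + 1 := by simp

/-- Two orthogonal vectors that are not space-like are proportional. -/
theorem eq_smul_of_nonpos {v w : Mink d} (hv : lorentz v v ≤ 0) (hw : lorentz w w ≤ 0)
    (h : lorentz v w = 0) (hv0 : v ≠ 0) : v.2 ≠ 0 ∧ w = (w.2 / v.2) • v := by
  have hs : v.2 ≠ 0 := by
    intro hs
    apply hv0
    simp only [lorentz, hs, real_inner_self_eq_norm_sq] at hv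
    have h1 : ‖v.1‖ ^ 2 = 0 := by nlinarith [sq_nonneg ‖v.1‖]
    ext1
    · simpa using h1
    · exact hs
  refine ⟨hs, ?_⟩
  -- The multiple of `v` removes the time coordinate, so `w'` has nonnegative square; by
  -- orthogonality that square is also a sum of two nonpositive terms.
  set w' := w - (w.2 / v.2) • v with hw'
  have h2 : w'.2 = 0 := by
    simp only [hw', Prod.snd_sub, Prod.smul_snd, smul_eq_mul]; field_simp; ring
  have h3 : lorentz w' w' = lorentz w w + (w.2 / v.2) ^ 2 * lorentz v v := by
    simp only [hw', lorentz_sub_left, lorentz_sub_right, lorentz_smul_left, lorentz_smul_right,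
      lorentz_comm w v, h]
    ring
  have h4 : lorentz w' w' = ‖w'.1‖ ^ 2 := by
    simp only [lorentz, h2, real_inner_self_eq_norm_sq]; ring
  have h5 : ‖w'.1‖ ^ 2 = 0 := by
    have : (w.2 / v.2) ^ 2 * lorentz v v ≤ 0 := mul_nonpos_of_nonneg_of_nonpos (sq_nonneg _) hv
    nlinarith [sq_nonneg ‖w'.1‖]
  have : w' = 0 := by
    ext1
    · simpa using h5
    · exact h2
  rwa [hw', sub_eq_zero] at this

/-- A nonzero vector orthogonal to a time-like vector is space-like. -/
theorem lorentz_pos_of_orthogonal {T u : Mink d} (hT : lorentz T T < 0) (h : lorentz u T = 0)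
    (hu : u ≠ 0) : 0 < lorentz u u := by
  by_contra! hc
  have hT0 : T ≠ 0 := by rintro rfl; simp [lorentz_zero_left] at hT
  obtain ⟨-, h2⟩ := eq_smul_of_nonpos hT.le hc (by rw [lorentz_comm, h]) hT0
  rw [h2, lorentz_smul_left] at h
  rcases mul_eq_zero.1 h with h | h
  · rw [h, zero_smul] at h2; exact hu h2
  · exact hT.ne h

/-- In a hyperplane the orthogonal complement is spanned by any of its nonzero vectors. -/
theorem exists_eq_smul_of_orthogonal (S : Submodule ℝ (Mink d)) (hS : d ≤ Module.finrank ℝ S)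
    {F v : Mink d} (hF0 : F ≠ 0) (hF : ∀ s ∈ S, lorentz s F = 0) (hv : ∀ s ∈ S, lorentz s v = 0) :
    ∃ β : ℝ, v = β • F := by
  have h1 := LinearMap.BilinForm.finrank_orthogonal (lorentzForm_nondegenerate d) S
  rw [finrank_mink] at h1
  have hFm : F ∈ (lorentzForm d).orthogonal S := fun s hs => hF s hs
  have hvm : v ∈ (lorentzForm d).orthogonal S := fun s hs => hv s hs
  have h2 : Module.finrank ℝ ((lorentzForm d).orthogonal S) = 1 := by
    have : Nontrivial ((lorentzForm d).orthogonal S) :=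
      ⟨⟨F, hFm⟩, 0, fun h => hF0 (congrArg Subtype.val h)⟩
    have := Module.finrank_pos (R := ℝ) (M := (lorentzForm d).orthogonal S)
    omega
  obtain ⟨β, hβ⟩ := (finrank_eq_one_iff_of_nonzero' (⟨F, hFm⟩ : (lorentzForm d).orthogonal S)
    (fun h => hF0 (congrArg Subtype.val h))).1 h2 ⟨v, hvm⟩
  exact ⟨β, (congrArg Subtype.val hβ).symm⟩

/-- A subspace on which the Lorentz product is positive definite is isometric to `ℝ^j`. -/
theorem exists_isometry_of_pos (W : Submodule ℝ (Mink d)) (hj : Module.finrank ℝ W = j)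
    (hW : ∀ w ∈ W, w ≠ 0 → 0 < lorentz w w) :
    ∃ D : Euc j →ₗ[ℝ] Mink d, (∀ y y', lorentz (D y) (D y') = inner ℝ y y') ∧
      LinearMap.range D = W := by
  subst hj
  obtain ⟨v, hv⟩ := LinearMap.BilinForm.exists_orthogonal_basis
    (B := (lorentzForm d).restrict W) (by
      refine ⟨fun x y => ?_⟩
      exact lorentz_comm (x : Mink d) (y : Mink d))
  have hort : ∀ i i', i ≠ i' → lorentz (v i : Mink d) (v i' : Mink d) = 0 := by
    intro i i' h
    exact hv h
  have hpos : ∀ i, 0 < lorentz (v i : Mink d) (v i : Mink d) := fun i =>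
    hW _ (v i).2 fun h => v.ne_zero i (Subtype.ext h)
  let a : Fin (Module.finrank ℝ W) → Mink d := fun i =>
    (Real.sqrt (lorentz (v i : Mink d) (v i : Mink d)))⁻¹ • (v i : Mink d)
  have haa : ∀ i i', lorentz (a i) (a i') = if i = i' then 1 else 0 := by
    intro i i'
    simp only [a, lorentz_smul_left, lorentz_smul_right]
    split_ifs with h
    · subst h
      have := Real.sqrt_pos.2 (hpos i)
      have h2 := Real.mul_self_sqrt (hpos i).le
      field_simp
      rw [sq, h2]
    · rw [hort i i' h]; ring
  let D : Euc (Module.finrank ℝ W) →ₗ[ℝ] Mink d :=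
    (Fintype.linearCombination ℝ a) ∘ₗ (EuclideanSpace.equiv _ ℝ).toLinearEquiv.toLinearMap
  have hD : ∀ y, D y = ∑ i, y i • a i := fun y => by
    simp [D, Fintype.linearCombination_apply]
  refine ⟨D, fun y y' => ?_, ?_⟩
  · rw [hD, hD, ← lorentzForm_apply]
    simp only [map_sum, LinearMap.sum_apply, map_smul, LinearMap.smul_apply, lorentzForm_apply,
      haa, smul_eq_mul]
    simp [PiLp.inner_apply, mul_comm]
  · apply le_antisymm
    · rintro _ ⟨y, rfl⟩
      rw [hD]
      exact W.sum_mem fun i _ => W.smul_mem _ (W.smul_mem _ (v i).2)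
    · intro w hw
      have hmem : ∀ i, (v i : Mink d) ∈ LinearMap.range D := by
        intro i
        refine ⟨Real.sqrt (lorentz (v i : Mink d) (v i : Mink d)) • EuclideanSpace.single i 1, ?_⟩
        rw [map_smul, hD]
        simp [a, smul_smul, (Real.sqrt_pos.2 (hpos i)).ne']
      have := v.sum_repr ⟨w, hw⟩
      have h2 : w = ∑ i, v.repr ⟨w, hw⟩ i • (v i : Mink d) := by
        conv_lhs => rw [show w = ((⟨w, hw⟩ : W) : Mink d) from rfl, ← this]
        rw [Submodule.coe_sum]
        rfl
      rw [h2]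
      exact Submodule.sum_mem _ fun i _ => Submodule.smul_mem _ _ (hmem i)

/-- The Lorentz adjoint of a linear map from a Euclidean space. -/
def coadj (D : Euc j →ₗ[ℝ] Mink d) : Mink d →ₗ[ℝ] Euc j where
  toFun v := WithLp.toLp 2 fun i => lorentz v (D (EuclideanSpace.single i 1))
  map_add' u v := by ext i; simp [lorentz_add_left]
  map_smul' r v := by ext i; simp [lorentz_smul_left]

theorem inner_coadj (D : Euc j →ₗ[ℝ] Mink d) (v : Mink d) (y : Euc j) :
    inner ℝ (coadj D v) y = lorentz v (D y) := by
  have hy : y = ∑ i, y i • EuclideanSpace.single i (1 : ℝ) := by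
    ext l
    simp [Finset.sum_apply, Pi.single_apply]
  conv_rhs => rw [hy]
  rw [← lorentzForm_apply]
  simp only [map_sum, map_smul, lorentzForm_apply, smul_eq_mul, PiLp.inner_apply, coadj]
  simp

theorem coadj_eq_zero {D : Euc j →ₗ[ℝ] Mink d} {v : Mink d} (h : ∀ y, lorentz v (D y) = 0) :
    coadj D v = 0 := by
  rw [← inner_self_eq_zero (𝕜 := ℝ), inner_coadj, h]

theorem coadj_apply_self {D : Euc j →ₗ[ℝ] Mink d}
    (hD : ∀ y y', lorentz (D y) (D y') = inner ℝ y y') (y : Euc j) : coadj D (D y) = y := by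
  apply ext_inner_right ℝ
  intro z
  rw [inner_coadj, hD]

theorem isometry_injective {D : Euc j →ₗ[ℝ] Mink d}
    (hD : ∀ y y', lorentz (D y) (D y') = inner ℝ y y') : Function.Injective D :=
  Function.LeftInverse.injective (coadj_apply_self hD)

/-- The Lorentz adjoint of a linear map between Minkowski spaces. -/
def coadjM (C : Mink j →ₗ[ℝ] Mink d) : Mink d →ₗ[ℝ] Mink j :=
  -- The time direction has square -1, hence the sign of the last component.
  (coadj (C ∘ₗ LinearMap.inl ℝ (Euc j) ℝ)).prod (-((lorentzForm d).flip (C (0, 1))))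

theorem lorentz_coadjM (C : Mink j →ₗ[ℝ] Mink d) (v : Mink d) (X : Mink j) :
    lorentz (coadjM C v) X = lorentz v (C X) := by
  obtain ⟨x, t⟩ := X
  have h : ((x, t) : Mink j) = (x, 0) + t • (0, 1) := by simp
  conv_rhs => rw [h, map_add, map_smul, lorentz_add_right, lorentz_smul_right]
  have h1 : (coadjM C v).1 = coadj (C ∘ₗ LinearMap.inl ℝ (Euc j) ℝ) v := rfl
  have h2 : (coadjM C v).2 = -lorentz v (C (0, 1)) := by
    simp [coadjM, lorentzForm_apply]
  rw [lorentz, h1, h2, inner_coadj]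
  simp; ring

theorem coadjM_apply_self {C : Mink j →ₗ[ℝ] Mink d}
    (hC : ∀ y y', lorentz (C y) (C y') = lorentz y y') (y : Mink j) : coadjM C (C y) = y := by
  rw [← sub_eq_zero]
  apply lorentz_nondegenerate
  intro z
  rw [lorentz_sub_left, lorentz_coadjM, hC, sub_self]

theorem isometryM_injective {C : Mink j →ₗ[ℝ] Mink d}
    (hC : ∀ y y', lorentz (C y) (C y') = lorentz y y') : Function.Injective C :=
  Function.LeftInverse.injective (coadjM_apply_self hC)

/-- Orthogonal decomposition along the ranges of two isometries of complementary dimensions. -/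
theorem eq_add_coadj {C : Mink k →ₗ[ℝ] Mink d} {D : Euc j →ₗ[ℝ] Mink d}
    (hC : ∀ y y', lorentz (C y) (C y') = lorentz y y')
    (hD : ∀ y y', lorentz (D y) (D y') = inner ℝ y y')
    (hCD : ∀ X Y, lorentz (C X) (D Y) = 0) (hd : k + j = d) (v : Mink d) :
    v = C (coadjM C v) + D (coadj D v) := by
  have hinj : Function.Injective (C.coprod D) := by
    rw [← LinearMap.ker_eq_bot, LinearMap.ker_eq_bot']
    rintro ⟨X, Y⟩ h
    change C X + D Y = 0 at h
    have h1 : X = 0 := by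
      apply lorentz_nondegenerate
      intro X'
      have : lorentz (C X + D Y) (C X') = 0 := by rw [h, lorentz_zero_left]
      rwa [lorentz_add_left, hC, lorentz_comm (D Y), hCD, add_zero] at this
    subst h1
    rw [map_zero, zero_add] at h
    have := isometry_injective hD (h.trans (map_zero D).symm)
    rw [this]; rfl
  have hsurj := (LinearMap.injective_iff_surjective_of_finrank_eq_finrank (f := C.coprod D)
    (by simp; omega)).1 hinj
  obtain ⟨⟨X, Y⟩, rfl⟩ := hsurj v
  change C X + D Y = C (coadjM C (C X + D Y)) + D (coadj D (C X + D Y))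
  rw [map_add, map_add, map_add, coadjM_apply_self hC, coadj_apply_self hD]
  rw [coadj_eq_zero (v := C X) (hCD X)]
  have : coadjM C (D Y) = 0 := lorentz_nondegenerate fun X' => by
    rw [lorentz_coadjM, lorentz_comm, hCD]
  rw [this]; simp

/-- The isometries of Euclidean space act transitively on the unit sphere. -/
theorem exists_linearIsometryEquiv_apply_eq {a b : Euc j} (h : ‖a‖ = ‖b‖) :
    ∃ U : Euc j ≃ₗᵢ[ℝ] Euc j, U a = b :=
  ⟨_, Submodule.reflection_sub h⟩

/-- An isometry of `𝕃^{k+2}` onto the orthogonal complement of a Euclidean subspace with two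
prescribed values. -/
theorem exists_frame {D : Euc m →ₗ[ℝ] Mink d}
    (hD : ∀ y y', lorentz (D y) (D y') = inner ℝ y y') (hd : k + 1 + m = d) {X₀ ν₀ : Mink d}
    (hX : lorentz X₀ X₀ = -1) (hν : lorentz ν₀ ν₀ = 1) (hXν : lorentz ν₀ X₀ = 0)
    (hXD : ∀ y, lorentz X₀ (D y) = 0) (hνD : ∀ y, lorentz ν₀ (D y) = 0) :
    ∃ C : Mink (k + 1) →ₗ[ℝ] Mink d, (∀ X X', lorentz (C X) (C X') = lorentz X X') ∧
      (∀ X y, lorentz (C X) (D y) = 0) ∧ C (0, 1) = X₀ ∧ C (EuclideanSpace.single 0 1, 0) = ν₀ := by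
  let G : Euc m × ℝ →ₗ[ℝ] Mink d := D.coprod (LinearMap.toSpanSingleton ℝ _ X₀)
  have hG : ∀ y s, G (y, s) = D y + s • X₀ := fun y s => by simp [G]
  have hGinj : Function.Injective G := by
    rw [← LinearMap.ker_eq_bot, LinearMap.ker_eq_bot']
    rintro ⟨y, s⟩ h
    rw [hG] at h
    have h1 : lorentz (D y + s • X₀) X₀ = 0 := by rw [h, lorentz_zero_left]
    rw [lorentz_add_left, lorentz_comm (D y), hXD, lorentz_smul_left, hX] at h1
    have hs : s = 0 := by linarith
    subst hs
    rw [zero_smul, add_zero] at h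
    have := isometry_injective hD (h.trans (map_zero D).symm)
    rw [this]; rfl
  set S := LinearMap.range G with hS
  have hSf : Module.finrank ℝ S = m + 1 := by
    rw [hS, LinearMap.finrank_range_of_inj hGinj]; simp
  have hUf := LinearMap.BilinForm.finrank_orthogonal (lorentzForm_nondegenerate d) S
  rw [finrank_mink, hSf] at hUf
  have hmem : ∀ u, u ∈ (lorentzForm d).orthogonal S ↔
      lorentz u X₀ = 0 ∧ ∀ y, lorentz u (D y) = 0 := by
    intro u
    constructor
    · intro h
      constructor
      · have := h _ ⟨((0 : Euc m), (1 : ℝ)), rfl⟩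
        rw [hG, map_zero, zero_add, one_smul] at this
        rw [lorentz_comm]; exact this
      · intro y
        have := h _ ⟨(y, (0 : ℝ)), rfl⟩
        rw [hG, zero_smul, add_zero] at this
        rw [lorentz_comm]; exact this
    · rintro ⟨h1, h2⟩ _ ⟨⟨y, s⟩, rfl⟩
      rw [hG]
      change lorentz _ _ = 0
      rw [lorentz_comm, lorentz_add_right, lorentz_smul_right, h1, h2]; ring
  -- The complement of `S` is orthogonal to the time-like `X₀`, hence Euclidean, and has dimension k
  -- + 1.
  obtain ⟨E, hE, hEr⟩ := exists_isometry_of_pos (j := k + 1) _ (by rw [hUf]; omega)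
    (fun u hu h0 => lorentz_pos_of_orthogonal (by rw [hX]; norm_num) ((hmem u).1 hu).1 h0)
  have hν' : ν₀ ∈ LinearMap.range E := by rw [hEr, hmem]; exact ⟨hXν, hνD⟩
  obtain ⟨y₀, hy₀⟩ := hν'
  -- `ν₀` is a unit vector of this Euclidean complement; a rotation moves the first basis vector
  -- onto it.
  have hy1 : ‖(EuclideanSpace.single 0 1 : Euc (k + 1))‖ = ‖y₀‖ := by
    have : ‖y₀‖ ^ 2 = 1 := by rw [← real_inner_self_eq_norm_sq, ← hE, hy₀, hν]
    have h2 : ‖y₀‖ = 1 := by nlinarith [norm_nonneg y₀]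
    rw [h2]; simp
  obtain ⟨U, hU⟩ := exists_linearIsometryEquiv_apply_eq hy1
  have hEo : ∀ y, lorentz (E y) X₀ = 0 ∧ ∀ z, lorentz (E y) (D z) = 0 := fun y =>
    (hmem _).1 (by rw [← hEr]; exact ⟨y, rfl⟩)
  let C : Mink (k + 1) →ₗ[ℝ] Mink d :=
    (E ∘ₗ U.toLinearEquiv.toLinearMap).coprod (LinearMap.toSpanSingleton ℝ _ X₀)
  have hCv : ∀ x s, C (x, s) = E (U x) + s • X₀ := fun y s => by simp [C]
  refine ⟨C, ?_, ?_, ?_, ?_⟩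
  · rintro ⟨x, s⟩ ⟨x', s'⟩
    rw [hCv, hCv]
    simp only [lorentz_add_left, lorentz_add_right, lorentz_smul_left, lorentz_smul_right, hE,
      (hEo _).1, lorentz_comm X₀ (E _), hX, LinearIsometryEquiv.inner_map_map]
    simp only [lorentz]; ring
  · rintro ⟨x, s⟩ y
    rw [hCv, lorentz_add_left, lorentz_smul_left, (hEo _).2, hXD]; ring
  · rw [hCv]; simp
  · rw [hCv, hU, hy₀]; simp

end Linear

/-! ### Calculus for vector valued maps on a manifold -/

section Calculus

open Topology Filter

variable {M : Type u} [TopologicalSpace M] {n : ℕ} [ChartedSpace (Euc n) M]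
  {F G H : Type*} [NormedAddCommGroup F] [NormedSpace ℝ F] [NormedAddCommGroup G]
  [NormedSpace ℝ G] [NormedAddCommGroup H] [NormedSpace ℝ H]

/-- The differential as a linear map on `ℝ^n`. -/
def dif (n : ℕ) [ChartedSpace (Euc n) M] (g : M → F) (x : M) : Euc n →L[ℝ] F := differential n g x

/-- `g` has the differential `g'` at `x`. -/
def HasD (n : ℕ) [ChartedSpace (Euc n) M] (g : M → F) (x : M) (g' : Euc n →L[ℝ] F) : Prop :=
  HasMFDerivAt (𝓡 n) 𝓘(ℝ, F) g x g'

/-- `g` is smooth at `x`. -/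
abbrev SmAt (n : ℕ) [ChartedSpace (Euc n) M] (g : M → F) (x : M) : Prop :=
  ContMDiffAt (𝓡 n) 𝓘(ℝ, F) ∞ g x

/-- The model has no boundary and the target is its own chart, so the rules of calculus below reduce
to those for Fréchet derivatives in the chart at `x`. -/
theorem hasD_iff {g : M → F} {x : M} {g' : Euc n →L[ℝ] F} : HasD n g x g' ↔
    ContinuousAt g x ∧
      HasFDerivAt (g ∘ (extChartAt (𝓡 n) x).symm) g' (extChartAt (𝓡 n) x x) := by
  simp only [HasD, HasMFDerivAt, writtenInExtChartAt, extChartAt_model_space_eq_id,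
    modelWithCornersSelf_coe, Set.range_id]
  exact and_congr Iff.rfl hasFDerivWithinAt_univ

theorem HasD.dif_eq {g : M → F} {x : M} {g' : Euc n →L[ℝ] F} (h : HasD n g x g') :
    dif n g x = g' := HasMFDerivAt.mfderiv h

theorem SmAt.hasD {g : M → F} {x : M} (h : SmAt n g x) : HasD n g x (dif n g x) :=
  (ContMDiffAt.mdifferentiableAt h (by simp)).hasMFDerivAt

theorem HasD.congr {g g₁ : M → F} {x : M} {g' : Euc n →L[ℝ] F} (h : HasD n g x g')
    (h₁ : g₁ =ᶠ[𝓝 x] g) : HasD n g₁ x g' := HasMFDerivAt.congr_of_eventuallyEq h h₁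

theorem dif_congr {g g₁ : M → F} {x : M} (h₁ : g₁ =ᶠ[𝓝 x] g) : dif n g₁ x = dif n g x :=
  Filter.EventuallyEq.mfderiv_eq h₁

theorem HasD.comp {g : M → F} {x : M} {g' : Euc n →L[ℝ] F} (h : HasD n g x g') {P : F → G}
    {P' : F →L[ℝ] G} (hP : HasFDerivAt P P' (g x)) : HasD n (fun y => P (g y)) x (P'.comp g') := by
  rw [hasD_iff] at h ⊢
  refine ⟨hP.continuousAt.comp h.1, ?_⟩
  have h2 := h.2
  exact HasFDerivAt.comp (g := P) (f := g ∘ (extChartAt (𝓡 n) x).symm) _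
    (by simpa using hP) h2

theorem HasD.prodMk {g : M → F} {h : M → G} {x : M} {g' : Euc n →L[ℝ] F} {h' : Euc n →L[ℝ] G}
    (hg : HasD n g x g') (hh : HasD n h x h') :
    HasD n (fun y => (g y, h y)) x (g'.prod h') := by
  rw [hasD_iff] at hg hh ⊢
  exact ⟨hg.1.prodMk hh.1, hg.2.prodMk hh.2⟩

theorem hasD_const (c : F) (x : M) : HasD n (fun _ : M => c) x 0 := hasMFDerivAt_const c x

theorem HasD.add {g h : M → F} {x : M} {g' h' : Euc n →L[ℝ] F}
    (hg : HasD n g x g') (hh : HasD n h x h') : HasD n (fun y => g y + h y) x (g' + h') := by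
  rw [hasD_iff] at hg hh ⊢
  exact ⟨hg.1.add hh.1, hg.2.add hh.2⟩

theorem HasD.neg {g : M → F} {x : M} {g' : Euc n →L[ℝ] F}
    (hg : HasD n g x g') : HasD n (fun y => -g y) x (-g') := by
  rw [hasD_iff] at hg ⊢
  exact ⟨hg.1.neg, hg.2.neg⟩

theorem HasD.sub {g h : M → F} {x : M} {g' h' : Euc n →L[ℝ] F}
    (hg : HasD n g x g') (hh : HasD n h x h') : HasD n (fun y => g y - h y) x (g' - h') := by
  rw [hasD_iff] at hg hh ⊢
  exact ⟨hg.1.sub hh.1, hg.2.sub hh.2⟩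

theorem HasD.const_smul {g : M → F} {x : M} {g' : Euc n →L[ℝ] F}
    (hg : HasD n g x g') (r : ℝ) : HasD n (fun y => r • g y) x (r • g') := by
  rw [hasD_iff] at hg ⊢
  exact ⟨hg.1.const_smul r, hg.2.const_smul r⟩

theorem HasD.smul {a : M → ℝ} {g : M → F} {x : M} {a' : Euc n →L[ℝ] ℝ} {g' : Euc n →L[ℝ] F}
    (ha : HasD n a x a') (hg : HasD n g x g') :
    HasD n (fun y => a y • g y) x (a x • g' + a'.smulRight (g x)) := by
  rw [hasD_iff] at ha hg ⊢
  refine ⟨ha.1.smul hg.1, ?_⟩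
  have := HasFDerivAt.smul ha.2 hg.2
  simp only [Function.comp_apply, extChartAt_to_inv] at this
  exact this

theorem HasD.clm {g : M → F} {x : M} {g' : Euc n →L[ℝ] F}
    (hg : HasD n g x g') (L : F →L[ℝ] G) : HasD n (fun y => L (g y)) x (L.comp g') :=
  hg.comp L.hasFDerivAt

/-- The continuous version of a linear map. -/
abbrev toCLM [FiniteDimensional ℝ F] (L : F →ₗ[ℝ] G) : F →L[ℝ] G := LinearMap.toContinuousLinearMap L

theorem HasD.linear [FiniteDimensional ℝ F] {g : M → F} {x : M} {g' : Euc n →L[ℝ] F}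
    (hg : HasD n g x g') (L : F →ₗ[ℝ] G) : HasD n (fun y => L (g y)) x ((toCLM L).comp g') :=
  hg.clm (toCLM L)

/-- The Lorentz product as a continuous bilinear map. -/
def lorentzCLM (d : ℕ) : Mink d →L[ℝ] Mink d →L[ℝ] ℝ :=
  LinearMap.toContinuousLinearMap
    ((LinearMap.toContinuousLinearMap : (Mink d →ₗ[ℝ] ℝ) ≃ₗ[ℝ] _).toLinearMap ∘ₗ lorentzForm d)

theorem hasFDerivAt_lorentz {d : ℕ} (p : Mink d × Mink d) :
    HasFDerivAt (fun q : Mink d × Mink d => lorentz q.1 q.2)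
      ((lorentzCLM d).deriv₂ p) p :=
  (lorentzCLM d).isBoundedBilinearMap.hasFDerivAt p

theorem contDiff_lorentz {d : ℕ} : ContDiff ℝ ∞ (fun q : Mink d × Mink d => lorentz q.1 q.2) :=
  (lorentzCLM d).isBoundedBilinearMap.contDiff

theorem HasD.lorentz {d : ℕ} {g h : M → Mink d} {x : M} {g' h' : Euc n →L[ℝ] Mink d}
    (hg : HasD n g x g') (hh : HasD n h x h') :
    HasD n (fun y => lorentz (g y) (h y)) x
      (((lorentzCLM d) (g x)).comp h' + ((lorentzCLM d).flip (h x)).comp g') := by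
  have := (hg.prodMk hh).comp (hasFDerivAt_lorentz (g x, h x))
  convert this using 1
  ext t
  rfl

theorem HasD.inner {j : ℕ} {g h : M → Euc j} {x : M} {g' h' : Euc n →L[ℝ] Euc j}
    (hg : HasD n g x g') (hh : HasD n h x h') :
    HasD n (fun y => inner ℝ (g y) (h y)) x
      (((innerSL ℝ) (g x)).comp h' + ((innerSL ℝ) (h x)).comp g') := by
  have := (hg.prodMk hh).comp (isBoundedBilinearMap_inner (𝕜 := ℝ) (E := Euc j)
    |>.hasFDerivAt (g x, h x))
  convert this using 1
  ext t
  simp [real_inner_comm (h x)]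

/-- Differentiating the equation `⟨g, h⟩ = const`. -/
theorem lorentz_dif_of_const {d : ℕ} {g h : M → Mink d} {x : M} {g' h' : Euc n →L[ℝ] Mink d}
    (hg : HasD n g x g') (hh : HasD n h x h') {c : ℝ}
    (hc : ∀ᶠ y in 𝓝 x, lorentz (g y) (h y) = c) (t : Euc n) :
    lorentz (g x) (h' t) + lorentz (g' t) (h x) = 0 := by
  have h1 := (hg.lorentz hh).dif_eq
  have h2 : dif n (fun y => DupinCyclide.lorentz (g y) (h y)) x = 0 := by
    rw [dif_congr (g := fun _ => c) hc]; exact (hasD_const c x).dif_eq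
  rw [h1] at h2
  exact DFunLike.congr_fun h2 t

/-- Differentiating the equation `⟨g, h⟩ = const` in Euclidean space. -/
theorem inner_dif_of_const {j : ℕ} {g h : M → Euc j} {x : M} {g' h' : Euc n →L[ℝ] Euc j}
    (hg : HasD n g x g') (hh : HasD n h x h') {c : ℝ}
    (hc : ∀ᶠ y in 𝓝 x, inner ℝ (g y) (h y) = c) (t : Euc n) :
    inner ℝ (g x) (h' t) + inner ℝ (h x) (g' t) = 0 := by
  have h1 := (hg.inner hh).dif_eq
  have h2 : dif n (fun y => Inner.inner ℝ (g y) (h y)) x = 0 := by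
    rw [dif_congr (g := fun _ => c) hc]; exact (hasD_const c x).dif_eq
  rw [h1] at h2
  exact DFunLike.congr_fun h2 t

theorem SmAt.comp {g : M → F} {x : M} (hg : SmAt n g x) {P : F → G}
    (hP : ContDiffAt ℝ ∞ P (g x)) : SmAt n (fun y => P (g y)) x :=
  ContMDiffAt.comp x hP.contMDiffAt hg

theorem SmAt.prodMk {g : M → F} {h : M → G} {x : M} (hg : SmAt n g x) (hh : SmAt n h x) :
    SmAt n (fun y => (g y, h y)) x := ContMDiffAt.prodMk_space hg hh

theorem smAt_const (c : F) (x : M) : SmAt n (fun _ : M => c) x := contMDiffAt_const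

theorem SmAt.add {g h : M → F} {x : M} (hg : SmAt n g x) (hh : SmAt n h x) :
    SmAt n (fun y => g y + h y) x :=
  (hg.prodMk hh).comp (P := fun q : F × F => q.1 + q.2) (by fun_prop)

theorem SmAt.sub {g h : M → F} {x : M} (hg : SmAt n g x) (hh : SmAt n h x) :
    SmAt n (fun y => g y - h y) x :=
  (hg.prodMk hh).comp (P := fun q : F × F => q.1 - q.2) (by fun_prop)

theorem SmAt.neg {g : M → F} {x : M} (hg : SmAt n g x) : SmAt n (fun y => -g y) x :=
  hg.comp (P := fun q : F => -q) (by fun_prop)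

theorem SmAt.const_smul {g : M → F} {x : M} (hg : SmAt n g x) (r : ℝ) :
    SmAt n (fun y => r • g y) x :=
  hg.comp (P := fun q : F => r • q) (by fun_prop)

theorem SmAt.smul {a : M → ℝ} {g : M → F} {x : M} (ha : SmAt n a x) (hg : SmAt n g x) :
    SmAt n (fun y => a y • g y) x :=
  (ha.prodMk hg).comp (P := fun q : ℝ × F => q.1 • q.2) (by fun_prop)

theorem SmAt.inv {a : M → ℝ} {x : M} (ha : SmAt n a x) (h : a x ≠ 0) :
    SmAt n (fun y => (a y)⁻¹) x :=
  ha.comp (P := fun q : ℝ => q⁻¹) (contDiffAt_inv ℝ h)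

theorem SmAt.clm {g : M → F} {x : M} (hg : SmAt n g x) (L : F →L[ℝ] G) :
    SmAt n (fun y => L (g y)) x :=
  hg.comp L.contDiff.contDiffAt

theorem SmAt.linear [FiniteDimensional ℝ F] {g : M → F} {x : M} (hg : SmAt n g x)
    (L : F →ₗ[ℝ] G) : SmAt n (fun y => L (g y)) x := hg.clm (toCLM L)

theorem SmAt.lorentz {d : ℕ} {g h : M → Mink d} {x : M} (hg : SmAt n g x) (hh : SmAt n h x) :
    SmAt n (fun y => lorentz (g y) (h y)) x :=
  (hg.prodMk hh).comp contDiff_lorentz.contDiffAt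

theorem SmAt.inner {j : ℕ} {g h : M → Euc j} {x : M} (hg : SmAt n g x) (hh : SmAt n h x) :
    SmAt n (fun y => inner ℝ (g y) (h y)) x :=
  (hg.prodMk hh).comp (P := fun q : Euc j × Euc j => Inner.inner ℝ q.1 q.2)
    contDiff_inner.contDiffAt

theorem SmAt.norm {j : ℕ} {g : M → Euc j} {x : M} (hg : SmAt n g x) (h : g x ≠ 0) :
    SmAt n (fun y => ‖g y‖) x :=
  hg.comp (P := fun q : Euc j => ‖q‖) (contDiffAt_norm ℝ h)

theorem SmAt.congr {g g₁ : M → F} {x : M} (hg : SmAt n g x) (h : g₁ =ᶠ[𝓝 x] g) : SmAt n g₁ x :=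
  ContMDiffAt.congr_of_eventuallyEq hg h

/-- A map smooth at `x` with injective differential that takes values in a level set of the right
dimension is locally injective, and open onto the level set. -/
theorem map_nhds_eq_nhdsWithin [IsManifold (𝓡 n) ∞ M] [FiniteDimensional ℝ F] {g : M → F} {x : M}
    (hg : SmAt n g x)
    (hinj : Function.Injective (dif n g x)) {S : Set F} (hS : ∀ᶠ y in 𝓝 x, g y ∈ S)
    {h : F → G} {h' : F →L[ℝ] G} (hh : HasStrictFDerivAt h h' (g x)) {c : G}
    (hc : ∀ s ∈ S, h s = c)
    (hrank : Module.finrank ℝ (LinearMap.ker h'.toLinearMap) ≤ n) :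
    map g (𝓝 x) = 𝓝[S] (g x) ∧ ∃ U ∈ 𝓝 x, Set.InjOn g U := by
  set A := (dif n g x).toLinearMap with hA
  have hker : LinearMap.ker A = ⊥ := LinearMap.ker_eq_bot.2 hinj
  -- `L ∘ g` is a local diffeomorphism at `x`, and `L` serves as a coordinate on the level set near
  -- `g x`.
  obtain ⟨L, hL⟩ := LinearMap.exists_leftInverse_of_injective A hker
  have hrange : LinearMap.range A = LinearMap.ker h'.toLinearMap := by
    apply Submodule.eq_of_le_of_finrank_le
    · rintro _ ⟨t, rfl⟩
      have h1 : HasD n (fun y => h (g y)) x (h'.comp (dif n g x)) := hg.hasD.comp hh.hasFDerivAt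
      have h2 : dif n (fun y => h (g y)) x = 0 := by
        rw [dif_congr (g := fun _ => c) (hS.mono fun y hy => hc _ hy)]
        exact (hasD_const c x).dif_eq
      rw [h1.dif_eq] at h2
      exact DFunLike.congr_fun h2 t
    · rw [LinearMap.finrank_range_of_inj hinj]
      simpa using hrank
  -- `(L, h)` is locally injective on `S`
  have hLS : ∃ V ∈ 𝓝 (g x), ∀ s ∈ V, ∀ s' ∈ V, s ∈ S → s' ∈ S → L s = L s' → s = s' := by
    have hk : LinearMap.ker (L.prod h'.toLinearMap) = ⊥ := by
      rw [LinearMap.ker_eq_bot']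
      intro v hv
      have hv1 : L v = 0 := congrArg Prod.fst hv
      have hv2 : v ∈ LinearMap.ker h'.toLinearMap := congrArg Prod.snd hv
      rw [← hrange] at hv2
      obtain ⟨t, rfl⟩ := hv2
      have : L (A t) = t := DFunLike.congr_fun hL t
      rw [hv1] at this
      rw [← this, map_zero]
    -- `(L, h')` is injective, hence bounded below: a vector killed by `L` is controlled by its
    -- image under `h'`.
    obtain ⟨K, hK0, hK⟩ := LinearMap.exists_antilipschitzWith _ hk
    have hKb : ∀ v, L v = 0 → ‖v‖ ≤ K * ‖h' v‖ := by
      intro v hv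
      have := hK.le_mul_dist v 0
      simpa [dist_eq_norm, Prod.norm_def, hv] using this
    have hsmall := hh.isLittleO
    have hK0' : (0 : ℝ) < K := hK0
    -- With this error in the strict derivative, two points of `S` with equal `L` satisfy ‖s - s'‖ ≤
    -- ½‖s - s'‖, so they coincide.
    have hK2 : (0 : ℝ) < 1 / (2 * K) := by positivity
    have := hsmall.def hK2
    rw [nhds_prod_eq] at this
    obtain ⟨V, hV, hV'⟩ := (eventually_prod_self_iff (r := fun s s' =>
      ‖h s - h s' - h' (s - s')‖ ≤ 1 / (2 * K) * ‖s - s'‖)).1 this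
    refine ⟨V, hV, fun s hs s' hs' hsS hsS' hLe => ?_⟩
    have h1 := hV' s hs s' hs'
    rw [hc s hsS, hc s' hsS', sub_self, zero_sub, norm_neg] at h1
    have h2 := hKb (s - s') (by rw [map_sub, hLe, sub_self])
    have h3 : ‖s - s'‖ ≤ 1 / 2 * ‖s - s'‖ := by
      calc ‖s - s'‖ ≤ K * ‖h' (s - s')‖ := h2
        _ ≤ K * (1 / (2 * K) * ‖s - s'‖) := by gcongr
        _ = 1 / 2 * ‖s - s'‖ := by field_simp
    have h4 : ‖s - s'‖ = 0 := by nlinarith [norm_nonneg (s - s')]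
    exact sub_eq_zero.1 (norm_eq_zero.1 h4)
  -- `L ∘ g` is a local homeomorphism at `x`
  set χ := extChartAt (𝓡 n) x with hχ
  have hstrict : HasStrictFDerivAt (fun y => L (g (χ.symm y)))
      ((ContinuousLinearEquiv.refl ℝ (Euc n) : Euc n ≃L[ℝ] Euc n) : Euc n →L[ℝ] Euc n) (χ x) := by
    have h1 : ContDiffAt ℝ ∞ (g ∘ χ.symm) (χ x) := by
      have := (contMDiffAt_iff.1 hg).2
      simp only [extChartAt_model_space_eq_id, modelWithCornersSelf_coe, Set.range_id,
        contDiffWithinAt_univ] at this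
      exact this
    have h2 := h1.hasStrictFDerivAt (by simp)
    have h3 : fderiv ℝ (g ∘ χ.symm) (χ x) = dif n g x :=
      ((hasD_iff.1 hg.hasD).2).fderiv
    rw [h3] at h2
    have h4 := ((toCLM L).hasStrictFDerivAt (x := g (χ.symm (χ x)))).comp (χ x) h2
    have h5 : (toCLM L).comp (dif n g x) =
        ((ContinuousLinearEquiv.refl ℝ (Euc n) : Euc n ≃L[ℝ] Euc n) : Euc n →L[ℝ] Euc n) :=
      ContinuousLinearMap.ext fun t => DFunLike.congr_fun hL t
    rw [h5] at h4
    exact h4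
  have hxs : χ.symm (χ x) = x := extChartAt_to_inv x
  have hχmap : map χ (𝓝 x) = 𝓝 (χ x) := by
    have := map_extChartAt_nhds (I := 𝓡 n) x
    rw [hχ, this, modelWithCornersSelf_coe, Set.range_id, nhdsWithin_univ]
  have hLg : map (fun y => L (g y)) (𝓝 x) = 𝓝 (L (g x)) := by
    have h1 := hstrict.map_nhds_eq_of_equiv
    simp only [hxs] at h1
    rw [← h1, ← hχmap, map_map]
    apply Filter.map_congr
    filter_upwards [extChartAt_source_mem_nhds (I := 𝓡 n) x] with y hy
    simp only [Function.comp_apply]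
    rw [χ.left_inv hy]
  have hLinj : ∃ U ∈ 𝓝 x, Set.InjOn (fun y => L (g y)) U := by
    set e := hstrict.toOpenPartialHomeomorph with he
    refine ⟨χ.source ∩ χ ⁻¹' e.source, ?_, ?_⟩
    · apply inter_mem (extChartAt_source_mem_nhds (I := 𝓡 n) x)
      exact (continuousAt_extChartAt x).preimage_mem_nhds
        (e.open_source.mem_nhds hstrict.mem_toOpenPartialHomeomorph_source)
    · rintro y ⟨hy, hy'⟩ z ⟨hz, hz'⟩ hyz
      apply χ.injOn hy hz
      apply e.injOn hy' hz'
      simp only [he, HasStrictFDerivAt.toOpenPartialHomeomorph_coe]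
      rw [χ.left_inv hy, χ.left_inv hz]
      exact hyz
  have hcont : ContinuousAt g x := hg.continuousAt
  constructor
  · apply le_antisymm
    · rw [nhdsWithin, le_inf_iff]
      exact ⟨hcont, le_principal_iff.2 hS⟩
    -- A point `s` of `S` near `g x` satisfies L s = L (g y) for some `y` near `x`, because `L ∘ g`
    -- is open at `x`; injectivity of `L` on `S` gives s = g y.
    · obtain ⟨V, hV, hVinj⟩ := hLS
      intro T hT
      rw [mem_map] at hT
      have hT' : g ⁻¹' T ∩ (g ⁻¹' V ∩ {y | g y ∈ S}) ∈ 𝓝 x :=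
        inter_mem hT (inter_mem (hcont.preimage_mem_nhds hV) hS)
      have h1 : (fun y => L (g y)) '' (g ⁻¹' T ∩ (g ⁻¹' V ∩ {y | g y ∈ S})) ∈ 𝓝 (L (g x)) := by
        rw [← hLg]; exact image_mem_map hT'
      have h2 : L ⁻¹' ((fun y => L (g y)) '' (g ⁻¹' T ∩ (g ⁻¹' V ∩ {y | g y ∈ S}))) ∈ 𝓝 (g x) :=
        ((toCLM L).continuous.continuousAt (x := g x)).preimage_mem_nhds h1
      rw [mem_nhdsWithin_iff_exists_mem_nhds_inter]
      refine ⟨_, inter_mem h2 hV, ?_⟩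
      rintro s ⟨⟨⟨y, ⟨hyT, hyV, hyS⟩, hy⟩, hsV⟩, hsS⟩
      rw [← hVinj _ hyV _ hsV hyS hsS hy]
      exact hyT
  · obtain ⟨U, hU, hUi⟩ := hLinj
    exact ⟨U, hU, fun y hy z hz h => hUi hy hz (congrArg L h)⟩

end Calculus

/-! ### Pairs of curvature spheres -/

section Pairs

open Topology Filter

variable {M : Type u} [TopologicalSpace M] {n : ℕ} [ChartedSpace (Euc n) M]

theorem snd_ne_zero_of_null {d : ℕ} {v : Mink d} (h : lorentz v v = 0) (hv : v ≠ 0) : v.2 ≠ 0 :=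
  (eq_smul_of_nonpos h.le h.le h hv).1

/-- `F` is a space-like immersion into the light cone on the set `U`. -/
structure IsLift (F : M → Mink (n + 1 + 1)) (U : Set M) : Prop where
  smooth : ∀ x ∈ U, SmAt n F x
  null : ∀ x ∈ U, lorentz (F x) (F x) = 0
  ne : ∀ x ∈ U, F x ≠ 0
  pos : ∀ x ∈ U, ∀ t, t ≠ 0 → 0 < lorentz (dif n F x t) (dif n F x t)

/-- `K_a, K_b` are the two curvature spheres, in de Sitter space, of a hypersurface with light cone
lift `F` and two principal curvatures of multiplicities `m` and `k`, each constant along its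
eigenbundle. -/
structure CurvPair (F : M → Mink (n + 1 + 1)) (m k : ℕ) (Ka Kb : M → Mink (n + 1 + 1)) (δ : M → ℝ)
    (U : Set M) : Prop where
  isOpen : IsOpen U
  lift : IsLift F U
  dim : m + k = n
  m_pos : 0 < m
  k_pos : 0 < k
  smooth_a : ∀ x ∈ U, SmAt n Ka x
  smooth_b : ∀ x ∈ U, SmAt n Kb x
  smooth_δ : ∀ x ∈ U, SmAt n δ x
  unit : ∀ x ∈ U, lorentz (Ka x) (Ka x) = 1
  perp : ∀ x ∈ U, lorentz (Ka x) (F x) = 0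
  perp_d : ∀ x ∈ U, ∀ t, lorentz (Ka x) (dif n F x t) = 0
  ne : ∀ x ∈ U, δ x ≠ 0
  eq : ∀ x ∈ U, Kb x = Ka x + δ x • F x
  rank_a : ∀ x ∈ U, Module.finrank ℝ (LinearMap.ker (dif n Ka x).toLinearMap) = m
  rank_b : ∀ x ∈ U, Module.finrank ℝ (LinearMap.ker (dif n Kb x).toLinearMap) = k

section Lift

variable {F : M → Mink (n + 1 + 1)} {U : Set M}

theorem IsLift.mono (h : IsLift F U) {V : Set M} (hV : V ⊆ U) : IsLift F V :=
  ⟨fun x hx => h.smooth x (hV hx), fun x hx => h.null x (hV hx), fun x hx => h.ne x (hV hx),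
    fun x hx => h.pos x (hV hx)⟩

theorem IsLift.lorentz_dif (h : IsLift F U) (hU : IsOpen U) {x : M} (hx : x ∈ U) (t : Euc n) :
    lorentz (F x) (dif n F x t) = 0 := by
  have h1 := lorentz_dif_of_const (h.smooth x hx).hasD (h.smooth x hx).hasD
    (eventually_of_mem (hU.mem_nhds hx) h.null) t
  rw [lorentz_comm (dif n F x t)] at h1
  linarith

/-- A multiple of `F` is light-like, whereas dF t is space-like unless t = 0. -/
theorem IsLift.eq_zero_of_dif_eq_smul (h : IsLift F U) {x : M} (hx : x ∈ U)
    {t : Euc n} {β : ℝ} (ht : dif n F x t = β • F x) : t = 0 := by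
  by_contra h0
  have h1 := h.pos x hx t h0
  rw [ht, lorentz_smul_right, lorentz_smul_left, h.null x hx] at h1
  simp at h1

/-- The term with dμ is a multiple of `F`, which is light-like and orthogonal to dF; rescaling only
multiplies the induced metric by μ². -/
theorem IsLift.smul (h : IsLift F U) (hU : IsOpen U) {μ : M → ℝ} (hμ : ∀ x ∈ U, SmAt n μ x)
    (hμ0 : ∀ x ∈ U, μ x ≠ 0) : IsLift (fun x => μ x • F x) U where
  smooth x hx := (hμ x hx).smul (h.smooth x hx)
  null x hx := by simp only [lorentz_smul_left, lorentz_smul_right, h.null x hx]; ring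
  ne x hx := smul_ne_zero (hμ0 x hx) (h.ne x hx)
  pos x hx t ht := by
    rw [((hμ x hx).hasD.smul (h.smooth x hx).hasD).dif_eq]
    have h1 := h.lorentz_dif hU hx t
    have h2 := h.pos x hx t ht
    have h3 := hμ0 x hx
    simp only [_root_.add_apply, _root_.smul_apply,
      ContinuousLinearMap.smulRight_apply, lorentz_add_left, lorentz_add_right, lorentz_smul_left,
      lorentz_smul_right, h1, h.null x hx, lorentz_comm (dif n F x t) (F x)]
    have : 0 < μ x * μ x := mul_self_pos.2 h3
    nlinarith [mul_pos this h2]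

end Lift

namespace CurvPair

variable {F Ka Kb : M → Mink (n + 1 + 1)} {m k : ℕ} {δ : M → ℝ} {U : Set M}

theorem mono (h : CurvPair F m k Ka Kb δ U) {V : Set M} (hV : V ⊆ U) (hVo : IsOpen V) :
    CurvPair F m k Ka Kb δ V where
  isOpen := hVo
  lift := h.lift.mono hV
  dim := h.dim
  m_pos := h.m_pos
  k_pos := h.k_pos
  smooth_a x hx := h.smooth_a x (hV hx)
  smooth_b x hx := h.smooth_b x (hV hx)
  smooth_δ x hx := h.smooth_δ x (hV hx)
  unit x hx := h.unit x (hV hx)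
  perp x hx := h.perp x (hV hx)
  perp_d x hx := h.perp_d x (hV hx)
  ne x hx := h.ne x (hV hx)
  eq x hx := h.eq x (hV hx)
  rank_a x hx := h.rank_a x (hV hx)
  rank_b x hx := h.rank_b x (hV hx)

theorem dif_b (h : CurvPair F m k Ka Kb δ U) {x : M} (hx : x ∈ U) (t : Euc n) :
    dif n Kb x t = dif n Ka x t + (δ x • dif n F x t + dif n δ x t • F x) := by
  have h1 : HasD n (fun y => Ka y + δ y • F y) x
      (dif n Ka x + (δ x • dif n F x + (dif n δ x).smulRight (F x))) :=
    (h.smooth_a x hx).hasD.add ((h.smooth_δ x hx).hasD.smul (h.lift.smooth x hx).hasD)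
  rw [dif_congr (eventually_of_mem (h.isOpen.mem_nhds hx) h.eq), h1.dif_eq]
  rfl

theorem unit_b (h : CurvPair F m k Ka Kb δ U) {x : M} (hx : x ∈ U) :
    lorentz (Kb x) (Kb x) = 1 := by
  rw [h.eq x hx]
  simp only [lorentz_add_left, lorentz_add_right, lorentz_smul_left, lorentz_smul_right,
    h.unit x hx, h.perp x hx, h.lift.null x hx, lorentz_comm (F x) (Ka x)]
  ring

theorem perp_b (h : CurvPair F m k Ka Kb δ U) {x : M} (hx : x ∈ U) :
    lorentz (Kb x) (F x) = 0 := by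
  rw [h.eq x hx, lorentz_add_left, lorentz_smul_left, h.perp x hx, h.lift.null x hx]; ring

theorem perp_d_b (h : CurvPair F m k Ka Kb δ U) {x : M} (hx : x ∈ U) (t : Euc n) :
    lorentz (Kb x) (dif n F x t) = 0 := by
  rw [h.eq x hx, lorentz_add_left, lorentz_smul_left, h.perp_d x hx,
    h.lift.lorentz_dif h.isOpen hx]; ring

theorem lorentz_ab (h : CurvPair F m k Ka Kb δ U) {x : M} (hx : x ∈ U) :
    lorentz (Ka x) (Kb x) = 1 := by
  rw [h.eq x hx, lorentz_add_right, lorentz_smul_right, h.unit x hx, h.perp x hx]; ring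

/-- Exchanging the two curvature spheres. -/
theorem swap (h : CurvPair F m k Ka Kb δ U) :
    CurvPair F k m (fun x => -Kb x) (fun x => -Ka x) δ U where
  isOpen := h.isOpen
  lift := h.lift
  dim := by rw [add_comm]; exact h.dim
  m_pos := h.k_pos
  k_pos := h.m_pos
  smooth_a x hx := (h.smooth_b x hx).neg
  smooth_b x hx := (h.smooth_a x hx).neg
  smooth_δ := h.smooth_δ
  unit x hx := by rw [lorentz_neg_left, lorentz_neg_right, neg_neg, h.unit_b hx]
  perp x hx := by rw [lorentz_neg_left, h.perp_b hx, neg_zero]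
  perp_d x hx t := by rw [lorentz_neg_left, h.perp_d_b hx, neg_zero]
  ne := h.ne
  -- The two minus signs keep `δ`: K_b = K_a + δF is the same as -K_a = -K_b + δF. In particular the
  -- positivity of `δ` survives the exchange.
  eq x hx := by rw [h.eq x hx]; abel
  rank_a x hx := by
    rw [(h.smooth_b x hx).hasD.neg.dif_eq, ContinuousLinearMap.toLinearMap_neg,
      LinearMap.ker_neg, h.rank_b x hx]
  rank_b x hx := by
    rw [(h.smooth_a x hx).hasD.neg.dif_eq, ContinuousLinearMap.toLinearMap_neg,
      LinearMap.ker_neg, h.rank_a x hx]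

/-- Reversing the normal. -/
theorem neg (h : CurvPair F m k Ka Kb δ U) :
    CurvPair F m k (fun x => -Ka x) (fun x => -Kb x) (fun x => -δ x) U where
  isOpen := h.isOpen
  lift := h.lift
  dim := h.dim
  m_pos := h.m_pos
  k_pos := h.k_pos
  smooth_a x hx := (h.smooth_a x hx).neg
  smooth_b x hx := (h.smooth_b x hx).neg
  smooth_δ x hx := (h.smooth_δ x hx).neg
  unit x hx := by rw [lorentz_neg_left, lorentz_neg_right, neg_neg, h.unit x hx]
  perp x hx := by rw [lorentz_neg_left, h.perp x hx, neg_zero]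
  perp_d x hx t := by rw [lorentz_neg_left, h.perp_d x hx, neg_zero]
  ne x hx := neg_ne_zero.2 (h.ne x hx)
  eq x hx := by rw [h.eq x hx, neg_smul]; abel
  rank_a x hx := by
    rw [(h.smooth_a x hx).hasD.neg.dif_eq, ContinuousLinearMap.toLinearMap_neg,
      LinearMap.ker_neg, h.rank_a x hx]
  rank_b x hx := by
    rw [(h.smooth_b x hx).hasD.neg.dif_eq, ContinuousLinearMap.toLinearMap_neg,
      LinearMap.ker_neg, h.rank_b x hx]

/-- Rescaling the light cone lift. -/
theorem smul_lift (h : CurvPair F m k Ka Kb δ U) {F' : M → Mink (n + 1 + 1)} {μ : M → ℝ}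
    (hμ : ∀ x ∈ U, SmAt n μ x) (hμ0 : ∀ x ∈ U, μ x ≠ 0) (hF' : ∀ x ∈ U, F' x = μ x • F x) :
    CurvPair F' m k Ka Kb (fun x => (μ x)⁻¹ * δ x) U where
  isOpen := h.isOpen
  lift := by
    have h1 := h.lift.smul h.isOpen hμ hμ0
    have hn : ∀ x ∈ U, F' =ᶠ[𝓝 x] fun y => μ y • F y := fun x hx =>
      eventually_of_mem (h.isOpen.mem_nhds hx) hF'
    refine ⟨fun x hx => (h1.smooth x hx).congr (hn x hx), fun x hx => ?_, fun x hx => ?_,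
      fun x hx t ht => ?_⟩
    · rw [hF' x hx]; exact h1.null x hx
    · rw [hF' x hx]; exact h1.ne x hx
    · rw [dif_congr (hn x hx)]; exact h1.pos x hx t ht
  dim := h.dim
  m_pos := h.m_pos
  k_pos := h.k_pos
  smooth_a := h.smooth_a
  smooth_b := h.smooth_b
  smooth_δ x hx := ((hμ x hx).inv (hμ0 x hx)).smul (h.smooth_δ x hx)
  unit := h.unit
  perp x hx := by rw [hF' x hx, lorentz_smul_right, h.perp x hx, mul_zero]
  perp_d x hx t := by
    have hn : F' =ᶠ[𝓝 x] fun y => μ y • F y := eventually_of_mem (h.isOpen.mem_nhds hx) hF'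
    rw [dif_congr hn, ((hμ x hx).hasD.smul (h.lift.smooth x hx).hasD).dif_eq]
    simp only [_root_.add_apply, _root_.smul_apply,
      ContinuousLinearMap.smulRight_apply, lorentz_add_right, lorentz_smul_right,
      h.perp x hx, h.perp_d x hx]
    ring
  ne x hx := mul_ne_zero (inv_ne_zero (hμ0 x hx)) (h.ne x hx)
  eq x hx := by
    rw [hF' x hx, h.eq x hx, smul_smul]
    have := hμ0 x hx
    congr 2
    field_simp
  rank_a := h.rank_a
  rank_b := h.rank_b

/-- If both spheres are stationary along `t`, so is their difference δF; then dF t is a multiple of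
`F`. -/
theorem disjoint_ker (h : CurvPair F m k Ka Kb δ U) {x : M} (hx : x ∈ U) {t : Euc n}
    (ha : dif n Ka x t = 0) (hb : dif n Kb x t = 0) : t = 0 := by
  have h1 := h.dif_b hx t
  rw [ha, hb, zero_add] at h1
  have hne := h.ne x hx
  apply h.lift.eq_zero_of_dif_eq_smul hx (β := -((δ x)⁻¹ * dif n δ x t))
  have h2 : (δ x)⁻¹ • (δ x • dif n F x t + dif n δ x t • F x) = 0 := by rw [← h1, smul_zero]
  rw [smul_add, smul_smul, inv_mul_cancel₀ hne, one_smul, smul_smul] at h2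
  rw [neg_smul]
  exact eq_neg_of_add_eq_zero_left h2

theorem exists_add (h : CurvPair F m k Ka Kb δ U) {x : M} (hx : x ∈ U) (t : Euc n) :
    ∃ ta tb, dif n Ka x ta = 0 ∧ dif n Kb x tb = 0 ∧ t = ta + tb := by
  have h1 : LinearMap.ker (dif n Ka x).toLinearMap ⊔ LinearMap.ker (dif n Kb x).toLinearMap = ⊤ := by
    apply Submodule.eq_top_of_disjoint
    · rw [h.rank_a x hx, h.rank_b x hx, h.dim]; simp
    · rw [Submodule.disjoint_def]
      exact fun t ha hb => h.disjoint_ker hx ha hb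
  have h2 : t ∈ LinearMap.ker (dif n Ka x).toLinearMap ⊔ LinearMap.ker (dif n Kb x).toLinearMap := by
    rw [h1]; trivial
  obtain ⟨ta, hta, tb, htb, rfl⟩ := Submodule.mem_sup.1 h2
  exact ⟨ta, tb, hta, htb, rfl⟩

/-- The spheres tangent to the hypersurface at a point. -/
theorem eq_add_smul (h : CurvPair F m k Ka Kb δ U) {x : M} (hx : x ∈ U) {v : Mink (n + 1 + 1)}
    (hv : lorentz v (F x) = 0) (hvd : ∀ t, lorentz v (dif n F x t) = 0) :
    ∃ β : ℝ, v = lorentz v (Ka x) • Ka x + β • F x := by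
  -- The image of dF, `F` and K_a together span the hyperplane orthogonal to `F`, whose orthogonal
  -- complement is the line of `F`. Both `F` and `v` minus its K_a-component lie in that complement.
  let G : (Euc n × ℝ) × ℝ →ₗ[ℝ] Mink (n + 1 + 1) :=
    ((dif n F x).toLinearMap.coprod (LinearMap.toSpanSingleton ℝ _ (F x))).coprod
      (LinearMap.toSpanSingleton ℝ _ (Ka x))
  have hG : ∀ t a b, G ((t, a), b) = dif n F x t + a • F x + b • Ka x := fun t a b => by simp [G]
  have hFF := h.lift.null x hx
  have hFd := h.lift.lorentz_dif h.isOpen hx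
  have hKF := h.perp x hx
  have hKd := h.perp_d x hx
  have hKK := h.unit x hx
  have hinj : Function.Injective G := by
    rw [← LinearMap.ker_eq_bot, LinearMap.ker_eq_bot']
    rintro ⟨⟨t, a⟩, b⟩ h0
    rw [hG] at h0
    have hb : lorentz (dif n F x t + a • F x + b • Ka x) (Ka x) = 0 := by
      rw [h0, lorentz_zero_left]
    rw [lorentz_add_left, lorentz_add_left, lorentz_smul_left, lorentz_smul_left,
      lorentz_comm _ (Ka x), lorentz_comm _ (Ka x), hKd, hKF, hKK] at hb
    have hb0 : b = 0 := by linarith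
    subst hb0
    rw [zero_smul, add_zero] at h0
    have ht := h.lift.eq_zero_of_dif_eq_smul hx (t := t) (β := -a) (by
      rw [neg_smul]; exact eq_neg_of_add_eq_zero_left h0)
    subst ht
    rw [map_zero, zero_add] at h0
    rcases smul_eq_zero.1 h0 with h1 | h1
    · rw [h1]; rfl
    · exact absurd h1 (h.lift.ne x hx)
  have hfr : Module.finrank ℝ (LinearMap.range G) = n + 1 + 1 := by
    rw [LinearMap.finrank_range_of_inj hinj]; simp
  obtain ⟨β, hβ⟩ := exists_eq_smul_of_orthogonal (LinearMap.range G) hfr.ge (h.lift.ne x hx)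
    (v := v - lorentz v (Ka x) • Ka x)
    (by
      rintro _ ⟨⟨⟨t, a⟩, b⟩, rfl⟩
      rw [hG]
      rw [lorentz_add_left, lorentz_add_left, lorentz_smul_left, lorentz_smul_left,
        lorentz_comm (dif n F x t), hFd, hFF, hKF]
      ring)
    (by
      rintro _ ⟨⟨⟨t, a⟩, b⟩, rfl⟩
      rw [hG]
      simp only [lorentz_add_left, lorentz_smul_left, lorentz_sub_right, lorentz_smul_right,
        lorentz_comm (dif n F x t), lorentz_comm (F x), hKF, hKd, hKK, hv, hvd,
        lorentz_comm (Ka x) v]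
      ring)
  exact ⟨β, by rw [← hβ]; abel⟩

/-- A family of tangent spheres that is stationary in some direction at each point is one of the two
families of curvature spheres, up to sign. -/
theorem eq_or_eq (h : CurvPair F m k Ka Kb δ U) {K : M → Mink (n + 1 + 1)} {p : M} (hp : p ∈ U)
    (hK : ∀ x ∈ U, SmAt n K x) (hKu : ∀ x ∈ U, lorentz (K x) (K x) = 1)
    (hKF : ∀ x ∈ U, lorentz (K x) (F x) = 0) (hKd : ∀ x ∈ U, ∀ t, lorentz (K x) (dif n F x t) = 0)
    (hker : ∀ x ∈ U, ∃ t, t ≠ 0 ∧ dif n K x t = 0) :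
    ∃ ε : ℝ, (ε = 1 ∨ ε = -1) ∧
      ((∀ᶠ x in 𝓝 p, K x = ε • Ka x) ∨ (∀ᶠ x in 𝓝 p, K x = ε • Kb x)) := by
  have hU := h.isOpen.mem_nhds hp
  -- The coefficient of K_a has square 1 and is continuous, hence locally constant.
  set e : M → ℝ := fun x => lorentz (K x) (Ka x) with he
  have hee : ∀ x ∈ U, e x = 1 ∨ e x = -1 := by
    intro x hx
    obtain ⟨β, hβ⟩ := h.eq_add_smul hx (hKF x hx) (hKd x hx)
    have h1 := hKu x hx
    conv at h1 => lhs; arg 2; rw [hβ]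
    rw [lorentz_add_right, lorentz_smul_right, lorentz_smul_right, hKF x hx] at h1
    have h2 : (e x - 1) * (e x + 1) = 0 := by simp only [he]; linarith
    rcases mul_eq_zero.1 h2 with h3 | h3
    · left; linarith
    · right; linarith
  have hec : ContinuousAt e p := ((hK p hp).lorentz (h.smooth_a p hp)).continuousAt
  set ε := e p with hε
  have heε : ∀ᶠ x in 𝓝 p, e x = ε := by
    have h1 : ∀ᶠ x in 𝓝 p, |e x - ε| < 1 := by
      have := Metric.tendsto_nhds.1 hec 1 one_pos
      simpa [Real.dist_eq] using this
    filter_upwards [h1, hU] with x h1 hx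
    rw [abs_lt] at h1
    rcases hee x hx with h2 | h2 <;> rcases hee p hp with h3 | h3 <;> rw [← hε] at h3 <;> linarith
  -- The coefficient of `F` is read off from the time coordinates, where `F` does not vanish; this
  -- makes it smooth.
  set l : M → ℝ := fun x => (K x - ε • Ka x).2 * (F x).2⁻¹ with hl
  have hF2 : ∀ x ∈ U, (F x).2 ≠ 0 := fun x hx => snd_ne_zero_of_null (h.lift.null x hx) (h.lift.ne x hx)
  have hls : ∀ x ∈ U, SmAt n l x := fun x hx =>
    (((hK x hx).sub ((h.smooth_a x hx).const_smul ε)).clm (ContinuousLinearMap.snd ℝ _ _)).smul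
      (((h.lift.smooth x hx).clm (ContinuousLinearMap.snd ℝ _ _)).inv (hF2 x hx))
  have hKl : ∀ᶠ x in 𝓝 p, K x = ε • Ka x + l x • F x := by
    filter_upwards [heε, hU] with x h1 hx
    obtain ⟨β, hβ⟩ := h.eq_add_smul hx (hKF x hx) (hKd x hx)
    change K x = e x • Ka x + β • F x at hβ
    rw [h1] at hβ
    have : l x = β := by
      simp only [hl]
      rw [hβ]
      have := hF2 x hx
      simp; field_simp
    rw [this]; exact hβ
  -- Differentiate K = εK_a + lF along a stationary direction t = ta + tb, with ta, tb in the two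
  -- kernels. This gives l ta + (l - εδ) tb = 0, and both terms vanish because the kernels are
  -- complementary.
  have hll : ∀ᶠ x in 𝓝 p, l x = 0 ∨ l x = ε * δ x := by
    filter_upwards [hKl.eventually_nhds, hU] with x h1 hx
    obtain ⟨t, ht0, ht⟩ := hker x hx
    have h2 : HasD n (fun y => ε • Ka y + l y • F y) x
        (ε • dif n Ka x + (l x • dif n F x + (dif n l x).smulRight (F x))) :=
      ((h.smooth_a x hx).hasD.const_smul ε).add ((hls x hx).hasD.smul (h.lift.smooth x hx).hasD)
    have h3 := dif_congr (n := n) h1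
    rw [h2.dif_eq] at h3
    have h4 := DFunLike.congr_fun h3 t
    rw [ht] at h4
    obtain ⟨ta, tb, hta, htb, rfl⟩ := h.exists_add hx t
    have h5 := h.dif_b hx tb
    rw [htb] at h5
    have h6 : dif n Ka x tb = -(δ x • dif n F x tb + dif n δ x tb • F x) :=
      eq_neg_of_add_eq_zero_left h5.symm
    simp only [_root_.add_apply, _root_.smul_apply,
      ContinuousLinearMap.smulRight_apply, map_add, hta, h6] at h4
    have h7 : l x • ta + (l x - ε * δ x) • tb = 0 := by
      apply h.lift.eq_zero_of_dif_eq_smul hx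
        (β := ε * dif n δ x tb - (dif n l x ta + dif n l x tb))
      rw [map_add, map_smul, map_smul, ← sub_eq_zero]
      conv_rhs => rw [h4]
      module
    have h8 : l x • ta = 0 := by
      apply h.disjoint_ker hx
      · rw [map_smul, hta, smul_zero]
      · rw [eq_neg_of_add_eq_zero_left h7, map_neg, map_smul, htb, smul_zero, neg_zero]
    rcases smul_eq_zero.1 h8 with h9 | h9
    · exact Or.inl h9
    · rw [h9, smul_zero, zero_add] at h7
      rcases smul_eq_zero.1 h7 with h10 | h10
      · right; linarith
      · exact absurd (by rw [h9, h10, add_zero]) ht0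
  have hlc : ContinuousAt l p := (hls p hp).continuousAt
  have hδc : ContinuousAt δ p := (h.smooth_δ p hp).continuousAt
  refine ⟨ε, hee p hp, ?_⟩
  have hε0 : ε ≠ 0 := by rcases hee p hp with h3 | h3 <;> rw [← hε] at h3 <;> rw [h3] <;> norm_num
  -- Since δ is not zero, the alternatives l = 0 and l = εδ are separated, and by continuity the one
  -- that holds at `p` persists nearby.
  rcases hll.self_of_nhds with h1 | h1
  · left
    have h2 : ∀ᶠ x in 𝓝 p, l x - ε * δ x ≠ 0 := by
      apply ContinuousAt.eventually_ne (hlc.sub (hδc.const_mul ε))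
      simp only [Pi.sub_apply, h1, zero_sub, ne_eq, neg_eq_zero]
      exact mul_ne_zero hε0 (h.ne p hp)
    filter_upwards [h2, hll, hKl] with x h3 h4 h5
    rcases h4 with h4 | h4
    · rw [h5, h4, zero_smul, add_zero]
    · exact absurd (by rw [h4, sub_self]) h3
  · right
    have h2 : ∀ᶠ x in 𝓝 p, l x ≠ 0 := by
      apply ContinuousAt.eventually_ne hlc
      rw [h1]
      exact mul_ne_zero hε0 (h.ne p hp)
    filter_upwards [h2, hll, hKl, hU] with x h3 h4 h5 hx
    rcases h4 with h4 | h4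
    · exact absurd h4 h3
    · rw [h5, h4, h.eq x hx, smul_add, smul_smul]

theorem exists_ker_a (h : CurvPair F m k Ka Kb δ U) {x : M} (hx : x ∈ U) :
    ∃ t, t ≠ 0 ∧ dif n Ka x t = 0 := by
  have h1 : Nontrivial (LinearMap.ker (dif n Ka x).toLinearMap) := by
    apply Module.nontrivial_of_finrank_pos (R := ℝ)
    rw [h.rank_a x hx]; exact h.m_pos
  obtain ⟨t, ht⟩ := exists_ne (0 : LinearMap.ker (dif n Ka x).toLinearMap)
  exact ⟨t, fun h0 => ht (Subtype.ext h0), t.2⟩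

theorem exists_ker_b (h : CurvPair F m k Ka Kb δ U) {x : M} (hx : x ∈ U) :
    ∃ t, t ≠ 0 ∧ dif n Kb x t = 0 := by
  obtain ⟨t, ht0, ht⟩ := h.swap.exists_ker_a hx
  rw [(h.smooth_b x hx).hasD.neg.dif_eq] at ht
  exact ⟨t, ht0, neg_eq_zero.1 ht⟩

theorem finrank_ker_of_eq_smul {K K' : M → Mink (n + 1 + 1)} {p : M} (hK : SmAt n K p) {ε : ℝ}
    (hε : ε ≠ 0) (h : ∀ᶠ x in 𝓝 p, K' x = ε • K x) :
    Module.finrank ℝ (LinearMap.ker (dif n K' p).toLinearMap) =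
      Module.finrank ℝ (LinearMap.ker (dif n K p).toLinearMap) := by
  rw [dif_congr h, (hK.hasD.const_smul ε).dif_eq, ContinuousLinearMap.toLinearMap_smul,
    LinearMap.ker_smul _ _ hε]

/-- The curvature spheres are determined up to sign and order. -/
theorem unique (h : CurvPair F m k Ka Kb δ U) {Ka' Kb' : M → Mink (n + 1 + 1)} {m' k' : ℕ}
    {δ' : M → ℝ} (h' : CurvPair F m' k' Ka' Kb' δ' U) {p : M} (hp : p ∈ U) :
    ∃ ε : ℝ, (ε = 1 ∨ ε = -1) ∧
      ((m' = m ∧ ∀ᶠ x in 𝓝 p, Ka' x = ε • Ka x ∧ Kb' x = ε • Kb x) ∨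
        (m' = k ∧ ∀ᶠ x in 𝓝 p, Ka' x = ε • Kb x ∧ Kb' x = ε • Ka x)) := by
  obtain ⟨ε, hε, ha⟩ := h.eq_or_eq hp h'.smooth_a h'.unit h'.perp h'.perp_d
    (fun x hx => h'.exists_ker_a hx)
  obtain ⟨ε', hε', hb⟩ := h.eq_or_eq hp h'.smooth_b (fun x hx => h'.unit_b hx)
    (fun x hx => h'.perp_b hx) (fun x hx => h'.perp_d_b hx) (fun x hx => h'.exists_ker_b hx)
  have h1 := h'.lorentz_ab hp
  have hne : Ka' p ≠ Kb' p := by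
    rw [h'.eq p hp]
    intro h0
    exact smul_ne_zero (h'.ne p hp) (h'.lift.ne p hp) (left_eq_add.1 h0)
  have hε0 : ε ≠ 0 := by rcases hε with h3 | h3 <;> rw [h3] <;> norm_num
  -- Two spheres tangent at the same point of the lift have product ±1, and the product 1 of the two
  -- given ones forces their signs ε, ε' to agree.
  have key : ∀ c : ℝ, c = 1 → lorentz (Ka' p) (Kb' p) = ε * ε' * c → ε' = ε := by
    intro c hc h2
    rw [h1, hc] at h2
    rcases hε with h3 | h3 <;> rcases hε' with h4 | h4 <;> rw [h3, h4] at h2 ⊢ <;> norm_num at h2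
  refine ⟨ε, hε, ?_⟩
  rcases ha with ha | ha <;> rcases hb with hb | hb
  · exfalso
    have := key _ (h.unit p hp) (by
      rw [ha.self_of_nhds, hb.self_of_nhds, lorentz_smul_left, lorentz_smul_right]; ring)
    exact hne (by rw [ha.self_of_nhds, hb.self_of_nhds, this])
  · have := key _ (h.lorentz_ab hp) (by
      rw [ha.self_of_nhds, hb.self_of_nhds, lorentz_smul_left, lorentz_smul_right]; ring)
    rw [this] at hb
    refine Or.inl ⟨?_, ha.and hb⟩
    rw [← h'.rank_a p hp, finrank_ker_of_eq_smul (h.smooth_a p hp) hε0 ha, h.rank_a p hp]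
  · have := key _ (h.lorentz_ab hp) (by
      rw [ha.self_of_nhds, hb.self_of_nhds, lorentz_smul_left, lorentz_smul_right,
        lorentz_comm]; ring)
    rw [this] at hb
    refine Or.inr ⟨?_, ha.and hb⟩
    rw [← h'.rank_a p hp, finrank_ker_of_eq_smul (h.smooth_b p hp) hε0 ha, h.rank_b p hp]
  · exfalso
    have := key _ (h.unit_b hp) (by
      rw [ha.self_of_nhds, hb.self_of_nhds, lorentz_smul_left, lorentz_smul_right]; ring)
    exact hne (by rw [ha.self_of_nhds, hb.self_of_nhds, this])

end CurvPair

end Pairs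

/-! ### The linear spans of the curvature spheres -/

section Spans

open Topology Filter

variable {M : Type u} [TopologicalSpace M] {n : ℕ} [ChartedSpace (Euc n) M]

theorem ker_zero_clm {F : Type*} [NormedAddCommGroup F] [NormedSpace ℝ F] :
    LinearMap.ker (0 : Euc n →L[ℝ] F).toLinearMap = ⊤ := LinearMap.ker_zero

/-- The spheres `K_a` lie in the orthogonal complement of the Euclidean subspace `range D` and in
the hyperplane `⟨·, κ⟩ = 1`, and the spheres `K_b` in the affine subspace `κ + range D`. -/
structure Adapted {d j : ℕ} (Ka Kb : M → Mink d) (D : Euc j →ₗ[ℝ] Mink d) (κ : Mink d)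
    (U : Set M) : Prop where
  iso : ∀ y y', lorentz (D y) (D y') = inner ℝ y y'
  perp : ∀ y, lorentz κ (D y) = 0
  a_D : ∀ x ∈ U, ∀ y, lorentz (Ka x) (D y) = 0
  a_κ : ∀ x ∈ U, lorentz (Ka x) κ = 1
  b_mem : ∀ x ∈ U, ∃ y, Kb x = κ + D y

set_option linter.unusedSectionVars false

namespace Adapted

variable {F Ka Kb : M → Mink (n + 1 + 1)} {m k : ℕ} {δ : M → ℝ} {U : Set M}
  {j : ℕ} {D : Euc j →ₗ[ℝ] Mink (n + 1 + 1)} {κ : Mink (n + 1 + 1)}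

theorem mono (h : Adapted Ka Kb D κ U) {V : Set M} (hV : V ⊆ U) : Adapted Ka Kb D κ V :=
  ⟨h.iso, h.perp, fun x hx => h.a_D x (hV hx), fun x hx => h.a_κ x (hV hx),
    fun x hx => h.b_mem x (hV hx)⟩

theorem coadj_κ (h : Adapted Ka Kb D κ U) : coadj D κ = 0 := coadj_eq_zero h.perp

theorem eq_b (h : Adapted Ka Kb D κ U) {x : M} (hx : x ∈ U) : Kb x = κ + D (coadj D (Kb x)) := by
  obtain ⟨y, hy⟩ := h.b_mem x hx
  rw [hy, map_add, h.coadj_κ, coadj_apply_self h.iso, zero_add]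

/-- Pythagoras for the unit vector K_b, as κ is orthogonal to range D. So the K_b lie on a round
sphere about κ. -/
theorem norm_sq (h : Adapted Ka Kb D κ U) (hc : CurvPair F m k Ka Kb δ U) {x : M} (hx : x ∈ U) :
    ‖coadj D (Kb x)‖ ^ 2 = 1 - lorentz κ κ := by
  have h1 := hc.unit_b hx
  rw [h.eq_b hx] at h1
  simp only [lorentz_add_left, lorentz_add_right, h.perp, h.iso, lorentz_comm (D _) κ,
    real_inner_self_eq_norm_sq] at h1
  linarith

theorem coadj_dif (h : Adapted Ka Kb D κ U) (hc : CurvPair F m k Ka Kb δ U) {x : M} (hx : x ∈ U)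
    (t : Euc n) : dif n Kb x t = D (coadj D (dif n Kb x t)) := by
  have h1 : HasD n (fun y => κ + D (coadj D (Kb y))) x
      (0 + (toCLM (D ∘ₗ coadj D)).comp (dif n Kb x)) :=
    (hasD_const κ x).add ((hc.smooth_b x hx).hasD.linear (D ∘ₗ coadj D))
  have h2 : dif n Kb x = 0 + (toCLM (D ∘ₗ coadj D)).comp (dif n Kb x) := by
    conv_lhs => rw [dif_congr (eventually_of_mem (hc.isOpen.mem_nhds hx) fun y hy => h.eq_b hy),
      h1.dif_eq]
  rw [zero_add] at h2
  exact DFunLike.congr_fun h2 t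

theorem hasD_coadj (hc : CurvPair F m k Ka Kb δ U) {x : M} (hx : x ∈ U) :
    HasD n (fun y => coadj D (Kb y)) x ((toCLM (coadj D)).comp (dif n Kb x)) :=
  (hc.smooth_b x hx).hasD.linear (coadj D)

theorem inner_coadj_dif (h : Adapted Ka Kb D κ U) (hc : CurvPair F m k Ka Kb δ U) {x : M}
    (hx : x ∈ U) (t : Euc n) : inner ℝ (coadj D (Kb x)) (coadj D (dif n Kb x t)) = 0 := by
  have h1 := inner_dif_of_const (hasD_coadj (D := D) hc hx) (hasD_coadj (D := D) hc hx)
    (c := 1 - lorentz κ κ) (eventually_of_mem (hc.isOpen.mem_nhds hx) fun y hy => by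
      rw [real_inner_self_eq_norm_sq, h.norm_sq hc hy]) t
  change inner ℝ (coadj D (Kb x)) (coadj D (dif n Kb x t)) +
    inner ℝ (coadj D (Kb x)) (coadj D (dif n Kb x t)) = 0 at h1
  linarith

theorem finrank_range_coadj (h : Adapted Ka Kb D κ U) (hc : CurvPair F m k Ka Kb δ U) {x : M}
    (hx : x ∈ U) :
    Module.finrank ℝ (LinearMap.range (coadj D ∘ₗ (dif n Kb x).toLinearMap)) = m := by
  have h1 := LinearMap.finrank_range_add_finrank_ker (coadj D ∘ₗ (dif n Kb x).toLinearMap)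
  have h2 : LinearMap.ker (coadj D ∘ₗ (dif n Kb x).toLinearMap) =
      LinearMap.ker (dif n Kb x).toLinearMap := by
    ext t
    constructor
    · intro ht
      change dif n Kb x t = 0
      rw [h.coadj_dif hc hx, show coadj D (dif n Kb x t) = 0 from ht, map_zero]
    · intro ht
      change coadj D (dif n Kb x t) = 0
      rw [show dif n Kb x t = 0 from ht, map_zero]
  rw [h2, hc.rank_b x hx] at h1
  have := hc.dim
  simp only [finrank_euclideanSpace, Fintype.card_fin] at h1
  omega

/-- Radius zero would make K_b constant, against the rank of dK_b, which is m > 0. This is the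
origin of the condition c > -1. -/
theorem radius_pos (h : Adapted Ka Kb D κ U) (hc : CurvPair F m k Ka Kb δ U) {p : M}
    (hp : p ∈ U) : 0 < 1 - lorentz κ κ := by
  rw [← h.norm_sq hc hp]
  refine lt_of_le_of_ne (sq_nonneg _) fun h0 => ?_
  have h1 : ∀ x ∈ U, coadj D (Kb x) = 0 := by
    intro x hx
    have := h.norm_sq hc hx
    rw [← h.norm_sq hc hp, ← h0] at this
    simpa using this
  have h2 : dif n Kb p = 0 := by
    rw [dif_congr (g := fun _ => κ) (eventually_of_mem (hc.isOpen.mem_nhds hp) fun x hx => by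
      rw [h.eq_b hx, h1 x hx, map_zero, add_zero])]
    exact (hasD_const κ p).dif_eq
  have h3 := hc.rank_b p hp
  rw [h2, ker_zero_clm, finrank_top, finrank_euclideanSpace_fin] at h3
  have h4 := hc.dim
  have h5 := hc.m_pos
  omega

theorem dif_a_perp (h : Adapted Ka Kb D κ U) (hc : CurvPair F m k Ka Kb δ U) {x : M} (hx : x ∈ U)
    (t : Euc n) : lorentz (dif n Ka x t) κ = 0 ∧ (∀ y, lorentz (dif n Ka x t) (D y) = 0) ∧
      lorentz (dif n Ka x t) (Ka x) = 0 := by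
  have hn := hc.isOpen.mem_nhds hx
  refine ⟨?_, fun y => ?_, ?_⟩
  · have := lorentz_dif_of_const (hc.smooth_a x hx).hasD (hasD_const κ x)
      (eventually_of_mem hn h.a_κ) t
    simpa [lorentz_zero_right] using this
  · have := lorentz_dif_of_const (hc.smooth_a x hx).hasD (hasD_const (D y) x)
      (eventually_of_mem hn fun x hx => h.a_D x hx y) t
    simpa [lorentz_zero_right] using this
  · have := lorentz_dif_of_const (hc.smooth_a x hx).hasD (hc.smooth_a x hx).hasD
      (eventually_of_mem hn hc.unit) t
    rw [lorentz_comm (Ka x)] at this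
    linarith

theorem finrank_range_a (hc : CurvPair F m k Ka Kb δ U) {x : M} (hx : x ∈ U) :
    Module.finrank ℝ (LinearMap.range (dif n Ka x).toLinearMap) = k := by
  have h1 := LinearMap.finrank_range_add_finrank_ker (dif n Ka x).toLinearMap
  rw [hc.rank_a x hx] at h1
  have := hc.dim
  simp only [finrank_euclideanSpace, Fintype.card_fin] at h1
  omega

/-- The space spanned by `range D` and the first order data of `K_a`. -/
theorem exists_span (h : Adapted Ka Kb D κ U) (hc : CurvPair F m k Ka Kb δ U) {x : M}
    (hx : x ∈ U) : ∃ S : Submodule ℝ (Mink (n + 1 + 1)), Module.finrank ℝ S = j + 1 + k ∧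
      ∀ z, (∀ y, lorentz z (D y) = 0) → lorentz (Ka x) z = 0 →
        (∀ t, lorentz (dif n Ka x t) z = 0) → ∀ s ∈ S, lorentz s z = 0 := by
  let G : (Euc j × ℝ) × LinearMap.range (dif n Ka x).toLinearMap →ₗ[ℝ] Mink (n + 1 + 1) :=
    (D.coprod (LinearMap.toSpanSingleton ℝ _ (Ka x))).coprod (Submodule.subtype _)
  have hG : ∀ y a v, G ((y, a), v) = D y + a • Ka x + (v : Mink (n + 1 + 1)) :=
    fun y a v => by simp [G]
  have hinj : Function.Injective G := by
    rw [← LinearMap.ker_eq_bot, LinearMap.ker_eq_bot']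
    rintro ⟨⟨y, a⟩, ⟨_, ⟨t, rfl⟩⟩⟩ h0
    rw [hG] at h0
    change D y + a • Ka x + dif n Ka x t = 0 at h0
    obtain ⟨-, ht2, ht3⟩ := h.dif_a_perp hc hx t
    have ha : lorentz (D y + a • Ka x + dif n Ka x t) (Ka x) = 0 := by
      rw [h0, lorentz_zero_left]
    rw [lorentz_add_left, lorentz_add_left, lorentz_smul_left, ht3, hc.unit x hx,
      lorentz_comm (D y), h.a_D x hx] at ha
    have ha0 : a = 0 := by linarith
    have hy : lorentz (D y + a • Ka x + dif n Ka x t) (D y) = 0 := by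
      rw [h0, lorentz_zero_left]
    rw [lorentz_add_left, lorentz_add_left, lorentz_smul_left, ht2, h.a_D x hx, h.iso] at hy
    have hy0 : y = 0 := by
      rw [← inner_self_eq_zero (𝕜 := ℝ)]; linarith
    subst ha0 hy0
    rw [map_zero, zero_smul, zero_add, zero_add] at h0
    rw [Prod.mk_eq_zero, Prod.mk_eq_zero]
    exact ⟨⟨rfl, rfl⟩, Subtype.ext h0⟩
  refine ⟨LinearMap.range G, ?_, fun z hD ha hd => ?_⟩
  · rw [LinearMap.finrank_range_of_inj hinj]
    simp only [Module.finrank_prod, finrank_euclideanSpace, Fintype.card_fin,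
      Module.finrank_self, finrank_range_a hc hx]
  · rintro _ ⟨⟨⟨y, a⟩, ⟨_, ⟨t, rfl⟩⟩⟩, rfl⟩
    rw [hG]
    change lorentz (D y + a • Ka x + dif n Ka x t) z = 0
    rw [lorentz_add_left, lorentz_add_left, lorentz_smul_left, hd, ha, lorentz_comm, hD]
    ring

/-- With `radius_pos` this makes κ - K_a time-like; divided by r = √(1 + c) it becomes the
hyperbolic component of the normal form. -/
theorem lorentz_center (h : Adapted Ka Kb D κ U) (hc : CurvPair F m k Ka Kb δ U) {x : M}
    (hx : x ∈ U) : lorentz (κ - Ka x) (κ - Ka x) = -(1 - lorentz κ κ) := by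
  rw [lorentz_sub_left, lorentz_sub_right, lorentz_sub_right, hc.unit x hx, lorentz_comm κ (Ka x),
    h.a_κ x hx]
  ring

theorem center_ne_zero (h : Adapted Ka Kb D κ U) (hc : CurvPair F m k Ka Kb δ U) {x : M}
    (hx : x ∈ U) : κ - Ka x ≠ 0 := by
  intro h0
  have h1 := h.lorentz_center hc hx
  rw [h0, lorentz_zero_left] at h1
  linarith [h.radius_pos hc hx]

/-- Thus κ - K_a is a normal of the subspace provided by `exists_span`, which turns out to be a
hyperplane. -/
theorem center_perp (h : Adapted Ka Kb D κ U) (hc : CurvPair F m k Ka Kb δ U) {x : M}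
    (hx : x ∈ U) : (∀ y, lorentz (κ - Ka x) (D y) = 0) ∧ lorentz (Ka x) (κ - Ka x) = 0 ∧
      ∀ t, lorentz (dif n Ka x t) (κ - Ka x) = 0 := by
  refine ⟨fun y => ?_, ?_, fun t => ?_⟩
  · rw [lorentz_sub_left, h.perp, h.a_D x hx, sub_zero]
  · rw [lorentz_sub_right, h.a_κ x hx, hc.unit x hx, sub_self]
  · obtain ⟨ht1, -, ht3⟩ := h.dif_a_perp hc hx t
    rw [lorentz_sub_right, ht1, ht3, sub_zero]

/-- The dimension of the Euclidean subspace is determined by the multiplicities. -/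
theorem dim_eq (h : Adapted Ka Kb D κ U) (hc : CurvPair F m k Ka Kb δ U) {p : M} (hp : p ∈ U) :
    j = m + 1 := by
  have hd := hc.dim
  apply le_antisymm
  -- A subspace of dimension j + 1 + k has the nonzero normal κ - K_a in a space of dimension n + 3,
  -- so j ≤ m + 1.
  · obtain ⟨S, hS, hperp⟩ := h.exists_span hc hp
    have h1 := LinearMap.BilinForm.finrank_orthogonal (lorentzForm_nondegenerate (n + 1 + 1)) S
    rw [finrank_mink, hS] at h1
    obtain ⟨h2, h3, h4⟩ := h.center_perp hc hp
    have h5 : κ - Ka p ∈ (lorentzForm (n + 1 + 1)).orthogonal S := fun s hs =>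
      hperp _ h2 h3 h4 s hs
    have : Nontrivial ((lorentzForm (n + 1 + 1)).orthogonal S) :=
      ⟨⟨_, h5⟩, 0, fun h0 => h.center_ne_zero hc hp (congrArg Subtype.val h0)⟩
    have := Module.finrank_pos (R := ℝ) (M := (lorentzForm (n + 1 + 1)).orthogonal S)
    omega
  -- The component of dK_b in range D has rank m and is orthogonal to the nonzero radius vector, so
  -- j ≥ m + 1.
  · set R := LinearMap.range (coadj D ∘ₗ (dif n Kb p).toLinearMap) with hR
    have hRf : Module.finrank ℝ R = m := h.finrank_range_coadj hc hp
    have hyR : coadj D (Kb p) ∈ Rᗮ := by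
      rw [Submodule.mem_orthogonal]
      rintro _ ⟨t, rfl⟩
      rw [real_inner_comm]
      exact h.inner_coadj_dif hc hp t
    have hy0 : coadj D (Kb p) ≠ 0 := by
      intro h0
      have h1 := h.norm_sq hc hp
      have h2 := h.radius_pos hc hp
      rw [h0, norm_zero] at h1
      norm_num at h1
      linarith
    have : Nontrivial Rᗮ := ⟨⟨_, hyR⟩, 0, fun h0 => hy0 (congrArg Subtype.val h0)⟩
    have h1 := Module.finrank_pos (R := ℝ) (M := Rᗮ)
    have h2 := Submodule.finrank_add_finrank_orthogonal R
    rw [hRf] at h2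
    simp only [finrank_euclideanSpace, Fintype.card_fin] at h2
    omega

/-- An affine function that is constant on an open family of spheres `K_a` comes from `κ` and
`range D`. -/
theorem mem_range_of_const_a (h : Adapted Ka Kb D κ U) (hc : CurvPair F m k Ka Kb δ U) {p : M}
    (hp : p ∈ U) {z : Mink (n + 1 + 1)} {β : ℝ} (hz : ∀ᶠ x in 𝓝 p, lorentz (Ka x) z = β) :
    ∃ y, z = β • κ + D y := by
  -- What remains of `z` is orthogonal to range D and to all nearby K_a.
  set z' := z - D (coadj D z) - β • κ with hz'
  have hz1 : ∀ y, lorentz z' (D y) = 0 := by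
    intro y
    rw [hz', lorentz_sub_left, lorentz_sub_left, lorentz_smul_left, h.perp, h.iso, inner_coadj]
    ring
  have hz2 : ∀ᶠ x in 𝓝 p, lorentz (Ka x) z' = 0 := by
    filter_upwards [hz, hc.isOpen.mem_nhds hp] with x h1 hx
    rw [hz', lorentz_sub_right, lorentz_sub_right, lorentz_smul_right, h1, h.a_D x hx, h.a_κ x hx]
    ring
  have hR := h.radius_pos hc hp
  have hdim := h.dim_eq hc hp
  -- At each x the vector `z'` is also orthogonal to dK_a, hence a multiple of the normal κ -
  -- K_a(x). Its product with that normal gives the factor, which does not depend on x.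
  have key : ∀ᶠ x in 𝓝 p, z' = (-lorentz z' κ / (1 - lorentz κ κ)) • (κ - Ka x) := by
    filter_upwards [hz2.eventually_nhds, hc.isOpen.mem_nhds hp] with x h1 hx
    have h1x := h1.self_of_nhds
    obtain ⟨S, hS, hperp⟩ := h.exists_span hc hx
    have hzd : ∀ t, lorentz (dif n Ka x t) z' = 0 := by
      intro t
      have := lorentz_dif_of_const (hc.smooth_a x hx).hasD (hasD_const z' x) h1 t
      simpa [lorentz_zero_right] using this
    obtain ⟨c1, c2, c3⟩ := h.center_perp hc hx
    have hd := hc.dim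
    obtain ⟨β', hβ'⟩ := exists_eq_smul_of_orthogonal S (by omega) (h.center_ne_zero hc hx) (v := z')
      (hperp _ c1 c2 c3) (hperp _ hz1 h1x hzd)
    have h3 : lorentz z' (κ - Ka x) = β' * -(1 - lorentz κ κ) := by
      conv_lhs => rw [hβ']
      rw [lorentz_smul_left, h.lorentz_center hc hx]
    rw [lorentz_sub_right, lorentz_comm z' (Ka x), h1x, sub_zero] at h3
    have h4 : -lorentz z' κ / (1 - lorentz κ κ) = β' := by
      rw [h3]; field_simp
    rw [h4]; exact hβ'
  -- With a nonzero factor K_a would be constant near `p`, but its differential has rank k > 0.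
  have hb : -lorentz z' κ / (1 - lorentz κ κ) = 0 := by
    by_contra hb
    set b := -lorentz z' κ / (1 - lorentz κ κ) with hbd
    have h1 : ∀ᶠ x in 𝓝 p, Ka x = κ - b⁻¹ • z' := by
      filter_upwards [key] with x hx
      have : b⁻¹ • z' = κ - Ka x := by
        conv_lhs => rw [hx]
        rw [smul_smul, inv_mul_cancel₀ hb, one_smul]
      rw [this]; abel
    have h2 : dif n Ka p = 0 := by
      rw [dif_congr (g := fun _ => κ - b⁻¹ • z') h1]; exact (hasD_const _ p).dif_eq
    have h3 := hc.rank_a p hp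
    rw [h2, ker_zero_clm, finrank_top, finrank_euclideanSpace_fin] at h3
    have h4 := hc.dim
    have h5 := hc.k_pos
    omega
  have h1 := key.self_of_nhds
  rw [hb, zero_smul] at h1
  refine ⟨coadj D z, ?_⟩
  have h2 : z - D (coadj D z) - β • κ = 0 := h1
  rw [sub_sub, sub_eq_zero] at h2
  exact h2.trans (add_comm _ _)

/-- An affine function that is constant on an open family of spheres `K_b` is orthogonal to
`range D`. -/
theorem perp_of_const_b (h : Adapted Ka Kb D κ U) (hc : CurvPair F m k Ka Kb δ U) {p : M}
    (hp : p ∈ U) {z : Mink (n + 1 + 1)} {β : ℝ} (hz : ∀ᶠ x in 𝓝 p, lorentz (Kb x) z = β) :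
    (∀ y, lorentz z (D y) = 0) ∧ lorentz κ z = β := by
  have hR := h.radius_pos hc hp
  have hdim := h.dim_eq hc hp
  set w := coadj D z with hw
  have hwz : ∀ x ∈ U, lorentz (Kb x) z = lorentz κ z + inner ℝ w (coadj D (Kb x)) := by
    intro x hx
    conv_lhs => rw [h.eq_b hx]
    rw [lorentz_add_left, lorentz_comm (D _), hw, inner_coadj]
  set b := (β - lorentz κ z) / (1 - lorentz κ κ) with hb
  -- The vector `w` has constant product with the radius vector of K_b, so it is orthogonal to the
  -- m-dimensional tangent space of the sphere at each x. It is then a multiple of the radius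
  -- vector, with a factor independent of x.
  have key : ∀ᶠ x in 𝓝 p, w = b • coadj D (Kb x) := by
    filter_upwards [hz.eventually_nhds, hc.isOpen.mem_nhds hp] with x h1 hx
    set y := coadj D (Kb x) with hy
    have hyn : ‖y‖ ^ 2 = 1 - lorentz κ κ := h.norm_sq hc hx
    have hwy : inner ℝ w y = β - lorentz κ z := by
      have := hwz x hx
      rw [h1.self_of_nhds] at this
      linarith
    set R := LinearMap.range (coadj D ∘ₗ (dif n Kb x).toLinearMap) with hR'
    have hRf : Module.finrank ℝ R = m := h.finrank_range_coadj hc hx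
    have hyR : y ∈ Rᗮ := by
      rw [Submodule.mem_orthogonal]
      rintro _ ⟨t, rfl⟩
      rw [real_inner_comm]
      exact h.inner_coadj_dif hc hx t
    have hwR : w ∈ Rᗮ := by
      rw [Submodule.mem_orthogonal]
      rintro _ ⟨t, rfl⟩
      change inner ℝ (coadj D (dif n Kb x t)) w = 0
      have h2 : ∀ᶠ x in 𝓝 x, inner ℝ w (coadj D (Kb x)) = β - lorentz κ z := by
        filter_upwards [h1, hc.isOpen.mem_nhds hx] with x' h3 hx'
        have := hwz x' hx'
        rw [h3] at this
        linarith
      have h3 := inner_dif_of_const (hasD_const w x) (hasD_coadj (D := D) hc hx) h2 t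
      change inner ℝ w (coadj D (dif n Kb x t)) + inner ℝ (coadj D (Kb x)) (0 : Euc j) = 0
        at h3
      rw [inner_zero_right, add_zero] at h3
      rw [real_inner_comm]
      exact h3
    have hy0 : y ≠ 0 := by
      intro h0
      rw [h0] at hyn
      simp at hyn
      linarith
    have h1f : Module.finrank ℝ Rᗮ = 1 := by
      have := Submodule.finrank_add_finrank_orthogonal R
      rw [hRf] at this
      simp only [finrank_euclideanSpace, Fintype.card_fin] at this
      omega
    obtain ⟨b', hb'⟩ := (finrank_eq_one_iff_of_nonzero' (⟨y, hyR⟩ : Rᗮ)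
      (fun h => hy0 (congrArg Subtype.val h))).1 h1f ⟨w, hwR⟩
    have hb'' : w = b' • y := (congrArg Subtype.val hb').symm
    have : b = b' := by
      rw [hb, ← hwy, hb'', real_inner_smul_left, real_inner_self_eq_norm_sq, hyn]
      field_simp
    rw [this]; exact hb''
  -- Otherwise the radius vector, and with it K_b, would be constant near `p`.
  have hb0 : b = 0 := by
    by_contra hb0
    have h1 : ∀ᶠ x in 𝓝 p, Kb x = κ + D (b⁻¹ • w) := by
      filter_upwards [key, hc.isOpen.mem_nhds hp] with x h1 hx
      rw [h1, smul_smul, inv_mul_cancel₀ hb0, one_smul, ← h.eq_b hx]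
    have h2 : dif n Kb p = 0 := by
      rw [dif_congr (g := fun _ => κ + D (b⁻¹ • w)) h1]; exact (hasD_const _ p).dif_eq
    have h3 := hc.rank_b p hp
    rw [h2, ker_zero_clm, finrank_top, finrank_euclideanSpace_fin] at h3
    have h4 := hc.dim
    have h5 := hc.m_pos
    omega
  have hw0 : w = 0 := by rw [key.self_of_nhds, hb0, zero_smul]
  refine ⟨fun y => ?_, ?_⟩
  · rw [← inner_coadj, ← hw, hw0, inner_zero_left]
  · have := hwz p hp
    rw [hz.self_of_nhds, hw0, inner_zero_left, add_zero] at this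
    exact this.symm

end Adapted

end Spans

/-! ### Local structure of a pair of curvature spheres -/

section Local

open Topology Filter

variable {M : Type u} [TopologicalSpace M] {n : ℕ} [ChartedSpace (Euc n) M]

/-- The local inverse of a map with bijective differential. -/
theorem exists_local_inverse [IsManifold (𝓡 n) ∞ M] {G : Type*} [NormedAddCommGroup G]
    [NormedSpace ℝ G] [FiniteDimensional ℝ G] {Φ : M → G} {p : M} (hΦ : SmAt n Φ p)
    (hinj : Function.Injective (dif n Φ p)) (hdim : Module.finrank ℝ G = n) :
    ∃ Ξ : G → M, ContinuousAt Ξ (Φ p) ∧ (∀ᶠ x in 𝓝 p, Ξ (Φ x) = x) ∧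
      (∀ᶠ q in 𝓝 (Φ p), Φ (Ξ q) = q ∧ ContMDiffAt 𝓘(ℝ, G) (𝓡 n) 1 Ξ q) := by
  set χ := extChartAt (𝓡 n) p with hχ
  have hχp : χ.symm (χ p) = p := extChartAt_to_inv p
  have h1 : ContDiffAt ℝ ∞ (Φ ∘ χ.symm) (χ p) := by
    have := (contMDiffAt_iff.1 hΦ).2
    simp only [extChartAt_model_space_eq_id, modelWithCornersSelf_coe, Set.range_id,
      contDiffWithinAt_univ] at this
    exact this
  let P : Euc n ≃L[ℝ] G := (LinearEquiv.ofInjectiveOfFinrankEq (dif n Φ p).toLinearMap hinj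
    (by simp [hdim])).toContinuousLinearEquiv
  have h2 : HasFDerivAt (Φ ∘ χ.symm) (P : Euc n →L[ℝ] G) (χ p) := by
    have : (P : Euc n →L[ℝ] G) = dif n Φ p := by ext t; rfl
    rw [this]
    exact (hasD_iff.1 hΦ.hasD).2
  set e := h1.toOpenPartialHomeomorph (Φ ∘ χ.symm) h2 (by simp) with he
  have hec : ∀ y, e y = Φ (χ.symm y) := fun y => rfl
  have hes : χ p ∈ e.source := h1.mem_toOpenPartialHomeomorph_source h2 (by simp)
  have hep : e (χ p) = Φ p := by rw [hec, hχp]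
  have hsymm : ContDiffAt ℝ ∞ e.symm (Φ p) := by
    have h3 := e.contDiffAt_symm (f₀' := P) (a := Φ p) (n := ∞)
      (by rw [← hep]; exact e.map_source hes)
      (by rw [← hep, e.left_inv hes]; exact h2) (by rw [← hep, e.left_inv hes]; exact h1)
    exact h3
  have hesp : e.symm (Φ p) = χ p := by rw [← hep, e.left_inv hes]
  have htarget : χ.target ∈ 𝓝 (χ p) := extChartAt_target_mem_nhds p
  have hcχ : ContinuousAt χ.symm (χ p) := continuousAt_extChartAt_symm p
  refine ⟨fun q => χ.symm (e.symm q), ?_, ?_, ?_⟩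
  · exact ContinuousAt.comp (g := χ.symm) (by rw [hesp]; exact hcχ) hsymm.continuousAt
  · have h3 : ∀ᶠ x in 𝓝 p, χ x ∈ e.source :=
      (continuousAt_extChartAt p).preimage_mem_nhds (e.open_source.mem_nhds hes)
    filter_upwards [h3, extChartAt_source_mem_nhds (I := 𝓡 n) p] with x h4 h5
    have h6 : e (χ x) = Φ x := by rw [hec, χ.left_inv h5]
    rw [← h6, e.left_inv h4, χ.left_inv h5]
  · have h3 : ∀ᶠ q in 𝓝 (Φ p), q ∈ e.target := e.open_target.mem_nhds (by
      rw [← hep]; exact e.map_source hes)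
    have h4 : ∀ᶠ q in 𝓝 (Φ p), e.symm q ∈ χ.target :=
      hsymm.continuousAt.preimage_mem_nhds (by rw [hesp]; exact htarget)
    have h5 : ∀ᶠ q in 𝓝 (Φ p), ContDiffAt ℝ 1 e.symm q :=
      (hsymm.of_le (m := 1) (by exact_mod_cast le_top)).eventually (by simp)
    filter_upwards [h3, h4, h5] with q hq3 hq4 hq5
    refine ⟨?_, ?_⟩
    · rw [← hec, e.right_inv hq3]
    · have h6 : ContMDiffAt 𝓘(ℝ, Euc n) (𝓡 n) 1 χ.symm (e.symm q) := by
        have h7 := contMDiffOn_extChartAt_symm (I := 𝓡 n) (n := ∞) p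
        have h8 := h7.contMDiffAt ((isOpen_extChartAt_target p).mem_nhds hq4)
        exact h8.of_le (by exact_mod_cast le_top)
      exact ContMDiffAt.comp q h6 hq5.contMDiffAt

/-- `T` is the differential of `Ξ`. It is chosen before `g`, so that the derivatives of several maps
along `Ξ` can be compared. -/
theorem hasFDerivAt_comp_inverse {G : Type*} [NormedAddCommGroup G] [NormedSpace ℝ G]
    {Ξ : G → M} {q : G}
    (hΞ : ContMDiffAt 𝓘(ℝ, G) (𝓡 n) 1 Ξ q) :
    ∃ T : G →L[ℝ] Euc n, ∀ (F' : Type) [NormedAddCommGroup F'] [NormedSpace ℝ F'] (g : M → F'),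
      SmAt n g (Ξ q) → HasFDerivAt (fun q => g (Ξ q)) ((dif n g (Ξ q)).comp T) q := by
  refine ⟨mfderiv 𝓘(ℝ, G) (𝓡 n) Ξ q, fun F' _ _ g hg => ?_⟩
  have h1 := (hΞ.mdifferentiableAt (by simp)).hasMFDerivAt
  exact (HasMFDerivAt.comp q hg.hasD h1).hasFDerivAt

/-- A projection that detects the kernel of a linear map of rank `k`. -/
theorem exists_projection {V W : Type*} [AddCommGroup V] [Module ℝ V] [AddCommGroup W] [Module ℝ W]
    [FiniteDimensional ℝ V] {k : ℕ} (A : V →ₗ[ℝ] W)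
    (hA : Module.finrank ℝ (LinearMap.range A) = k) :
    ∃ G : W →ₗ[ℝ] Euc k, ∀ t, G (A t) = 0 → A t = 0 := by
  let E : LinearMap.range A ≃ₗ[ℝ] Euc k := LinearEquiv.ofFinrankEq _ _ (by simp [hA])
  obtain ⟨G, hG⟩ := LinearMap.exists_extend E.toLinearMap
  refine ⟨G, fun t ht => ?_⟩
  have h1 : G (A t) = E ⟨A t, ⟨t, rfl⟩⟩ := DFunLike.congr_fun hG ⟨A t, ⟨t, rfl⟩⟩
  rw [h1] at ht
  exact congrArg Subtype.val ((LinearEquiv.map_eq_zero_iff E).1 ht)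

variable {F Ka Kb : M → Mink (n + 1 + 1)} {m k : ℕ} {δ : M → ℝ} {U : Set M}

/-- Locally the two families of curvature spheres depend on complementary coordinates, so that any
sphere of one family touches any sphere of the other. -/
theorem CurvPair.exists_box [IsManifold (𝓡 n) ∞ M] (h : CurvPair F m k Ka Kb δ U) {p : M}
    (hp : p ∈ U) : ∃ V, IsOpen V ∧ p ∈ V ∧ V ⊆ U ∧
      ∀ x ∈ V, ∀ x' ∈ V, lorentz (Ka x) (Kb x') = 1 := by
  -- k coordinates taken from K_a and m coordinates taken from K_b give a chart at `p`, because the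
  -- kernels of the two differentials meet in zero.
  obtain ⟨Ga, hGa⟩ := exists_projection (dif n Ka p).toLinearMap (Adapted.finrank_range_a h hp)
  have hrb : Module.finrank ℝ (LinearMap.range (dif n Kb p).toLinearMap) = m := by
    have h1 := LinearMap.finrank_range_add_finrank_ker (dif n Kb p).toLinearMap
    rw [h.rank_b p hp] at h1
    have := h.dim
    simp only [finrank_euclideanSpace, Fintype.card_fin] at h1
    omega
  obtain ⟨Gb, hGb⟩ := exists_projection (dif n Kb p).toLinearMap hrb
  set Φ : M → Euc k × Euc m := fun x => (Ga (Ka x), Gb (Kb x)) with hΦ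
  have hΦs : ∀ x ∈ U, SmAt n Φ x := fun x hx =>
    ((h.smooth_a x hx).linear Ga).prodMk ((h.smooth_b x hx).linear Gb)
  have hΦd : ∀ x ∈ U, dif n Φ x = ((toCLM Ga).comp (dif n Ka x)).prod ((toCLM Gb).comp (dif n Kb x)) :=
    fun x hx => (((h.smooth_a x hx).hasD.linear Ga).prodMk ((h.smooth_b x hx).hasD.linear Gb)).dif_eq
  have hinj : Function.Injective (dif n Φ p) := by
    rw [injective_iff_map_eq_zero]
    intro t ht
    rw [hΦd p hp] at ht
    exact h.disjoint_ker hp (hGa t (congrArg Prod.fst ht)) (hGb t (congrArg Prod.snd ht))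
  obtain ⟨Ξ, hΞc, hΞl, hΞr⟩ := exists_local_inverse (hΦs p hp) hinj (by
    simp only [Module.finrank_prod, finrank_euclideanSpace, Fintype.card_fin]
    have := h.dim
    omega)
  have hΞp : Ξ (Φ p) = p := hΞl.self_of_nhds
  have hΞU : ∀ᶠ q in 𝓝 (Φ p), Ξ q ∈ U :=
    hΞc.preimage_mem_nhds (by rw [hΞp]; exact h.isOpen.mem_nhds hp)
  obtain ⟨ρ, hρ, hball⟩ := Metric.eventually_nhds_iff_ball.1 ((hΞr.eventually_nhds).and hΞU)
  -- derivatives in the box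
  have hder : ∀ q ∈ Metric.ball (Φ p) ρ, ∃ A B : Euc k × Euc m →L[ℝ] Mink (n + 1 + 1),
      HasFDerivAt (fun q => Ka (Ξ q)) A q ∧ HasFDerivAt (fun q => Kb (Ξ q)) B q ∧
      (∀ v, A (0, v) = 0) ∧ ∀ u, B (u, 0) = 0 := by
    intro q hq
    obtain ⟨h1, hqU⟩ := hball q hq
    obtain ⟨-, h2⟩ := h1.self_of_nhds
    obtain ⟨T, hT⟩ := hasFDerivAt_comp_inverse h2
    have hA := hT _ Ka (h.smooth_a _ hqU)
    have hB := hT _ Kb (h.smooth_b _ hqU)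
    have hP := hT _ Φ (hΦs _ hqU)
    -- `T` inverts dΦ on the right, so T (0, v) leaves the coordinates from K_a unchanged to first
    -- order, and T (u, 0) those from K_b.
    have hid : (dif n Φ (Ξ q)).comp T = ContinuousLinearMap.id ℝ _ := by
      apply hP.unique
      exact (hasFDerivAt_id q).congr_of_eventuallyEq (h1.mono fun q' hq' => hq'.1)
    rw [hΦd _ hqU] at hid
    have h3 : ∀ w, Ga (dif n Ka (Ξ q) (T w)) = w.1 := fun w =>
      congrArg Prod.fst (DFunLike.congr_fun hid w)
    have h4 : ∀ w, Gb (dif n Kb (Ξ q) (T w)) = w.2 := fun w =>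
      congrArg Prod.snd (DFunLike.congr_fun hid w)
    refine ⟨_, _, hA, hB, fun v => ?_, fun u => ?_⟩
    -- Constant rank enters here: composing with the projection can only enlarge the kernel, but
    -- both kernels have dimension m. So a direction that fixes the k coordinates fixes K_a itself
    -- to first order.
    · have hk : LinearMap.ker (dif n Ka (Ξ q)).toLinearMap =
          LinearMap.ker (Ga ∘ₗ (dif n Ka (Ξ q)).toLinearMap) := by
        apply Submodule.eq_of_le_of_finrank_le
        · intro t ht
          change Ga (dif n Ka (Ξ q) t) = 0
          rw [show dif n Ka (Ξ q) t = 0 from ht, map_zero]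
        · have h5 := LinearMap.finrank_range_add_finrank_ker (Ga ∘ₗ (dif n Ka (Ξ q)).toLinearMap)
          have h6 : LinearMap.range (Ga ∘ₗ (dif n Ka (Ξ q)).toLinearMap) = ⊤ := by
            rw [LinearMap.range_eq_top]
            exact fun w => ⟨T (w, 0), h3 (w, 0)⟩
          rw [h6, finrank_top] at h5
          rw [h.rank_a _ hqU]
          have := h.dim
          simp only [finrank_euclideanSpace, Fintype.card_fin] at h5
          omega
      have h7 : T (0, v) ∈ LinearMap.ker (Ga ∘ₗ (dif n Ka (Ξ q)).toLinearMap) := h3 (0, v)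
      rw [← hk] at h7
      exact h7
    · have hk : LinearMap.ker (dif n Kb (Ξ q)).toLinearMap =
          LinearMap.ker (Gb ∘ₗ (dif n Kb (Ξ q)).toLinearMap) := by
        apply Submodule.eq_of_le_of_finrank_le
        · intro t ht
          change Gb (dif n Kb (Ξ q) t) = 0
          rw [show dif n Kb (Ξ q) t = 0 from ht, map_zero]
        · have h5 := LinearMap.finrank_range_add_finrank_ker (Gb ∘ₗ (dif n Kb (Ξ q)).toLinearMap)
          have h6 : LinearMap.range (Gb ∘ₗ (dif n Kb (Ξ q)).toLinearMap) = ⊤ := by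
            rw [LinearMap.range_eq_top]
            exact fun w => ⟨T (0, w), h4 (0, w)⟩
          rw [h6, finrank_top] at h5
          rw [h.rank_b _ hqU]
          have := h.dim
          simp only [finrank_euclideanSpace, Fintype.card_fin] at h5
          omega
      have h7 : T (u, 0) ∈ LinearMap.ker (Gb ∘ₗ (dif n Kb (Ξ q)).toLinearMap) := h4 (u, 0)
      rw [← hk] at h7
      exact h7
  have hmem : ∀ y z, (y, z) ∈ Metric.ball (Φ p) ρ ↔
      y ∈ Metric.ball (Φ p).1 ρ ∧ z ∈ Metric.ball (Φ p).2 ρ := by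
    intro y z
    rw [← ball_prod_same, Set.mem_prod]
  have hconstA : ∀ y z z', (y, z) ∈ Metric.ball (Φ p) ρ → (y, z') ∈ Metric.ball (Φ p) ρ →
      Ka (Ξ (y, z)) = Ka (Ξ (y, z')) := by
    intro y z z' hz hz'
    have hd : ∀ w ∈ Metric.ball (Φ p).2 ρ, HasFDerivAt (fun w => Ka (Ξ (y, w)))
        (0 : Euc m →L[ℝ] Mink (n + 1 + 1)) w := by
      intro w hw
      obtain ⟨A, B, hA, -, hA0, -⟩ := hder (y, w) ((hmem _ _).2 ⟨((hmem _ _).1 hz).1, hw⟩)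
      have h1 := hA.comp w (hasFDerivAt_prodMk_right y w)
      have h2 : A.comp (ContinuousLinearMap.inr ℝ (Euc k) (Euc m)) = 0 := by
        ext1 v; exact hA0 v
      rw [h2] at h1
      exact h1
    exact Metric.isOpen_ball.is_const_of_fderiv_eq_zero (𝕜 := ℝ)
      (convex_ball _ _).isPreconnected
      (fun w hw => (hd w hw).differentiableAt.differentiableWithinAt)
      (fun w hw => (hd w hw).fderiv) ((hmem _ _).1 hz).2 ((hmem _ _).1 hz').2
  have hconstB : ∀ y y' z, (y, z) ∈ Metric.ball (Φ p) ρ → (y', z) ∈ Metric.ball (Φ p) ρ →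
      Kb (Ξ (y, z)) = Kb (Ξ (y', z)) := by
    intro y y' z hy hy'
    have hd : ∀ w ∈ Metric.ball (Φ p).1 ρ, HasFDerivAt (fun w => Kb (Ξ (w, z)))
        (0 : Euc k →L[ℝ] Mink (n + 1 + 1)) w := by
      intro w hw
      obtain ⟨A, B, -, hB, -, hB0⟩ := hder (w, z) ((hmem _ _).2 ⟨hw, ((hmem _ _).1 hy).2⟩)
      have h1 := HasFDerivAt.comp (f := fun w => (w, z)) w hB (hasFDerivAt_prodMk_left w z)
      have h2 : B.comp (ContinuousLinearMap.inl ℝ (Euc k) (Euc m)) = 0 := by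
        ext1 v; exact hB0 v
      rw [h2] at h1
      exact h1
    exact Metric.isOpen_ball.is_const_of_fderiv_eq_zero (𝕜 := ℝ)
      (convex_ball _ _).isPreconnected
      (fun w hw => (hd w hw).differentiableAt.differentiableWithinAt)
      (fun w hw => (hd w hw).fderiv) ((hmem _ _).1 hy).1 ((hmem _ _).1 hy').1
  have hev : ∀ᶠ x in 𝓝 p, Ξ (Φ x) = x ∧ Φ x ∈ Metric.ball (Φ p) ρ ∧ x ∈ U :=
    hΞl.and (Eventually.and ((hΦs p hp).continuousAt.preimage_mem_nhds (Metric.ball_mem_nhds _ hρ))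
      (h.isOpen.mem_nhds hp))
  obtain ⟨V, hV, hVo, hpV⟩ := eventually_nhds_iff.1 hev
  refine ⟨V, hVo, hpV, fun x hx => (hV x hx).2.2, fun x hx x' hx' => ?_⟩
  obtain ⟨h1, h2, -⟩ := hV x hx
  obtain ⟨h1', h2', -⟩ := hV x' hx'
  -- The point with these mixed coordinates has the sphere K_a of x and the sphere K_b of x', and
  -- two curvature spheres at one point have product 1. It exists because a ball of the product norm
  -- is a product of balls.
  have h3 : ((Φ x).1, (Φ x').2) ∈ Metric.ball (Φ p) ρ :=
    (hmem _ _).2 ⟨((hmem _ _).1 h2).1, ((hmem _ _).1 h2').2⟩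
  have h4 : Ka x = Ka (Ξ ((Φ x).1, (Φ x').2)) := by
    conv_lhs => rw [← h1]
    exact hconstA _ _ _ h2 h3
  have h5 : Kb x' = Kb (Ξ ((Φ x).1, (Φ x').2)) := by
    conv_lhs => rw [← h1']
    exact hconstB _ _ _ h2' h3
  rw [h4, h5]
  exact h.lorentz_ab (hball _ h3).2

/-- The span of the differences of the values of `K` on `V`. -/
def diffSpan {d : ℕ} (K : M → Mink d) (V : Set M) : Submodule ℝ (Mink d) :=
  Submodule.span ℝ {v | ∃ x ∈ V, ∃ x' ∈ V, v = K x - K x'}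

theorem diffSpan_neg {M : Type u} {d : ℕ} (K : M → Mink d) (V : Set M) :
    diffSpan (fun x => -K x) V = diffSpan K V := by
  unfold diffSpan
  congr 1
  ext v
  constructor
  · rintro ⟨x, hx, x', hx', rfl⟩
    exact ⟨x', hx', x, hx, neg_sub_neg _ _⟩
  · rintro ⟨x, hx, x', hx', rfl⟩
    exact ⟨x', hx', x, hx, (neg_sub_neg _ _).symm⟩

theorem lorentz_diffSpan {M : Type u} {d : ℕ} {K : M → Mink d} {V : Set M} {z : Mink d}
    (h : ∀ x ∈ V, ∀ x' ∈ V, lorentz z (K x) = lorentz z (K x')) {w : Mink d}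
    (hw : w ∈ diffSpan K V) : lorentz z w = 0 := by
  have h1 : diffSpan K V ≤ LinearMap.ker (lorentzForm d z) := by
    apply Submodule.span_le.2
    rintro _ ⟨x, hx, x', hx', rfl⟩
    change lorentz z (K x - K x') = 0
    rw [lorentz_sub_right, h x hx x' hx', sub_self]
  exact h1 hw

/-- All K_b have the same component orthogonal to the span of their differences, and this component
is κ. By the box property K_a is orthogonal to the differences, so its product with κ equals its
product with K_b. -/
theorem CurvPair.adapted_of_pos (h : CurvPair F m k Ka Kb δ U) {p : M} (hp : p ∈ U)
    (hbox : ∀ x ∈ U, ∀ x' ∈ U, lorentz (Ka x) (Kb x') = 1)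
    (hpos : ∀ w ∈ diffSpan Kb U, w ≠ 0 → 0 < lorentz w w) :
    ∃ (D : Euc (m + 1) →ₗ[ℝ] Mink (n + 1 + 1)) (κ : Mink (n + 1 + 1)), Adapted Ka Kb D κ U := by
  -- The dimension of the span is not known beforehand; `Adapted.dim_eq` identifies it once an
  -- adapted pair is available.
  have hex : ∀ j, Module.finrank ℝ (diffSpan Kb U) = j →
      ∃ (D : Euc j →ₗ[ℝ] Mink (n + 1 + 1)) (κ : Mink (n + 1 + 1)), Adapted Ka Kb D κ U := by
    intro j hj
    obtain ⟨D, hD, hDr⟩ := exists_isometry_of_pos _ hj hpos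
    have hDm : ∀ y, D y ∈ diffSpan Kb U := fun y => by rw [← hDr]; exact ⟨y, rfl⟩
    refine ⟨D, Kb p - D (coadj D (Kb p)), hD, fun y => ?_, fun x hx y => ?_, fun x hx => ?_,
      fun x hx => ?_⟩
    · rw [lorentz_sub_left, hD, inner_coadj, sub_self]
    · exact lorentz_diffSpan (fun x' hx' x'' hx'' => by rw [hbox x hx x' hx', hbox x hx x'' hx''])
        (hDm y)
    · rw [lorentz_sub_right, hbox x hx p hp, lorentz_diffSpan (fun x' hx' x'' hx'' => by
        rw [hbox x hx x' hx', hbox x hx x'' hx'']) (hDm _), sub_zero]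
    · have h1 : Kb x - Kb p ∈ LinearMap.range D := by
        rw [hDr]; exact Submodule.subset_span ⟨x, hx, p, hp, rfl⟩
      obtain ⟨y, hy⟩ := h1
      refine ⟨y + coadj D (Kb p), ?_⟩
      rw [map_add, hy]; abel
  obtain ⟨D, κ, hA⟩ := hex _ rfl
  exact hex _ (hA.dim_eq h hp)

/-- Locally one of the two families of curvature spheres spans a Euclidean affine subspace. -/
theorem CurvPair.exists_adapted [IsManifold (𝓡 n) ∞ M] (h : CurvPair F m k Ka Kb δ U) {p : M}
    (hp : p ∈ U) : ∃ V, IsOpen V ∧ p ∈ V ∧ V ⊆ U ∧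
      ((∃ (D : Euc (m + 1) →ₗ[ℝ] Mink (n + 1 + 1)) (κ : Mink (n + 1 + 1)), Adapted Ka Kb D κ V) ∨
        ∃ (D : Euc (k + 1) →ₗ[ℝ] Mink (n + 1 + 1)) (κ : Mink (n + 1 + 1)),
          Adapted (fun x => -Kb x) (fun x => -Ka x) D κ V) := by
  obtain ⟨V, hVo, hpV, hVU, hbox⟩ := h.exists_box hp
  have hV := h.mono hVU hVo
  refine ⟨V, hVo, hpV, hVU, ?_⟩
  by_cases hb : ∀ w ∈ diffSpan Kb V, w ≠ 0 → 0 < lorentz w w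
  · exact Or.inl (hV.adapted_of_pos hpV hbox hb)
  by_cases ha : ∀ w ∈ diffSpan Ka V, w ≠ 0 → 0 < lorentz w w
  · refine Or.inr (hV.swap.adapted_of_pos hpV (fun x hx x' hx' => ?_) ?_)
    · rw [lorentz_neg_left, lorentz_neg_right, neg_neg, lorentz_comm, hbox x' hx' x hx]
    · rw [diffSpan_neg]; exact ha
  -- If neither span is positive definite, each contains a nonzero vector that is not space-like.
  -- The two vectors are orthogonal, hence proportional, so `v` is orthogonal to all spheres of both
  -- families.
  exfalso
  push Not at ha hb
  obtain ⟨v, hv, hv0, hvv⟩ := ha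
  obtain ⟨w, hw, hw0, hww⟩ := hb
  have hKaw : ∀ x ∈ V, lorentz (Ka x) w = 0 := fun x hx =>
    lorentz_diffSpan (fun x' hx' x'' hx'' => by rw [hbox x hx x' hx', hbox x hx x'' hx'']) hw
  have hKbv : ∀ x ∈ V, lorentz (Kb x) v = 0 := fun x hx =>
    lorentz_diffSpan (fun x' hx' x'' hx'' => by
      rw [lorentz_comm, hbox x' hx' x hx, lorentz_comm, hbox x'' hx'' x hx]) hv
  have hvw : lorentz v w = 0 := by
    rw [lorentz_comm]
    exact lorentz_diffSpan (fun x hx x' hx' => by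
      rw [lorentz_comm, hKaw x hx, lorentz_comm, hKaw x' hx']) hv
  obtain ⟨hv2, hwv⟩ := eq_smul_of_nonpos hvv hww hvw hv0
  have hr : w.2 / v.2 ≠ 0 := by
    intro h0
    rw [h0, zero_smul] at hwv
    exact hw0 hwv
  have hKav : ∀ x ∈ V, lorentz (Ka x) v = 0 := by
    intro x hx
    have := hKaw x hx
    rw [hwv, lorentz_smul_right] at this
    exact (mul_eq_zero.1 this).resolve_left hr
  -- δF = K_b - K_a; so `F`, being light-like, runs in the line of `v`, which is then light-like
  -- too.
  have hFv : ∀ x ∈ V, lorentz v (F x) = 0 := by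
    intro x hx
    have h1 := hKbv x hx
    rw [h.eq x (hVU hx), lorentz_add_left, lorentz_smul_left, hKav x hx, zero_add] at h1
    rw [lorentz_comm]
    exact (mul_eq_zero.1 h1).resolve_left (h.ne x (hVU hx))
  have hFe : ∀ x ∈ V, F x = ((F x).2 / v.2) • v := fun x hx =>
    (eq_smul_of_nonpos hvv (h.lift.null x (hVU hx)).le (hFv x hx) hv0).2
  have hvnull : lorentz v v = 0 := by
    have h1 := hFv p hpV
    have h2 := hFe p hpV
    rw [h2, lorentz_smul_right] at h1
    refine (mul_eq_zero.1 h1).resolve_left fun h3 => ?_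
    rw [h3, zero_smul] at h2
    exact h.lift.ne p hp h2
  -- A lift with values in a light-like line has a light-like differential, so it is no immersion of
  -- the required kind.
  have hd : HasD n (fun x => ((F x).2 / v.2) • v) p
      ((ContinuousLinearMap.toSpanSingleton ℝ v).comp
        (((v.2)⁻¹ • ContinuousLinearMap.snd ℝ (Euc (n + 1 + 1)) ℝ).comp (dif n F p))) := by
    have h1 := ((h.lift.smooth p hp).hasD.clm
      ((v.2)⁻¹ • ContinuousLinearMap.snd ℝ (Euc (n + 1 + 1)) ℝ)).clm
        (ContinuousLinearMap.toSpanSingleton ℝ v)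
    refine h1.congr (Eventually.of_forall fun x => ?_)
    simp [div_eq_inv_mul]
  have hdF : dif n F p = _ := (dif_congr (eventually_of_mem (hVo.mem_nhds hpV) hFe)).trans hd.dif_eq
  obtain ⟨t, ht0, -⟩ := h.exists_ker_a hp
  have h1 := h.lift.pos p hp t ht0
  rw [hdF] at h1
  simp [lorentz_smul_left, lorentz_smul_right, hvnull] at h1

end Local

/-! ### Light cone models and Möbius transformations -/

section LightCone

variable {N : ℕ}

/-- The inclusion of `ℝ^k` into `ℝ^{k+1}` as the last coordinates. -/
def embSucc (k : ℕ) : Euc k →ₗ[ℝ] Euc (k + 1) where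
  toFun x := WithLp.toLp 2 (Fin.cons 0 x : Fin (k + 1) → ℝ)
  map_add' x y := by
    ext i
    refine Fin.cases ?_ (fun i => ?_) i <;> simp
  map_smul' r x := by
    ext i
    refine Fin.cases ?_ (fun i => ?_) i <;> simp

/-- The projection of `ℝ^{k+1}` to the last coordinates. -/
def tailSucc (k : ℕ) : Euc (k + 1) →ₗ[ℝ] Euc k where
  toFun x := WithLp.toLp 2 (fun i => x i.succ)
  map_add' x y := by ext i; simp
  map_smul' r x := by ext i; simp

/-- The first basis vector. -/
def e₀ (k : ℕ) : Euc (k + 1) := EuclideanSpace.single 0 1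

theorem embSucc_zero {k : ℕ} (x : Euc k) : embSucc k x 0 = 0 := rfl

theorem embSucc_succ {k : ℕ} (x : Euc k) (i : Fin k) : embSucc k x i.succ = x i := rfl

theorem inner_embSucc {k : ℕ} (x y : Euc k) : inner ℝ (embSucc k x) (embSucc k y) = inner ℝ x y := by
  simp [PiLp.inner_apply, Fin.sum_univ_succ, embSucc_zero, embSucc_succ]

theorem inner_embSucc_e₀ {k : ℕ} (x : Euc k) : inner ℝ (embSucc k x) (e₀ k) = 0 := by
  simp [e₀, EuclideanSpace.inner_single_right, embSucc_zero]

theorem norm_e₀ (k : ℕ) : ‖e₀ k‖ = 1 := by simp [e₀]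

theorem tailSucc_embSucc {k : ℕ} (x : Euc k) : tailSucc k (embSucc k x) = x := by
  ext i; rfl

theorem eq_embSucc_add {k : ℕ} (x : Euc (k + 1)) :
    x = embSucc k (tailSucc k x) + x 0 • e₀ k := by
  ext i
  refine Fin.cases ?_ (fun i => ?_) i
  · simp [embSucc_zero, e₀]
  · simp [embSucc_succ, e₀, tailSucc]

namespace LightConeModel

variable (τ : LightConeModel N)

theorem lorentz_w_p₀ : lorentz τ.w τ.p₀ = 1 := by rw [lorentz_comm, τ.p₀_w]

theorem lorentz_p₀_A (v : Euc N) : lorentz τ.p₀ (τ.A v) = 0 := by rw [lorentz_comm, τ.A_p₀]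

theorem lorentz_w_A (v : Euc N) : lorentz τ.w (τ.A v) = 0 := by rw [lorentz_comm, τ.A_w]

theorem w_ne_zero : τ.w ≠ 0 := by
  intro h
  have := τ.p₀_w
  rw [h, lorentz_zero_right] at this
  norm_num at this

theorem psi_w (x : Euc N) : lorentz (τ.psi x) τ.w = 1 := by
  simp only [psi, lorentz_sub_left, lorentz_add_left, lorentz_smul_left, τ.p₀_w, τ.A_w, τ.w_null]
  ring

theorem psi_A (x v : Euc N) : lorentz (τ.psi x) (τ.A v) = inner ℝ x v := by
  simp only [psi, lorentz_sub_left, lorentz_add_left, lorentz_smul_left, lorentz_p₀_A,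
    lorentz_w_A, τ.A_isometry]
  ring

theorem psi_p₀ (x : Euc N) : lorentz (τ.psi x) τ.p₀ = -(1 / 2 * ‖x‖ ^ 2) := by
  simp only [psi, lorentz_sub_left, lorentz_add_left, lorentz_smul_left, τ.p₀_null, τ.A_p₀,
    lorentz_w_p₀]
  ring

/-- Products of points of the model encode distances. This makes -2Ψ(a) the new vector at infinity
for the inversion about `a`. -/
theorem psi_psi (x y : Euc N) : lorentz (τ.psi x) (τ.psi y) = -(1 / 2 * ‖x - y‖ ^ 2) := by
  conv_lhs => arg 2; rw [psi]
  rw [lorentz_sub_right, lorentz_add_right, lorentz_smul_right, psi_w, psi_A, psi_p₀,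
    norm_sub_sq_real]
  ring

theorem psi_null (x : Euc N) : lorentz (τ.psi x) (τ.psi x) = 0 := by
  rw [psi_psi, sub_self, norm_zero]; norm_num

theorem psi_ne_zero (x : Euc N) : τ.psi x ≠ 0 := by
  intro h
  have := τ.psi_w x
  rw [h, lorentz_zero_left] at this
  norm_num at this

theorem inner_proj (F : Mink (N + 1)) (v : Euc N) :
    inner ℝ (τ.proj F) v = lorentz F (τ.A v) / lorentz F τ.w := by
  rw [← inner_coadj]
  have : τ.proj F = (lorentz F τ.w)⁻¹ • coadj τ.A F := by
    ext i
    simp [proj, coadj, div_eq_inv_mul]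
  rw [this, real_inner_smul_left, div_eq_inv_mul]

theorem proj_eq_of_forall {F : Mink (N + 1)} {y : Euc N}
    (h : ∀ v, lorentz F (τ.A v) / lorentz F τ.w = inner ℝ y v) : τ.proj F = y :=
  ext_inner_right ℝ fun v => by rw [inner_proj, h]

theorem proj_psi (x : Euc N) : τ.proj (τ.psi x) = x :=
  τ.proj_eq_of_forall fun v => by rw [psi_A, psi_w, div_one]

theorem proj_smul {r : ℝ} (hr : r ≠ 0) (F : Mink (N + 1)) : τ.proj (r • F) = τ.proj F :=
  τ.proj_eq_of_forall fun v => by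
    rw [inner_proj, lorentz_smul_left, lorentz_smul_left, mul_div_mul_left _ _ hr]

/-- The light cone model transported by a linear isometry. -/
def map (τ : LightConeModel N) (K : Mink (N + 1) →ₗ[ℝ] Mink (N + 1))
    (hK : ∀ u v, lorentz (K u) (K v) = lorentz u v) : LightConeModel N where
  p₀ := K τ.p₀
  w := K τ.w
  A := K ∘ₗ τ.A
  p₀_null := by rw [hK, τ.p₀_null]
  w_null := by rw [hK, τ.w_null]
  p₀_w := by rw [hK, τ.p₀_w]
  A_isometry x y := by simp only [LinearMap.comp_apply, hK, τ.A_isometry]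
  A_p₀ x := by simp only [LinearMap.comp_apply, hK, τ.A_p₀]
  A_w x := by simp only [LinearMap.comp_apply, hK, τ.A_w]

/-- The light cone model that describes the same points after a similarity. -/
def similarity (τ : LightConeModel N) (r : ℝ) (hr : r ≠ 0) (U : Euc N ≃ₗᵢ[ℝ] Euc N) (b : Euc N) :
    LightConeModel N where
  -- The choice of `A` and `w` makes ⟨Ψ(x), A v⟩ / ⟨Ψ(x), w⟩ equal to ⟨r U x + b, v⟩. This `p₀` is
  -- then forced: it is the light-like vector orthogonal to the image of the new `A` whose product
  -- with the new `w` is 1.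
  p₀ := r • τ.p₀ - τ.A (U.symm b) - (‖b‖ ^ 2 / (2 * r)) • τ.w
  w := r⁻¹ • τ.w
  A := τ.A ∘ₗ U.symm.toLinearEquiv.toLinearMap +
    LinearMap.smulRight (r⁻¹ • (innerSL ℝ b).toLinearMap) τ.w
  p₀_null := by
    simp only [lorentz_sub_left, lorentz_sub_right, lorentz_smul_left, lorentz_smul_right,
      τ.p₀_null, τ.w_null, τ.A_isometry, τ.p₀_w, τ.A_p₀, τ.A_w, lorentz_p₀_A, lorentz_w_A,
      lorentz_w_p₀, LinearIsometryEquiv.inner_map_map, real_inner_self_eq_norm_sq]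
    field_simp
    ring
  w_null := by simp only [lorentz_smul_left, lorentz_smul_right, τ.w_null]; ring
  p₀_w := by
    simp only [lorentz_sub_left, lorentz_smul_left, lorentz_smul_right, τ.w_null, τ.p₀_w, τ.A_w]
    field_simp
    ring
  A_isometry x y := by
    simp [lorentz_add_left, lorentz_add_right, lorentz_smul_left, lorentz_smul_right,
      τ.w_null, τ.A_isometry, τ.A_w, lorentz_w_A]
  A_p₀ x := by
    simp [lorentz_add_left, lorentz_sub_right, lorentz_smul_left, lorentz_smul_right,
      τ.w_null, τ.A_isometry, τ.A_w, lorentz_w_A, τ.A_p₀, lorentz_w_p₀]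
    rw [real_inner_comm]
    field_simp
    ring
  A_w x := by
    simp [lorentz_add_left, lorentz_smul_left, lorentz_smul_right, τ.w_null, τ.A_w]

theorem similarity_w (r : ℝ) (hr : r ≠ 0) (U : Euc N ≃ₗᵢ[ℝ] Euc N) (b : Euc N) :
    (τ.similarity r hr U b).w = r⁻¹ • τ.w := rfl

theorem proj_similarity (r : ℝ) (hr : r ≠ 0) (U : Euc N ≃ₗᵢ[ℝ] Euc N) (b : Euc N)
    {F : Mink (N + 1)} (hF : lorentz F τ.w ≠ 0) :
    (τ.similarity r hr U b).proj F = r • U (τ.proj F) + b := by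
  apply proj_eq_of_forall
  intro v
  have h1 : (τ.similarity r hr U b).A v = τ.A (U.symm v) + (r⁻¹ * inner ℝ b v) • τ.w := by
    simp [similarity]
  have h2 : inner ℝ (U (τ.proj F)) v = inner ℝ (τ.proj F) (U.symm v) := by
    conv_lhs => rw [← U.apply_symm_apply v]
    rw [U.inner_map_map]
  rw [h1, similarity_w, inner_add_left, real_inner_smul_left, h2, inner_proj, lorentz_add_right,
    lorentz_smul_right, lorentz_smul_right]
  field_simp

/-- The light cone model that describes the same points after an inversion. -/
def inversion (τ : LightConeModel N) (a : Euc N) : LightConeModel N where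
  p₀ := -(1 / 2 : ℝ) • τ.w - (τ.A a - ‖a‖ ^ 2 • τ.w) + ‖a‖ ^ 2 • τ.psi a
  -- Since ⟨Ψ(x), -2Ψ(a)⟩ = ‖x - a‖², the quotient ⟨Ψ(x), A v⟩ / ⟨Ψ(x), w⟩ becomes ⟨x - a, v⟩ / ‖x -
  -- a‖² + ⟨a, v⟩.
  w := (-2 : ℝ) • τ.psi a
  A := τ.A - LinearMap.smulRight (innerSL ℝ a).toLinearMap τ.w +
    LinearMap.smulRight (innerSL ℝ a).toLinearMap ((-2 : ℝ) • τ.psi a)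
  p₀_null := by
    simp only [lorentz_add_left, lorentz_add_right, lorentz_sub_left, lorentz_sub_right,
      lorentz_smul_left, lorentz_smul_right, τ.w_null, τ.A_isometry, τ.A_w, lorentz_w_A, psi_null,
      psi_A, psi_w, lorentz_comm τ.w (τ.psi a), lorentz_comm (τ.A a) (τ.psi a),
      real_inner_self_eq_norm_sq]
    ring
  w_null := by simp only [lorentz_smul_left, lorentz_smul_right, psi_null]; ring
  p₀_w := by
    simp only [lorentz_add_left, lorentz_sub_left,
      lorentz_smul_left, lorentz_smul_right, psi_null,
      lorentz_comm τ.w (τ.psi a), lorentz_comm (τ.A a) (τ.psi a), psi_A, psi_w,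
      real_inner_self_eq_norm_sq]
    ring
  A_isometry x y := by
    simp [lorentz_add_left, lorentz_add_right, lorentz_sub_left, lorentz_sub_right,
      lorentz_smul_left, lorentz_smul_right, τ.w_null, τ.A_isometry, τ.A_w, lorentz_w_A, psi_null,
      psi_A, psi_w, lorentz_comm τ.w (τ.psi a), lorentz_comm (τ.A x) (τ.psi a), lorentz_neg_left,
      lorentz_neg_right]
    ring
  A_p₀ x := by
    simp [lorentz_add_left, lorentz_add_right, lorentz_sub_left, lorentz_sub_right,
      lorentz_smul_left, lorentz_smul_right, τ.w_null, τ.A_isometry, τ.A_w, lorentz_w_A, psi_null,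
      psi_A, psi_w, lorentz_comm τ.w (τ.psi a), lorentz_comm (τ.A x) (τ.psi a), lorentz_neg_left,
      lorentz_neg_right, real_inner_comm a x]
    ring
  A_w x := by
    simp [lorentz_add_left, lorentz_sub_left,
      lorentz_smul_left, lorentz_smul_right, psi_null,
      psi_w, lorentz_comm τ.w (τ.psi a), lorentz_comm (τ.A x) (τ.psi a), psi_A, lorentz_neg_left,
      lorentz_neg_right]

theorem inversion_w (a : Euc N) : (τ.inversion a).w = (-2 : ℝ) • τ.psi a := rfl

theorem psi_inversion_w (a x : Euc N) : lorentz (τ.psi x) (τ.inversion a).w = ‖x - a‖ ^ 2 := by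
  rw [inversion_w, lorentz_smul_right, psi_psi]; ring

theorem proj_inversion {a x : Euc N} (hx : x ≠ a) :
    (τ.inversion a).proj (τ.psi x) = EuclideanGeometry.inversion a 1 x := by
  apply proj_eq_of_forall
  intro v
  have h1 : (τ.inversion a).A v = τ.A v - inner ℝ a v • τ.w + inner ℝ a v • (τ.inversion a).w := by
    simp [inversion]
  have h0 : ‖x - a‖ ≠ 0 := norm_ne_zero_iff.2 (sub_ne_zero.2 hx)
  rw [h1, lorentz_add_right, lorentz_sub_right, lorentz_smul_right, lorentz_smul_right,
    psi_inversion_w, psi_A, psi_w]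
  simp only [EuclideanGeometry.inversion, dist_eq_norm, vsub_eq_sub, vadd_eq_add, inner_add_left,
    real_inner_smul_left, inner_sub_left]
  field_simp

/-- A Möbius transformation amounts to a change of the light cone model. -/
theorem exists_of_isMoebiusOn {T : Euc N → Euc N} {S : Set (Euc N)} (hT : IsMoebiusOn T S) :
    ∃ τ' : LightConeModel N, ∀ x ∈ S,
      lorentz (τ.psi x) τ'.w ≠ 0 ∧ T x = τ'.proj (τ.psi x) := by
  obtain ⟨r, U, b, hr, h | ⟨a, ha, h⟩⟩ := hT
  · refine ⟨τ.similarity r hr.ne' U b, fun x hx => ⟨?_, ?_⟩⟩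
    · rw [similarity_w, lorentz_smul_right, psi_w, mul_one]
      exact inv_ne_zero hr.ne'
    · rw [h x hx, proj_similarity _ _ _ _ _ (by rw [psi_w]; norm_num), proj_psi]
  · refine ⟨(τ.inversion a).similarity r hr.ne' U b, fun x hx => ?_⟩
    have hxa : x ≠ a := fun h0 => ha (h0 ▸ hx)
    have h1 : lorentz (τ.psi x) (τ.inversion a).w ≠ 0 := by
      rw [psi_inversion_w]
      exact pow_ne_zero 2 (norm_ne_zero_iff.2 (sub_ne_zero.2 hxa))
    refine ⟨?_, ?_⟩
    · rw [similarity_w, lorentz_smul_right]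
      exact mul_ne_zero (inv_ne_zero hr.ne') h1
    · rw [h x hx, proj_similarity _ _ _ _ _ h1, proj_inversion _ hxa]

/-- Two light cone models with the same point at infinity differ by a similarity. -/
theorem exists_similarity {τ τ' : LightConeModel N} {l : ℝ} (hl : l ≠ 0) (hw : τ'.w = l • τ.w) :
    ∃ (r : ℝ) (U : Euc N ≃ₗᵢ[ℝ] Euc N) (b : Euc N), 0 < r ∧
      ∀ F, lorentz F τ.w ≠ 0 → τ'.proj F = r • U (τ.proj F) + b := by
  have hperp : ∀ v, lorentz (τ'.A v) τ.w = 0 := by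
    intro v
    have := τ'.A_w v
    rw [hw, lorentz_smul_right] at this
    exact (mul_eq_zero.1 this).resolve_left hl
  -- The image of the second `A` is orthogonal to the common light-like direction, hence lies in the
  -- first image plus that direction. The first component is an isometry and the second gives the
  -- translation.
  have hdec : ∀ v, τ'.A v = τ.A (coadj τ.A (τ'.A v)) + lorentz (τ'.A v) τ.p₀ • τ.w := by
    intro v
    obtain ⟨x, s, t, h⟩ := τ.exists_decomp (τ'.A v)
    have h1 := hperp v
    have h2 : lorentz (τ'.A v) τ.p₀ = t := by
      rw [h]
      simp only [lorentz_add_left, lorentz_smul_left, τ.A_p₀, τ.p₀_null, lorentz_w_p₀]; ring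
    have h3 : coadj τ.A (τ'.A v) = x := by
      apply ext_inner_right ℝ
      intro z
      rw [inner_coadj, h]
      simp only [lorentz_add_left, lorentz_smul_left, τ.A_isometry, lorentz_p₀_A, lorentz_w_A]
      ring
    rw [h] at h1
    simp only [lorentz_add_left, lorentz_smul_left, τ.A_w, τ.p₀_w, τ.w_null] at h1
    have hs : s = 0 := by linarith
    rw [h2, h3]
    rw [hs, zero_smul, add_zero] at h
    exact h
  let z : Euc N →ₗᵢ[ℝ] Euc N := LinearMap.isometryOfInner (coadj τ.A ∘ₗ τ'.A) (by
    intro x y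
    rw [← τ'.A_isometry x y]
    conv_rhs => rw [hdec x, hdec y]
    simp only [LinearMap.comp_apply, lorentz_add_left, lorentz_add_right, lorentz_smul_left,
      lorentz_smul_right, τ.A_isometry, τ.A_w, lorentz_w_A, τ.w_null]
    ring)
  have hz : ∀ v, z v = coadj τ.A (τ'.A v) := fun v => rfl
  let Z : Euc N ≃ₗᵢ[ℝ] Euc N := z.toLinearIsometryEquiv rfl
  have hZ : ∀ v, Z v = z v := fun v => rfl
  have key : ∀ F, lorentz F τ.w ≠ 0 →
      τ'.proj F = l⁻¹ • Z.symm (τ.proj F) + l⁻¹ • coadj τ'.A τ.p₀ := by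
    intro F hF
    apply proj_eq_of_forall
    intro v
    have h2 : inner ℝ (Z.symm (τ.proj F)) v = inner ℝ (τ.proj F) (z v) := by
      rw [← hZ, ← Z.inner_map_map, Z.apply_symm_apply]
    rw [inner_add_left, real_inner_smul_left, real_inner_smul_left, h2, inner_coadj, hz, inner_proj,
      hw, lorentz_smul_right]
    conv_lhs => rw [hdec v]
    rw [lorentz_add_right, lorentz_smul_right, lorentz_comm τ.p₀ (τ'.A v)]
    field_simp
  -- The scale factor must be positive, so a negative sign of `l` is absorbed by the isometry -1.
  rcases lt_or_gt_of_ne hl with h0 | h0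
  · refine ⟨-l⁻¹, Z.symm.trans (LinearIsometryEquiv.neg ℝ), l⁻¹ • coadj τ'.A τ.p₀,
      neg_pos.2 (inv_lt_zero.2 h0), fun F hF => ?_⟩
    rw [key F hF]
    simp
  · exact ⟨l⁻¹, Z.symm, l⁻¹ • coadj τ'.A τ.p₀, inv_pos.2 h0, key⟩

/-- The change of the light cone model is a Möbius transformation. -/
theorem isMoebiusOn (τ τ' : LightConeModel N) :
    IsMoebiusOn (fun x => τ'.proj (τ.psi x)) {x | lorentz (τ.psi x) τ'.w ≠ 0} := by
  -- Orthogonal light-like vectors are proportional: then both models have the same point at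
  -- infinity. Otherwise the second point at infinity is a finite point `a` of the first model, and
  -- an inversion about `a` reduces to the first case.
  by_cases h0 : lorentz τ.w τ'.w = 0
  · have h1 := (eq_smul_of_nonpos τ.w_null.le τ'.w_null.le h0 τ.w_ne_zero).2
    set l := τ'.w.2 / τ.w.2 with hl
    have hl0 : l ≠ 0 := by
      intro h2
      rw [h2, zero_smul] at h1
      exact τ'.w_ne_zero h1
    obtain ⟨r, U, b, hr, h⟩ := exists_similarity hl0 h1
    refine ⟨r, U, b, hr, Or.inl fun x _ => ?_⟩
    change τ'.proj (τ.psi x) = _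
    rw [h _ (by rw [psi_w]; norm_num), proj_psi]
  · set a := τ.proj τ'.w with ha
    have h0' : lorentz τ'.w τ.w ≠ 0 := by rwa [lorentz_comm]
    have h1 : τ.psi a = (lorentz τ'.w τ.w)⁻¹ • τ'.w := τ.psi_proj _ τ'.w_null h0'
    have h2 : τ'.w = (-(1 / 2) * lorentz τ'.w τ.w) • (τ.inversion a).w := by
      rw [inversion_w, h1, smul_smul, smul_smul]
      have : -(1 / 2) * lorentz τ'.w τ.w * -2 * (lorentz τ'.w τ.w)⁻¹ = 1 := by field_simp
      rw [this, one_smul]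
    obtain ⟨r, U, b, hr, h⟩ := exists_similarity
      (mul_ne_zero (by norm_num) h0') h2
    refine ⟨r, U, b, hr, Or.inr ⟨a, ?_, fun x hx => ?_⟩⟩
    · change ¬ lorentz (τ.psi a) τ'.w ≠ 0
      rw [not_not]
      rw [h1, lorentz_smul_left, τ'.w_null, mul_zero]
    · have hxw : lorentz (τ.psi x) (τ.inversion a).w ≠ 0 := by
        intro h3
        apply hx
        rw [h2, lorentz_smul_right, h3, mul_zero]
      have hxa : x ≠ a := by
        rintro rfl
        rw [psi_inversion_w, sub_self, norm_zero] at hxw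
        norm_num at hxw
      change τ'.proj (τ.psi x) = _
      rw [h _ hxw, proj_inversion _ hxa]

/-- The linear isometry that carries one light cone model to another. -/
theorem exists_transport (τ τ' : LightConeModel N) :
    ∃ L : Mink (N + 1) →ₗ[ℝ] Mink (N + 1), (∀ u v, lorentz (L u) (L v) = lorentz u v) ∧
      (∀ v, lorentz (L v) τ.w = lorentz v τ'.w) ∧ ∀ v, τ.proj (L v) = τ'.proj v := by
  -- `L` carries `p₀`, `w`, `A` of the second model to those of the first; since p₀ and w are dual
  -- to each other, the coefficient along `p₀` is a product with `w` and vice versa.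
  let L : Mink (N + 1) →ₗ[ℝ] Mink (N + 1) := τ.A ∘ₗ coadj τ'.A +
    LinearMap.smulRight (lorentzForm _ τ'.w) τ.p₀ + LinearMap.smulRight (lorentzForm _ τ'.p₀) τ.w
  have hL : ∀ v, L v = τ.A (coadj τ'.A v) + lorentz τ'.w v • τ.p₀ + lorentz τ'.p₀ v • τ.w :=
    fun v => rfl
  have hw : ∀ v, lorentz (L v) τ.w = lorentz v τ'.w := by
    intro v
    rw [hL]
    simp only [lorentz_add_left, lorentz_smul_left, τ.A_w, τ.p₀_w, τ.w_null, lorentz_comm v τ'.w]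
    ring
  have hA : ∀ v z, lorentz (L v) (τ.A z) = lorentz v (τ'.A z) := by
    intro v z
    rw [hL]
    simp only [lorentz_add_left, lorentz_smul_left, lorentz_p₀_A, lorentz_w_A, τ.A_isometry,
      inner_coadj]
    ring
  refine ⟨L, fun u v => ?_, hw, fun v => ?_⟩
  · have hp : lorentz (L u) τ.p₀ = lorentz u τ'.p₀ := by
      rw [hL]
      simp only [lorentz_add_left, lorentz_smul_left, τ.A_p₀, τ.p₀_null, lorentz_w_p₀,
        lorentz_comm u τ'.p₀]
      ring
    obtain ⟨x, s, t, rfl⟩ := τ'.exists_decomp v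
    have hLv : L (τ'.A x + s • τ'.p₀ + t • τ'.w) = τ.A x + s • τ.p₀ + t • τ.w := by
      rw [hL]
      have h1 : coadj τ'.A (τ'.A x + s • τ'.p₀ + t • τ'.w) = x := by
        apply ext_inner_right ℝ
        intro z
        rw [inner_coadj]
        simp only [lorentz_add_left, lorentz_smul_left, τ'.A_isometry, lorentz_p₀_A, lorentz_w_A]
        ring
      rw [h1]
      simp only [lorentz_add_right, lorentz_smul_right, lorentz_w_A, lorentz_w_p₀, τ'.w_null,
        lorentz_p₀_A, τ'.p₀_null, τ'.p₀_w]
      congr 2 <;> ring_nf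
    rw [hLv]
    simp only [lorentz_add_right, lorentz_smul_right, hA, hp, hw]
  · apply proj_eq_of_forall
    intro z
    rw [hA, hw, inner_proj]

/-- Any pair of light-like vectors with product `1` belongs to a light cone model. -/
theorem exists_of_null {p₀ w : Mink (N + 1)} (hp : lorentz p₀ p₀ = 0) (hw : lorentz w w = 0)
    (hpw : lorentz p₀ w = 1) : ∃ τ : LightConeModel N, τ.p₀ = p₀ ∧ τ.w = w := by
  have hwp : lorentz w p₀ = 1 := by rw [lorentz_comm, hpw]
  -- p₀ - w/2 and p₀ + w/2 form an orthonormal pair, the first time-like. Completing it to a frame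
  -- provides `A` from the remaining N vectors.
  obtain ⟨C, hC, -, hC1, hC2⟩ := exists_frame (k := N) (m := 0) (d := N + 1) (D := 0)
    (X₀ := p₀ - (1 / 2 : ℝ) • w) (ν₀ := p₀ + (1 / 2 : ℝ) • w)
    (by
      intro y y'
      rw [Subsingleton.elim y 0]
      simp [lorentz_zero_left]) rfl
    (by
      simp only [lorentz_sub_left, lorentz_sub_right, lorentz_smul_left, lorentz_smul_right, hp, hw,
        hpw, hwp]; ring)
    (by
      simp only [lorentz_add_left, lorentz_add_right, lorentz_smul_left, lorentz_smul_right, hp, hw,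
        hpw, hwp]; ring)
    (by
      simp only [lorentz_add_left, lorentz_sub_right, lorentz_smul_left, lorentz_smul_right, hp, hw,
        hpw, hwp]; ring)
    (fun y => by simp [lorentz_zero_right]) (fun y => by simp [lorentz_zero_right])
  have hC2' : C (e₀ N, 0) = p₀ + (1 / 2 : ℝ) • w := hC2
  have hpC : p₀ = (1 / 2 : ℝ) • C (e₀ N, 1) := by
    have : ((e₀ N, 1) : Mink (N + 1)) = (e₀ N, 0) + (0, 1) := by simp
    rw [this, map_add, hC1, hC2']; module
  have hwC : w = C (e₀ N, -1) := by
    have : ((e₀ N, -1) : Mink (N + 1)) = (e₀ N, 0) - (0, 1) := by simp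
    rw [this, map_sub, hC1, hC2']; module
  refine ⟨⟨p₀, w, C ∘ₗ LinearMap.inl ℝ _ _ ∘ₗ embSucc N, hp, hw, hpw, fun x y => ?_, fun x => ?_,
    fun x => ?_⟩, rfl, rfl⟩
  · change lorentz (C (embSucc N x, 0)) (C (embSucc N y, 0)) = _
    rw [hC]; simp [lorentz, inner_embSucc]
  · change lorentz (C (embSucc N x, 0)) p₀ = _
    rw [hpC, lorentz_smul_right, hC]; simp [lorentz, inner_embSucc_e₀]
  · change lorentz (C (embSucc N x, 0)) w = _
    rw [hwC, hC]; simp [lorentz, inner_embSucc_e₀]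

end LightConeModel

end LightCone

/-! ### Cyclides of Dupin and pairs of curvature spheres -/

namespace LightConeModel

variable {N : ℕ} (τ : LightConeModel N)

/-- The differential of `Ψ` at `x`. -/
def tang (x v : Euc N) : Mink (N + 1) := τ.A v - inner ℝ x v • τ.w

theorem tang_add (x v v' : Euc N) : τ.tang x (v + v') = τ.tang x v + τ.tang x v' := by
  simp only [tang, map_add, inner_add_right]; module

theorem tang_smul (x : Euc N) (r : ℝ) (v : Euc N) : τ.tang x (r • v) = r • τ.tang x v := by
  simp only [tang, map_smul, inner_smul_right]; module

theorem lorentz_tang (x v v' : Euc N) : lorentz (τ.tang x v) (τ.tang x v') = inner ℝ v v' := by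
  simp only [tang, lorentz_sub_left, lorentz_sub_right, lorentz_smul_left, lorentz_smul_right,
    τ.A_isometry, τ.A_w, lorentz_w_A, τ.w_null]
  ring

theorem lorentz_tang_w (x v : Euc N) : lorentz (τ.tang x v) τ.w = 0 := by
  simp only [tang, lorentz_sub_left, lorentz_smul_left, τ.A_w, τ.w_null]; ring

theorem lorentz_tang_psi (x v : Euc N) : lorentz (τ.tang x v) (τ.psi x) = 0 := by
  rw [tang, lorentz_sub_left, lorentz_smul_left, lorentz_comm _ (τ.psi x), psi_A,
    lorentz_comm _ (τ.psi x), psi_w]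
  ring

theorem tang_eq_zero {x v : Euc N} (h : τ.tang x v = 0) : v = 0 := by
  rw [← inner_self_eq_zero (𝕜 := ℝ), ← τ.lorentz_tang x, h, lorentz_zero_left]

/-- The complement of Ψ(x) and `w` is exactly the image of the differential of Ψ at x; this recovers
a unit normal from a tangent sphere. -/
theorem eq_tang {x : Euc N} {v : Mink (N + 1)} (hw : lorentz v τ.w = 0)
    (hx : lorentz v (τ.psi x) = 0) : v = τ.tang x (coadj τ.A v) := by
  obtain ⟨y, s, t, h⟩ := τ.exists_decomp v
  have h3 : coadj τ.A v = y := by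
    apply ext_inner_right ℝ
    intro z
    rw [inner_coadj, h]
    simp only [lorentz_add_left, lorentz_smul_left, τ.A_isometry, lorentz_p₀_A, lorentz_w_A]
    ring
  have h1 := hw
  rw [h] at h1
  simp only [lorentz_add_left, lorentz_smul_left, τ.A_w, τ.p₀_w, τ.w_null] at h1
  have hs : s = 0 := by linarith
  have h2 := hx
  rw [h, hs, zero_smul, add_zero, lorentz_add_left, lorentz_smul_left, lorentz_comm _ (τ.psi x),
    psi_A, lorentz_comm _ (τ.psi x), psi_w] at h2
  have ht : t = -inner ℝ x y := by linarith
  rw [h3, tang, h, hs, ht]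
  module

theorem contDiff_psi : ContDiff ℝ ∞ τ.psi :=
  (contDiff_const.add (toCLM τ.A).contDiff).sub
    ((contDiff_const.mul (contDiff_norm_sq ℝ)).smul contDiff_const)

end LightConeModel

section Dupin

open Topology Filter

variable {M : Type u} [TopologicalSpace M] {n : ℕ} [ChartedSpace (Euc n) M] {N : ℕ}

theorem SmAt.psi {f : M → Euc N} {x : M} (hf : SmAt n f x) (τ : LightConeModel N) :
    SmAt n (fun y => τ.psi (f y)) x := hf.comp τ.contDiff_psi.contDiffAt

theorem dif_tang {f ν : M → Euc N} {x : M} (hf : SmAt n f x) (hν : SmAt n ν x)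
    (τ : LightConeModel N) (t : Euc n) (h : inner ℝ (ν x) (dif n f x t) = 0) :
    dif n (fun y => τ.tang (f y) (ν y)) x t = τ.tang (f x) (dif n ν x t) := by
  have h1 := (hν.hasD.linear τ.A).sub ((hf.hasD.inner hν.hasD).smul (hasD_const τ.w x))
  change HasD n (fun y => τ.tang (f y) (ν y)) x _ at h1
  rw [h1.dif_eq]
  simp [LightConeModel.tang, h]

theorem dif_psi {f : M → Euc N} {x : M} (hf : SmAt n f x) (τ : LightConeModel N) (t : Euc n) :
    dif n (fun y => τ.psi (f y)) x t = τ.tang (f x) (dif n f x t) := by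
  have h1 := ((hasD_const τ.p₀ x).add (hf.hasD.linear τ.A)).sub
    (((hf.hasD.inner hf.hasD).const_smul (1 / 2 : ℝ)).smul (hasD_const τ.w x))
  have h2 : HasD n (fun y => τ.psi (f y)) x _ := h1.congr (Eventually.of_forall fun y => by
    simp only [LightConeModel.psi, real_inner_self_eq_norm_sq, smul_eq_mul])
  rw [h2.dif_eq]
  simp [LightConeModel.tang, ← two_mul]

theorem isLift_psi {f : M → Euc (n + 1)} (hf : IsSmoothImmersion n f)
    (τ : LightConeModel (n + 1)) : IsLift (fun y => τ.psi (f y)) Set.univ where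
  smooth x _ := SmAt.psi (hf.1 x) τ
  null x _ := τ.psi_null _
  ne x _ := τ.psi_ne_zero _
  pos x _ t ht := by
    rw [dif_psi (hf.1 x), LightConeModel.lorentz_tang]
    refine real_inner_self_pos.2 fun h => ht (hf.2 x ?_)
    exact h.trans (map_zero (dif n f x)).symm

/-- The differential of a curvature sphere. -/
theorem dif_sphere {f ν : M → Euc N} {a : M → ℝ} {x : M} (hf : SmAt n f x) (hν : SmAt n ν x)
    (ha : SmAt n a x) (τ : LightConeModel N) (t : Euc n) (h : inner ℝ (ν x) (dif n f x t) = 0) :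
    dif n (fun y => τ.tang (f y) (ν y) + a y • τ.psi (f y)) x t =
      τ.tang (f x) (dif n ν x t + a x • dif n f x t) + dif n a x t • τ.psi (f x) := by
  have hs : SmAt n (fun y => τ.tang (f y) (ν y)) x :=
    (hν.linear τ.A).sub ((hf.inner hν).smul (smAt_const τ.w x))
  have h1 := hs.hasD.add (ha.hasD.smul (hf.psi τ).hasD)
  rw [h1.dif_eq]
  simp only [_root_.add_apply, _root_.smul_apply, ContinuousLinearMap.smulRight_apply,
    dif_tang hf hν τ t h, dif_psi hf τ, τ.tang_add, τ.tang_smul]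
  module

/-- Pairing with `w` separates the multiple of Ψ from the tangential part. So the kernel of the
differential of a curvature sphere is the part of the eigenspace on which the principal curvature is
stationary, and the condition of Dupin says that it is the whole eigenspace. -/
theorem dif_sphere_eq_zero {f ν : M → Euc N} {a : M → ℝ} {x : M} (hf : SmAt n f x)
    (hν : SmAt n ν x) (ha : SmAt n a x) (τ : LightConeModel N) (t : Euc n)
    (h : inner ℝ (ν x) (dif n f x t) = 0) :
    dif n (fun y => τ.tang (f y) (ν y) + a y • τ.psi (f y)) x t = 0 ↔
      dif n ν x t + a x • dif n f x t = 0 ∧ dif n a x t = 0 := by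
  rw [dif_sphere hf hν ha τ t h]
  constructor
  · intro h0
    have h1 : lorentz (τ.tang (f x) (dif n ν x t + a x • dif n f x t) +
      dif n a x t • τ.psi (f x)) τ.w = 0 := by rw [h0, lorentz_zero_left]
    rw [lorentz_add_left, lorentz_smul_left, τ.lorentz_tang_w, τ.psi_w, zero_add, mul_one] at h1
    rw [h1, zero_smul, add_zero] at h0
    exact ⟨τ.tang_eq_zero h0, h1⟩
  · rintro ⟨h1, h2⟩
    rw [h1, h2]
    simp [LightConeModel.tang]

/-- `principalSpace` as a subspace of `ℝ^n`. -/
def principalKer (n : ℕ) [ChartedSpace (Euc n) M] {d : ℕ} (f ν : M → Euc d) (a : ℝ) (x : M) :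
    Submodule ℝ (Euc n) := LinearMap.ker ((dif n ν x + a • dif n f x).toLinearMap)

theorem mem_principalKer {d : ℕ} {f ν : M → Euc d} {a : ℝ} {x : M} {t : Euc n} :
    t ∈ principalKer n f ν a x ↔ dif n ν x t + a • dif n f x t = 0 := Iff.rfl

/-- The two curvature spheres of a cyclide of Dupin. -/
theorem IsDupinCyclide.exists_curvPair {m k : ℕ} {f : M → Euc (n + 1)}
    (h : IsDupinCyclide n m k f) (τ : LightConeModel (n + 1)) (p : M) :
    ∃ (Ka Kb : M → Mink (n + 1 + 1)) (δ : M → ℝ) (U : Set M), p ∈ U ∧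
      CurvPair (fun y => τ.psi (f y)) m k Ka Kb δ U ∧ ∀ x ∈ U, 0 < δ x := by
  obtain ⟨hm, hk, hmk, hf, h⟩ := h
  obtain ⟨U, hU, hp, ν, hν, a, b, ha, hb, h⟩ := h p
  have hν' : ∀ x ∈ U, SmAt n ν x := fun x hx => hν.1.contMDiffAt (hU.mem_nhds hx)
  have ha' : ∀ x ∈ U, SmAt n a x := fun x hx => ha.contMDiffAt (hU.mem_nhds hx)
  have hb' : ∀ x ∈ U, SmAt n b x := fun x hx => hb.contMDiffAt (hU.mem_nhds hx)
  have hf' : ∀ x, SmAt n f x := hf.1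
  have hperp : ∀ x ∈ U, ∀ t, inner ℝ (ν x) (dif n f x t) = 0 := fun x hx t => (hν.2 x hx).2 t
  have hs : ∀ x ∈ U, SmAt n (fun y => τ.tang (f y) (ν y)) x := fun x hx =>
    ((hν' x hx).linear τ.A).sub (((hf' x).inner (hν' x hx)).smul (smAt_const τ.w x))
  -- Constancy along the eigenbundle makes the second condition of `dif_sphere_eq_zero` automatic.
  have hker : ∀ (c : M → ℝ), ∀ x ∈ U, SmAt n c x →
      (∀ t ∈ principalSpace n f ν (c x) x, differential n c x t = 0) →
      LinearMap.ker (dif n (fun y => τ.tang (f y) (ν y) + c y • τ.psi (f y)) x).toLinearMap =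
        principalKer n f ν (c x) x := by
    intro c x hx hc h0
    ext t
    refine (dif_sphere_eq_zero (hf' x) (hν' x hx) hc τ t (hperp x hx t)).trans ?_
    exact ⟨fun h1 => h1.1, fun h1 => ⟨h1, h0 t h1⟩⟩
  have hc : CurvPair (fun y => τ.psi (f y)) m k
      (fun y => τ.tang (f y) (ν y) + a y • τ.psi (f y))
      (fun y => τ.tang (f y) (ν y) + b y • τ.psi (f y)) (fun y => b y - a y) U := {
    isOpen := hU
    lift := (isLift_psi hf τ).mono (Set.subset_univ _)
    dim := hmk
    m_pos := hm
    k_pos := hk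
    smooth_a := fun x hx => (hs x hx).add ((ha' x hx).smul ((hf' x).psi τ))
    smooth_b := fun x hx => (hs x hx).add ((hb' x hx).smul ((hf' x).psi τ))
    smooth_δ := fun x hx => (hb' x hx).sub (ha' x hx)
    unit := fun x hx => by
      simp only [lorentz_add_left, lorentz_add_right, lorentz_smul_left, lorentz_smul_right,
        τ.lorentz_tang, τ.lorentz_tang_psi, lorentz_comm (τ.psi _) (τ.tang _ _), τ.psi_null,
        real_inner_self_eq_norm_sq, (hν.2 x hx).1]
      ring
    perp := fun x hx => by
      simp only [lorentz_add_left, lorentz_smul_left, τ.lorentz_tang_psi, τ.psi_null]; ring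
    perp_d := fun x hx t => by
      rw [dif_psi (hf' x)]
      simp only [lorentz_add_left, lorentz_smul_left, τ.lorentz_tang_psi,
        lorentz_comm (τ.psi _) (τ.tang _ _), τ.lorentz_tang, hperp x hx t]
      ring
    ne := fun x hx => sub_ne_zero.2 (h x hx).1.symm
    eq := fun x hx => by module
    rank_a := fun x hx => by
      rw [hker a x hx (ha' x hx) (h x hx).2.2.2.1]
      exact (h x hx).2.1
    rank_b := fun x hx => by
      rw [hker b x hx (hb' x hx) (h x hx).2.2.2.2]
      exact (h x hx).2.2.1 }
  have hδc : ContinuousOn (fun y => b y - a y) U := fun x hx =>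
    (hc.smooth_δ x hx).continuousAt.continuousWithinAt
  -- δ = b - a is made positive near `p` by reversing the normal if needed. This normalization later
  -- fixes all signs.
  rcases lt_or_gt_of_ne (hc.ne p hp) with h0 | h0
  · refine ⟨_, _, _, U ∩ (fun y => b y - a y) ⁻¹' Set.Iio 0, ⟨hp, h0⟩,
      hc.neg.mono Set.inter_subset_left (hδc.isOpen_inter_preimage hU isOpen_Iio), ?_⟩
    intro x hx
    exact neg_pos.2 hx.2
  · exact ⟨_, _, _, U ∩ (fun y => b y - a y) ⁻¹' Set.Ioi 0, ⟨hp, h0⟩,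
      hc.mono Set.inter_subset_left (hδc.isOpen_inter_preimage hU isOpen_Ioi), fun x hx => hx.2⟩

/-- Used with kernels inside eigenspaces: two independent eigenspaces cannot be larger than kernels
whose dimensions already add up to n. -/
theorem finrank_eq_of_le {V : Type*} [AddCommGroup V] [Module ℝ V] [FiniteDimensional ℝ V]
    {A B A' B' : Submodule ℝ V} (hA : A ≤ A') (hB : B ≤ B') (hd : A' ⊓ B' = ⊥)
    (h : Module.finrank ℝ A + Module.finrank ℝ B = Module.finrank ℝ V) : A = A' ∧ B = B' := by
  have h1 := Submodule.finrank_sup_add_finrank_inf_eq A' B'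
  have h2 := Submodule.finrank_le (A' ⊔ B')
  have h3 := Submodule.finrank_mono hA
  have h4 := Submodule.finrank_mono hB
  rw [hd, finrank_bot] at h1
  exact ⟨Submodule.eq_of_le_of_finrank_le hA (by omega),
    Submodule.eq_of_le_of_finrank_le hB (by omega)⟩

/-- A hypersurface with a pair of curvature spheres is a cyclide of Dupin. -/
theorem isDupinCyclide_of_curvPair {m k : ℕ} {f : M → Euc (n + 1)} (hf : IsSmoothImmersion n f)
    (τ : LightConeModel (n + 1)) (hm : 0 < m) (hk : 0 < k) (hmk : m + k = n)
    (h : ∀ p, ∃ (Ka Kb : M → Mink (n + 1 + 1)) (δ : M → ℝ) (U : Set M), p ∈ U ∧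
      CurvPair (fun y => τ.psi (f y)) m k Ka Kb δ U) : IsDupinCyclide n m k f := by
  refine ⟨hm, hk, hmk, hf, fun p => ?_⟩
  obtain ⟨Ka, Kb, δ, U, hp, hc⟩ := h p
  have hf' : ∀ x, SmAt n f x := hf.1
  -- The principal curvature is the product with `w`, because Ψ has product 1 with `w` and the
  -- tangential part has product 0. What is left of K_a is the differential of Ψ applied to the unit
  -- normal.
  set a : M → ℝ := fun y => lorentz (Ka y) τ.w with ha
  set b : M → ℝ := fun y => lorentz (Kb y) τ.w with hb
  set ν : M → Euc (n + 1) := fun y => coadj τ.A (Ka y - a y • τ.psi (f y)) with hν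
  have sa : ∀ x ∈ U, SmAt n a x := fun x hx => (hc.smooth_a x hx).lorentz (smAt_const _ x)
  have sb : ∀ x ∈ U, SmAt n b x := fun x hx => (hc.smooth_b x hx).lorentz (smAt_const _ x)
  have sν : ∀ x ∈ U, SmAt n ν x := fun x hx =>
    ((hc.smooth_a x hx).sub ((sa x hx).smul ((hf' x).psi τ))).linear (coadj τ.A)
  have hab : ∀ x ∈ U, b x = a x + δ x := fun x hx => by
    simp only [hb, ha, hc.eq x hx, lorentz_add_left, lorentz_smul_left, τ.psi_w]; ring
  have ea : ∀ x ∈ U, Ka x = τ.tang (f x) (ν x) + a x • τ.psi (f x) := by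
    intro x hx
    rw [← τ.eq_tang (v := Ka x - a x • τ.psi (f x)) (x := f x)]
    · module
    · rw [lorentz_sub_left, lorentz_smul_left, τ.psi_w, mul_one, sub_self]
    · rw [lorentz_sub_left, lorentz_smul_left, τ.psi_null, hc.perp x hx]; ring
  have eb : ∀ x ∈ U, Kb x = τ.tang (f x) (ν x) + b x • τ.psi (f x) := by
    intro x hx
    rw [hc.eq x hx, ea x hx, hab x hx]; module
  have hperp : ∀ x ∈ U, ∀ t, inner ℝ (ν x) (dif n f x t) = 0 := by
    intro x hx t
    have h1 := hc.perp_d x hx t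
    rw [dif_psi (hf' x), ea x hx, lorentz_add_left, lorentz_smul_left, τ.lorentz_tang,
      lorentz_comm (τ.psi _), τ.lorentz_tang_psi] at h1
    linarith
  have hunit : ∀ x ∈ U, ‖ν x‖ = 1 := by
    intro x hx
    have h1 := hc.unit x hx
    rw [ea x hx] at h1
    simp only [lorentz_add_left, lorentz_add_right, lorentz_smul_left, lorentz_smul_right,
        τ.lorentz_tang, τ.lorentz_tang_psi, lorentz_comm (τ.psi _) (τ.tang _ _), τ.psi_null,
        real_inner_self_eq_norm_sq] at h1
    have h2 : ‖ν x‖ ^ 2 = 1 := by linarith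
    exact (pow_eq_one_iff_of_nonneg (norm_nonneg _) two_ne_zero).1 h2
  refine ⟨U, hc.isOpen, hp, ν, ⟨fun x hx => (sν x hx).contMDiffWithinAt, fun x hx =>
    ⟨hunit x hx, hperp x hx⟩⟩, a, b, fun x hx => (sa x hx).contMDiffWithinAt,
    fun x hx => (sb x hx).contMDiffWithinAt, fun x hx => ?_⟩
  have hne : a x ≠ b x := by
    rw [hab x hx]
    have := hc.ne x hx
    intro h0
    exact this (by linarith)
  have hU := hc.isOpen.mem_nhds hx
  have ka : ∀ t, dif n Ka x t = 0 ↔ dif n ν x t + a x • dif n f x t = 0 ∧ dif n a x t = 0 := by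
    intro t
    rw [dif_congr (eventually_of_mem hU ea)]
    exact dif_sphere_eq_zero (hf' x) (sν x hx) (sa x hx) τ t (hperp x hx t)
  have kb : ∀ t, dif n Kb x t = 0 ↔ dif n ν x t + b x • dif n f x t = 0 ∧ dif n b x t = 0 := by
    intro t
    rw [dif_congr (eventually_of_mem hU eb)]
    exact dif_sphere_eq_zero (hf' x) (sν x hx) (sb x hx) τ t (hperp x hx t)
  have hd : principalKer n f ν (a x) x ⊓ principalKer n f ν (b x) x = ⊥ := by
    rw [eq_bot_iff]
    rintro t ⟨h1, h2⟩
    have h1' := mem_principalKer.1 h1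
    have h2' := mem_principalKer.1 h2
    have h3 : (a x - b x) • dif n f x t = 0 := by
      rw [sub_smul, ← sub_eq_zero.2 (h1'.trans h2'.symm)]; module
    have h4 := (smul_eq_zero.1 h3).resolve_left (sub_ne_zero.2 hne)
    exact hf.2 x (h4.trans (map_zero (dif n f x)).symm)
  -- The kernels fill the eigenspaces, which gives the multiplicities and the constancy of each
  -- principal curvature along its eigenspace.
  obtain ⟨e1, e2⟩ := finrank_eq_of_le
    (A := LinearMap.ker (dif n Ka x).toLinearMap) (B := LinearMap.ker (dif n Kb x).toLinearMap)
    (fun t ht => ((ka t).1 ht).1) (fun t ht => ((kb t).1 ht).1) hd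
    (by rw [hc.rank_a x hx, hc.rank_b x hx, hmk]; simp)
  refine ⟨hne, ?_, ?_, fun t ht => ?_, fun t ht => ?_⟩
  · exact (congrArg (fun S : Submodule ℝ (Euc n) => Module.finrank ℝ S) e1).symm.trans
      (hc.rank_a x hx)
  · exact (congrArg (fun S : Submodule ℝ (Euc n) => Module.finrank ℝ S) e2).symm.trans
      (hc.rank_b x hx)
  · have : t ∈ LinearMap.ker (dif n Ka x).toLinearMap := by rw [e1]; exact ht
    exact ((ka t).1 this).2
  · have : t ∈ LinearMap.ker (dif n Kb x).toLinearMap := by rw [e2]; exact ht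
    exact ((kb t).1 this).2

end Dupin

/-! ### Products of hyperbolic and spherical immersions -/

section Product

open Topology Filter

variable {M : Type u} [TopologicalSpace M] {n : ℕ} [ChartedSpace (Euc n) M]

/-- A map with vanishing differential is locally constant. -/
theorem eventually_eq_of_dif_eq_zero [IsManifold (𝓡 n) ∞ M] {F : Type} [NormedAddCommGroup F]
    [NormedSpace ℝ F] {g : M → F} {p : M}
    (h : ∀ᶠ x in 𝓝 p, SmAt n g x ∧ dif n g x = 0) : ∀ᶠ x in 𝓝 p, g x = g p := by
  set χ := extChartAt (𝓡 n) p with hχ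
  have hχp : χ.symm (χ p) = p := extChartAt_to_inv p
  have hcχ : ContinuousAt χ.symm (χ p) := continuousAt_extChartAt_symm p
  have h1 : ∀ᶠ q in 𝓝 (χ p), q ∈ χ.target ∧ (SmAt n g (χ.symm q) ∧ dif n g (χ.symm q) = 0) :=
    Filter.Eventually.and (extChartAt_target_mem_nhds p)
      (hcχ.eventually (by rw [hχp]; exact h))
  obtain ⟨ε, hε, hB⟩ := Metric.eventually_nhds_iff_ball.1 h1
  have hd : ∀ q ∈ Metric.ball (χ p) ε, HasFDerivAt (fun q => g (χ.symm q)) (0 : Euc n →L[ℝ] F) q := by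
    intro q hq
    obtain ⟨hq1, hq2, hq3⟩ := hB q hq
    have h6 : ContMDiffAt 𝓘(ℝ, Euc n) (𝓡 n) 1 χ.symm q := by
      have h7 := contMDiffOn_extChartAt_symm (I := 𝓡 n) (n := ∞) p
      exact (h7.contMDiffAt ((isOpen_extChartAt_target p).mem_nhds hq1)).of_le
        (by exact_mod_cast le_top)
    obtain ⟨T, hT⟩ := hasFDerivAt_comp_inverse h6
    have := hT F g hq2
    rw [hq3] at this
    simpa using this
  have hconst : ∀ q ∈ Metric.ball (χ p) ε, g (χ.symm q) = g p := by
    intro q hq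
    have := Convex.is_const_of_fderivWithin_eq_zero (𝕜 := ℝ) (G := F) (convex_ball (χ p) ε)
      (f := fun q => g (χ.symm q)) (fun q hq => (hd q hq).differentiableAt.differentiableWithinAt)
      (fun q hq => by
        rw [fderivWithin_of_isOpen Metric.isOpen_ball hq]; exact (hd q hq).fderiv)
      hq (Metric.mem_ball_self hε)
    simpa [hχp] using this
  have h2 : ∀ᶠ x in 𝓝 p, χ x ∈ Metric.ball (χ p) ε :=
    (continuousAt_extChartAt p).preimage_mem_nhds (Metric.ball_mem_nhds _ hε)
  filter_upwards [h2, extChartAt_source_mem_nhds (I := 𝓡 n) p] with x hx1 hx2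
  rw [← hconst _ hx1, χ.left_inv hx2]

theorem finrank_ker_add_of_surjective {V W : Type*} [AddCommGroup V] [Module ℝ V]
    [FiniteDimensional ℝ V] [AddCommGroup W] [Module ℝ W] {L : V →ₗ[ℝ] W}
    (h : Function.Surjective L) :
    Module.finrank ℝ (LinearMap.ker L) + Module.finrank ℝ W = Module.finrank ℝ V := by
  have := LinearMap.finrank_range_add_finrank_ker L
  rw [LinearMap.range_eq_top.2 h, finrank_top] at this
  omega

/-- The image of `X` lies in an umbilical hypersurface of hyperbolic space, and that of `Y` in the
unit sphere; the pair is an immersion. -/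
structure ProductImm (n : ℕ) [ChartedSpace (Euc n) M] {k m : ℕ} (c : ℝ) (ξ : Mink (k + 1)) (X : M → Mink (k + 1))
    (Y : M → Euc (m + 1)) (U : Set M) : Prop where
  isOpen : IsOpen U
  lt : -1 < c
  dim : m + k = n
  m_pos : 0 < m
  k_pos : 0 < k
  norm_ξ : lorentz ξ ξ = -c
  smooth_X : ∀ x ∈ U, SmAt n X x
  smooth_Y : ∀ x ∈ U, SmAt n Y x
  XX : ∀ x ∈ U, lorentz (X x) (X x) = -1
  Xξ : ∀ x ∈ U, lorentz (X x) ξ = -√(1 + c)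
  YY : ∀ x ∈ U, ‖Y x‖ = 1
  inj : ∀ x ∈ U, ∀ t, dif n X x t = 0 → dif n Y x t = 0 → t = 0

/-- The pairs `(X, Y)` that satisfy the equations of `ProductImm`. -/
def productSet {k : ℕ} (m : ℕ) (c : ℝ) (ξ : Mink (k + 1)) : Set (Mink (k + 1) × Euc (m + 1)) :=
  {s | lorentz s.1 s.1 = -1 ∧ lorentz s.1 ξ = -√(1 + c) ∧ ‖s.2‖ = 1}

/-- The Gram determinant of X, ξ is c - (1 + c) = -1, so both products can be prescribed by a vector
in their span. -/
theorem exists_lorentz_eq {k : ℕ} {c : ℝ} (hc : -1 < c) {ξ X : Mink (k + 1)}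
    (h1 : lorentz ξ ξ = -c) (h2 : lorentz X X = -1) (h3 : lorentz X ξ = -√(1 + c)) (a b : ℝ) :
    ∃ v, lorentz X v = a ∧ lorentz ξ v = b := by
  have hr : √(1 + c) ^ 2 = 1 + c := Real.sq_sqrt (by linarith)
  refine ⟨(c * a - √(1 + c) * b) • X + (b - √(1 + c) * a) • ξ, ?_, ?_⟩
  · rw [lorentz_add_right, lorentz_smul_right, lorentz_smul_right, h2, h3]
    linear_combination a * hr
  · rw [lorentz_add_right, lorentz_smul_right, lorentz_smul_right, h1, lorentz_comm ξ, h3]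
    linear_combination b * hr

namespace ProductImm

variable {k m : ℕ} {c : ℝ} {ξ : Mink (k + 1)} {X : M → Mink (k + 1)} {Y : M → Euc (m + 1)}
  {U : Set M}

theorem mono (h : ProductImm n c ξ X Y U) {V : Set M} (hV : V ⊆ U) (hVo : IsOpen V) :
    ProductImm n c ξ X Y V where
  isOpen := hVo
  lt := h.lt
  dim := h.dim
  m_pos := h.m_pos
  k_pos := h.k_pos
  norm_ξ := h.norm_ξ
  smooth_X x hx := h.smooth_X x (hV hx)
  smooth_Y x hx := h.smooth_Y x (hV hx)
  XX x hx := h.XX x (hV hx)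
  Xξ x hx := h.Xξ x (hV hx)
  YY x hx := h.YY x (hV hx)
  inj x hx := h.inj x (hV hx)

theorem r_pos (h : ProductImm n c ξ X Y U) : 0 < √(1 + c) := Real.sqrt_pos.2 (by linarith [h.lt])

theorem r_sq (h : ProductImm n c ξ X Y U) : √(1 + c) ^ 2 = 1 + c :=
  Real.sq_sqrt (by linarith [h.lt])

theorem X_dif (h : ProductImm n c ξ X Y U) {x : M} (hx : x ∈ U) (t : Euc n) :
    lorentz (X x) (dif n X x t) = 0 := by
  have h1 := lorentz_dif_of_const (h.smooth_X x hx).hasD (h.smooth_X x hx).hasD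
    (eventually_of_mem (h.isOpen.mem_nhds hx) h.XX) t
  rw [lorentz_comm (dif n X x t)] at h1
  linarith

theorem ξ_dif (h : ProductImm n c ξ X Y U) {x : M} (hx : x ∈ U) (t : Euc n) :
    lorentz ξ (dif n X x t) = 0 := by
  have h1 := lorentz_dif_of_const (h.smooth_X x hx).hasD (hasD_const ξ x)
    (eventually_of_mem (h.isOpen.mem_nhds hx) h.Xξ) t
  simp only [_root_.zero_apply, lorentz_zero_right, zero_add] at h1
  rw [lorentz_comm, h1]

theorem Y_dif (h : ProductImm n c ξ X Y U) {x : M} (hx : x ∈ U) (t : Euc n) :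
    inner ℝ (Y x) (dif n Y x t) = 0 := by
  have h1 := inner_dif_of_const (h.smooth_Y x hx).hasD (h.smooth_Y x hx).hasD
    (c := 1) (eventually_of_mem (h.isOpen.mem_nhds hx) fun y hy => by
      rw [real_inner_self_eq_norm_sq, h.YY y hy]; norm_num) t
  linarith

/-- dX is orthogonal to X and ξ, and dY to Y, so the ranks are at most k and m. The kernels meet in
zero and m + k = n, so both bounds are attained. -/
theorem ranks (h : ProductImm n c ξ X Y U) {x : M} (hx : x ∈ U) :
    Module.finrank ℝ (LinearMap.ker (dif n X x).toLinearMap) = m ∧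
      Module.finrank ℝ (LinearMap.ker (dif n Y x).toLinearMap) = k := by
  set A := (dif n X x).toLinearMap with hA
  set B := (dif n Y x).toLinearMap with hB
  have hd : LinearMap.ker A ⊓ LinearMap.ker B = ⊥ := by
    rw [eq_bot_iff]
    rintro t ⟨h1, h2⟩
    exact h.inj x hx t h1 h2
  have h1 := Submodule.finrank_sup_add_finrank_inf_eq (LinearMap.ker A) (LinearMap.ker B)
  have h2 := Submodule.finrank_le (LinearMap.ker A ⊔ LinearMap.ker B)
  rw [hd, finrank_bot] at h1
  have h3 : Module.finrank ℝ (LinearMap.range A) ≤ k := by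
    let L : Mink (k + 1) →ₗ[ℝ] ℝ × ℝ := (lorentzForm _ (X x)).prod (lorentzForm _ ξ)
    have hL : Function.Surjective L := by
      rintro ⟨a, b⟩
      obtain ⟨v, h1, h2⟩ := exists_lorentz_eq h.lt h.norm_ξ (h.XX x hx) (h.Xξ x hx) a b
      exact ⟨v, Prod.ext h1 h2⟩
    have h4 := finrank_ker_add_of_surjective hL
    have h5 : LinearMap.range A ≤ LinearMap.ker L := by
      rintro _ ⟨t, rfl⟩
      exact Prod.ext (h.X_dif hx t) (h.ξ_dif hx t)
    have h6 := Submodule.finrank_mono h5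
    simp only [Module.finrank_prod, finrank_euclideanSpace, Fintype.card_fin,
      Module.finrank_self] at h4
    omega
  have h4 : Module.finrank ℝ (LinearMap.range B) ≤ m := by
    let L : Euc (m + 1) →ₗ[ℝ] ℝ := (innerSL ℝ (Y x)).toLinearMap
    have hL : Function.Surjective L := by
      intro a
      refine ⟨a • Y x, ?_⟩
      change inner ℝ (Y x) (a • Y x) = a
      rw [inner_smul_right, real_inner_self_eq_norm_sq, h.YY x hx]; ring
    have h4 := finrank_ker_add_of_surjective hL
    have h5 : LinearMap.range B ≤ LinearMap.ker L := by
      rintro _ ⟨t, rfl⟩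
      exact h.Y_dif hx t
    have h6 := Submodule.finrank_mono h5
    simp only [finrank_euclideanSpace, Fintype.card_fin, Module.finrank_self] at h4
    omega
  have h5 := LinearMap.finrank_range_add_finrank_ker A
  have h6 := LinearMap.finrank_range_add_finrank_ker B
  have h7 := h.dim
  simp only [finrank_euclideanSpace, Fintype.card_fin] at h2 h5 h6
  omega

/-- The image of a small neighbourhood is a neighbourhood in `productSet`. -/
theorem map_nhds [IsManifold (𝓡 n) ∞ M] (h : ProductImm n c ξ X Y U) {p : M} (hp : p ∈ U) :
    map (fun x => (X x, Y x)) (𝓝 p) = 𝓝[productSet m c ξ] (X p, Y p) ∧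
      ∃ V ∈ 𝓝 p, Set.InjOn (fun x => (X x, Y x)) V := by
  have hD : HasD n (fun x => (X x, Y x)) p ((dif n X p).prod (dif n Y p)) :=
    (h.smooth_X p hp).hasD.prodMk (h.smooth_Y p hp).hasD
  -- Three independent equations in dimension (k + 2) + (m + 1) cut out the dimension n;
  -- independence of the first two is `exists_lorentz_eq`.
  let Q : Mink (k + 1) × Euc (m + 1) → ℝ × ℝ × ℝ :=
    fun s => (lorentz s.1 s.1, lorentz s.1 ξ, inner ℝ s.2 s.2)
  let E := Mink (k + 1) × Euc (m + 1)
  let pX : E →L[ℝ] Mink (k + 1) := ContinuousLinearMap.fst ℝ _ _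
  let pY : E →L[ℝ] Euc (m + 1) := ContinuousLinearMap.snd ℝ _ _
  have hQ1 : HasStrictFDerivAt (fun s : E => lorentz s.1 s.1)
      (((lorentzCLM (k + 1)).deriv₂ (X p, X p)).comp (pX.prod pX)) (X p, Y p) :=
    ((lorentzCLM (k + 1)).isBoundedBilinearMap.hasStrictFDerivAt (X p, X p)).comp
      (X p, Y p) (f := fun s : E => (s.1, s.1)) (pX.prod pX).hasStrictFDerivAt
  have hQ2 : HasStrictFDerivAt (fun s : E => lorentz s.1 ξ)
      (((lorentzCLM (k + 1)).flip ξ).comp pX) (X p, Y p) :=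
    (((lorentzCLM (k + 1)).flip ξ).comp pX).hasStrictFDerivAt
  have hQ3 : HasStrictFDerivAt (fun s : E => inner ℝ s.2 s.2)
      (((innerSL ℝ (E := Euc (m + 1))).deriv₂ (Y p, Y p)).comp (pY.prod pY)) (X p, Y p) :=
    ((innerSL ℝ (E := Euc (m + 1))).isBoundedBilinearMap.hasStrictFDerivAt (Y p, Y p)).comp
      (X p, Y p) (f := fun s : E => (s.2, s.2)) (pY.prod pY).hasStrictFDerivAt
  have hQ := hQ1.prodMk (hQ2.prodMk hQ3)
  refine map_nhds_eq_nhdsWithin ((h.smooth_X p hp).prodMk (h.smooth_Y p hp)) ?_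
    (eventually_of_mem (h.isOpen.mem_nhds hp) fun x hx => ⟨h.XX x hx, h.Xξ x hx, h.YY x hx⟩)
    hQ (c := (-1, -√(1 + c), 1)) ?_ ?_
  · rw [hD.dif_eq, injective_iff_map_eq_zero]
    intro t ht
    exact h.inj p hp t (congrArg Prod.fst ht) (congrArg Prod.snd ht)
  · rintro s ⟨h1, h2, h3⟩
    refine Prod.ext h1 (Prod.ext h2 ?_)
    change inner ℝ s.2 s.2 = 1
    rw [real_inner_self_eq_norm_sq, h3]; norm_num
  · refine le_of_add_le_add_right (a := Module.finrank ℝ (ℝ × ℝ × ℝ))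
      ((finrank_ker_add_of_surjective ?_).trans_le ?_)
    · rintro ⟨a, b, d⟩
      obtain ⟨v, h1, h2⟩ := exists_lorentz_eq h.lt h.norm_ξ (h.XX p hp) (h.Xξ p hp) (a / 2) b
      refine ⟨(v, (d / 2) • Y p), Prod.ext ?_ (Prod.ext ?_ ?_)⟩
      · change lorentz (X p) v + lorentz v (X p) = a
        rw [lorentz_comm v, h1]; ring
      · change lorentz v ξ = b
        rw [lorentz_comm v, h2]
      · change inner ℝ (Y p) ((d / 2) • Y p) + inner ℝ ((d / 2) • Y p) (Y p) = d
        rw [real_inner_smul_left, real_inner_smul_right, real_inner_self_eq_norm_sq, h.YY p hp]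
        ring
    · have := h.dim
      simp only [Module.finrank_prod, finrank_euclideanSpace, Fintype.card_fin,
        Module.finrank_self]
      omega

variable {C : Mink (k + 1) →ₗ[ℝ] Mink (n + 1 + 1)} {D : Euc (m + 1) →ₗ[ℝ] Mink (n + 1 + 1)}

theorem hasD_lift (h : ProductImm n c ξ X Y U) {x : M} (hx : x ∈ U) :
    HasD n (fun y => C (X y) + D (Y y)) x
      ((toCLM C).comp (dif n X x) + (toCLM D).comp (dif n Y x)) :=
  ((h.smooth_X x hx).hasD.linear C).add ((h.smooth_Y x hx).hasD.linear D)

theorem smAt_lift (h : ProductImm n c ξ X Y U) {x : M} (hx : x ∈ U) :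
    SmAt n (fun y => C (X y) + D (Y y)) x :=
  ((h.smooth_X x hx).linear C).add ((h.smooth_Y x hx).linear D)

theorem dif_lift (h : ProductImm n c ξ X Y U) {x : M} (hx : x ∈ U) (t : Euc n) :
    dif n (fun y => C (X y) + D (Y y)) x t = C (dif n X x t) + D (dif n Y x t) := by
  rw [h.hasD_lift hx |>.dif_eq]; rfl

theorem lorentz_dif_X_nonneg (h : ProductImm n c ξ X Y U) {x : M} (hx : x ∈ U) {t : Euc n}
    (ht : dif n X x t ≠ 0) : 0 < lorentz (dif n X x t) (dif n X x t) :=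
  lorentz_pos_of_orthogonal (T := X x) (by rw [h.XX x hx]; norm_num)
    (by rw [lorentz_comm]; exact h.X_dif hx t) ht

variable (hC : ∀ v v', lorentz (C v) (C v') = lorentz v v')
  (hD : ∀ v v', lorentz (D v) (D v') = inner ℝ v v') (hCD : ∀ v v', lorentz (C v) (D v') = 0)

include hC hD hCD

/-- The induced metric is the sum of those of X and Y. The first is positive on nonzero values of dX
because dX is orthogonal to the time-like X. -/
theorem isLift (h : ProductImm n c ξ X Y U) : IsLift (fun y => C (X y) + D (Y y)) U where
  smooth x hx := h.smAt_lift hx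
  null x hx := by
    simp only [lorentz_add_left, lorentz_add_right, hC, hD, hCD, lorentz_comm (D _) (C _),
      h.XX x hx, real_inner_self_eq_norm_sq, h.YY x hx]
    norm_num
  ne x hx h0 := by
    have h1 : lorentz (C (X x) + D (Y x)) (D (Y x)) = 0 := by rw [h0, lorentz_zero_left]
    rw [lorentz_add_left, hCD, hD, real_inner_self_eq_norm_sq, h.YY x hx] at h1
    norm_num at h1
  pos x hx t ht := by
    rw [h.dif_lift hx]
    simp only [lorentz_add_left, lorentz_add_right, hC, hD, hCD, lorentz_comm (D _) (C _)]
    by_cases h1 : dif n X x t = 0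
    · have h2 : dif n Y x t ≠ 0 := fun h2 => ht (h.inj x hx t h1 h2)
      have h3 := real_inner_self_pos.2 h2
      rw [h1, lorentz_zero_left]
      linarith
    · have h3 := h.lorentz_dif_X_nonneg hx h1
      have h4 := real_inner_self_nonneg (x := dif n Y x t)
      linarith

/-- The curvature spheres of a product immersion. -/
theorem curvPair (h : ProductImm n c ξ X Y U) :
    CurvPair (fun y => C (X y) + D (Y y)) m k (fun y => C (ξ - √(1 + c) • X y))
      (fun y => C ξ + D (√(1 + c) • Y y)) (fun _ => √(1 + c)) U where
  isOpen := h.isOpen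
  lift := h.isLift hC hD hCD
  dim := h.dim
  m_pos := h.m_pos
  k_pos := h.k_pos
  smooth_a x hx := ((smAt_const ξ x).sub ((h.smooth_X x hx).const_smul _)).linear C
  smooth_b x hx := (smAt_const (C ξ) x).add (((h.smooth_Y x hx).const_smul _).linear D)
  smooth_δ x _ := smAt_const _ x
  -- ξ - √(1 + c) X is a unit normal of the umbilical hypersurface along X; it is orthogonal to X
  -- and to dX.
  unit x hx := by
    rw [hC]
    simp only [lorentz_sub_left, lorentz_sub_right, lorentz_smul_left, lorentz_smul_right,
      h.norm_ξ, h.XX x hx, lorentz_comm ξ, h.Xξ x hx]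
    linear_combination h.r_sq
  perp x hx := by
    simp only [lorentz_add_right, hC, hCD, lorentz_sub_left, lorentz_smul_left, lorentz_comm ξ,
      h.Xξ x hx, h.XX x hx]
    ring
  perp_d x hx t := by
    rw [h.dif_lift hx]
    simp only [lorentz_add_right, hC, hCD, lorentz_sub_left, lorentz_smul_left, h.ξ_dif hx,
      h.X_dif hx]
    ring
  ne x hx := h.r_pos.ne'
  eq x hx := by
    simp only [map_sub, map_smul]; module
  rank_a x hx := by
    refine Eq.trans (congrArg (fun S : Submodule ℝ (Euc n) => Module.finrank ℝ S) ?_)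
      (h.ranks hx).1
    ext t
    have h1 := ((hasD_const ξ x).sub ((h.smooth_X x hx).hasD.const_smul (√(1 + c)))).linear C
    rw [LinearMap.mem_ker, LinearMap.mem_ker, h1.dif_eq]
    change C (0 - √(1 + c) • dif n X x t) = 0 ↔ dif n X x t = 0
    rw [zero_sub, map_neg, map_smul, neg_eq_zero, smul_eq_zero_iff_right h.r_pos.ne',
      (injective_iff_map_eq_zero' C).1 (isometryM_injective hC)]
  rank_b x hx := by
    refine Eq.trans (congrArg (fun S : Submodule ℝ (Euc n) => Module.finrank ℝ S) ?_)
      (h.ranks hx).2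
    ext t
    have h1 := (hasD_const (C ξ) x).add (((h.smooth_Y x hx).hasD.const_smul (√(1 + c))).linear D)
    rw [LinearMap.mem_ker, LinearMap.mem_ker, h1.dif_eq]
    change 0 + D (√(1 + c) • dif n Y x t) = 0 ↔ dif n Y x t = 0
    rw [zero_add, map_smul, smul_eq_zero_iff_right h.r_pos.ne',
      (injective_iff_map_eq_zero' D).1 (isometry_injective hD)]

theorem adapted (h : ProductImm n c ξ X Y U) :
    Adapted (fun y => C (ξ - √(1 + c) • X y)) (fun y => C ξ + D (√(1 + c) • Y y)) D (C ξ) U where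
  iso := hD
  perp := hCD ξ
  a_D x _ y := hCD _ y
  a_κ x hx := by
    rw [hC, lorentz_sub_left, lorentz_smul_left, h.norm_ξ, h.Xξ x hx]
    linear_combination h.r_sq
  b_mem x _ := ⟨_, rfl⟩

end ProductImm

end Product

/-! ### The standard spherical inclusion -/

section Standard

variable {k : ℕ} {c : ℝ}

/-- The height of a point of the space form of curvature `c` over the base point. -/
def height (c : ℝ) (q : Euc k × ℝ) : ℝ :=
  -- The two cases are matched so that the height h satisfies |q.1|² + c h² = 2h on the space form
  -- for every c, with the paraboloid as the case c = 0.
  if c = 0 then (1 / 2) * inner ℝ q.1 q.1 else (√|c|)⁻¹ * q.2 + 1 / c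

/-- The vector `ξ` of square `-c` such that the standard spherical inclusion lies in the hyperplane
`⟨·, ξ⟩ = -√(1+c)`. -/
def stdVec (k : ℕ) (c : ℝ) : Mink (k + 1) := (e₀ k, √(1 + c))

/-- The standard spherical inclusion. -/
def stdIncl (k : ℕ) (c : ℝ) (q : Euc k × ℝ) : Mink (k + 1) :=
  (embSucc k q.1, 0) + (height c q • ((√(1 + c) • e₀ k, 1) : Mink (k + 1)) + (0, 1))

/-- The inverse of the standard spherical inclusion. -/
def stdInv (k : ℕ) (c : ℝ) (X : Mink (k + 1)) : Euc k × ℝ :=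
  (tailSucc k X.1, if c = 0 then 0 else √|c| * (X.2 - 1 - 1 / c))

theorem sign_mul_abs_eq (c : ℝ) : Real.sign c * |c| = c := by
  rcases lt_trichotomy c 0 with h | h | h
  · rw [Real.sign_of_neg h, abs_of_neg h]; ring
  · simp [h]
  · rw [Real.sign_of_pos h, abs_of_pos h]; ring

theorem sqrt_abs_sq (c : ℝ) : √|c| ^ 2 = |c| := Real.sq_sqrt (abs_nonneg c)

theorem stdVec_norm (hc : -1 < c) : lorentz (stdVec k c) (stdVec k c) = -c := by
  have hr : √(1 + c) ^ 2 = 1 + c := Real.sq_sqrt (by linarith)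
  simp only [lorentz, stdVec, real_inner_self_eq_norm_sq, norm_e₀]
  linear_combination -hr

theorem contDiff_height : ContDiff ℝ ∞ (height c : Euc k × ℝ → ℝ) := by
  unfold height
  by_cases h : c = 0
  · simp only [h, if_true]
    exact contDiff_const.mul (contDiff_fst.inner ℝ contDiff_fst)
  · simp only [h, if_false]
    exact (contDiff_const.mul contDiff_snd).add contDiff_const

theorem contDiff_stdIncl : ContDiff ℝ ∞ (stdIncl k c) :=
  (((toCLM (embSucc k)).contDiff.comp contDiff_fst).prodMk contDiff_const).add
    ((contDiff_height.smul contDiff_const).add contDiff_const)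

theorem contDiff_stdInv : ContDiff ℝ ∞ (stdInv k c) := by
  refine ((toCLM (tailSucc k)).contDiff.comp contDiff_fst).prodMk ?_
  by_cases h : c = 0
  · simp only [h, if_true]; exact contDiff_const
  · simp only [h, if_false]
    exact contDiff_const.mul ((contDiff_snd.sub contDiff_const).sub contDiff_const)

theorem stdIncl_fst (q : Euc k × ℝ) :
    (stdIncl k c q).1 = embSucc k q.1 + (√(1 + c) * height c q) • e₀ k := by
  simp only [stdIncl, Prod.fst_add, Prod.smul_fst, smul_smul, add_zero, mul_comm]

theorem stdIncl_snd (q : Euc k × ℝ) : (stdIncl k c q).2 = 1 + height c q := by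
  simp only [stdIncl, Prod.snd_add, Prod.smul_snd, smul_eq_mul, mul_one, zero_add, add_comm]

/-- The equation of the space form in terms of the height. -/
theorem height_eq {q : Euc k × ℝ} (hq : q ∈ spaceForm k c) :
    inner ℝ q.1 q.1 + c * height c q ^ 2 - 2 * height c q = 0 := by
  unfold height
  by_cases h : c = 0
  · simp only [h, if_true]; ring
  · have h1 := hq.1 h
    have h2 : √|c| ≠ 0 := (Real.sqrt_pos.2 (abs_pos.2 h)).ne'
    have h3 := sqrt_abs_sq c
    have h4 := sign_mul_abs_eq c
    simp only [h, if_false]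
    simp only [formOf] at h1
    have h5 : Real.sign c = c * (√|c|)⁻¹ ^ 2 := by
      rw [inv_pow, h3]
      have := abs_ne_zero.2 h
      field_simp
      linarith
    rw [h5] at h1
    have h6 : c * (1 / c) = 1 := by field_simp
    linear_combination h1 + (2 * (√|c|)⁻¹ * q.2 + 1 / c) * h6

/-- Puts the image of the standard inclusion on the upper sheet. For c < 0 the equation of the
height also has solutions with h < 0, but they belong to the lower sheet of the space form. -/
theorem height_nonneg {q : Euc k × ℝ} (hq : q ∈ spaceForm k c) : 0 ≤ height c q := by
  have h1 := height_eq hq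
  have h2 := real_inner_self_nonneg (x := q.1)
  by_contra! h
  rcases lt_trichotomy c 0 with hc | hc | hc
  · have h3 := hq.2.2 hc
    have h4 : (√|c|)⁻¹ * q.2 = height c q - 1 / c := by
      simp only [height, hc.ne, if_false]; ring
    have h5 : 0 < (√|c|)⁻¹ := inv_pos.2 (Real.sqrt_pos.2 (abs_pos.2 hc.ne))
    have h6 : 0 < height c q - 1 / c := h4 ▸ mul_pos h5 h3
    have h7 : c * (1 / c) = 1 := by have := hc.ne; field_simp
    have h8 : c * (height c q - 1 / c) < 0 := mul_neg_of_neg_of_pos hc h6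
    nlinarith
  · simp only [height, hc, if_true] at h
    linarith
  · nlinarith [mul_nonneg hc.le (sq_nonneg (height c q))]

theorem lorentz_stdIncl_self (hc : -1 < c) {q : Euc k × ℝ} (hq : q ∈ spaceForm k c) :
    lorentz (stdIncl k c q) (stdIncl k c q) = -1 := by
  have hr : √(1 + c) ^ 2 = 1 + c := Real.sq_sqrt (by linarith)
  rw [lorentz, stdIncl_fst, stdIncl_snd]
  simp only [inner_add_left, inner_add_right, real_inner_smul_left, real_inner_smul_right,
    inner_embSucc, inner_embSucc_e₀, real_inner_comm (embSucc k q.1) (e₀ k),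
    real_inner_self_eq_norm_sq (e₀ k), norm_e₀]
  linear_combination height_eq hq + height c q ^ 2 * hr

theorem lorentz_stdIncl_stdVec (q : Euc k × ℝ) :
    lorentz (stdIncl k c q) (stdVec k c) = -√(1 + c) := by
  rw [lorentz, stdIncl_fst, stdIncl_snd]
  simp only [stdVec, inner_add_left, real_inner_smul_left, inner_embSucc_e₀,
    real_inner_self_eq_norm_sq (e₀ k), norm_e₀]
  ring

theorem stdIncl_mem (hc : -1 < c) {q : Euc k × ℝ} (hq : q ∈ spaceForm k c) :
    stdIncl k c q ∈ hyperbolic (k + 1) :=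
  ⟨lorentz_stdIncl_self hc hq, by rw [stdIncl_snd]; linarith [height_nonneg hq]⟩

/-- The differential of the height. -/
def heightD (c : ℝ) (q x : Euc k × ℝ) : ℝ := if c = 0 then inner ℝ q.1 x.1 else (√|c|)⁻¹ * x.2

theorem hasFDerivAt_height (q : Euc k × ℝ) : ∃ L : Euc k × ℝ →L[ℝ] ℝ,
    HasFDerivAt (height c) L q ∧ ∀ x, L x = heightD c q x := by
  by_cases h : c = 0
  · refine ⟨_, ((hasFDerivAt_fst.inner ℝ hasFDerivAt_fst).const_mul (1 / 2 : ℝ)).congr_of_eventuallyEq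
      (Filter.Eventually.of_forall fun q => by simp only [height, h, if_true]), fun x => ?_⟩
    simp only [heightD, h, if_true]
    simp [real_inner_comm]
    ring
  · refine ⟨_, ((hasFDerivAt_snd.const_mul ((√|c|)⁻¹)).add_const (1 / c)).congr_of_eventuallyEq
      (Filter.Eventually.of_forall fun q => by simp only [height, h, if_false]), fun x => ?_⟩
    simp only [heightD, h, if_false]
    simp

theorem fderiv_stdIncl (q x : Euc k × ℝ) : fderiv ℝ (stdIncl k c) q x =
    (embSucc k x.1, 0) + heightD c q x • ((√(1 + c) • e₀ k, 1) : Mink (k + 1)) := by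
  obtain ⟨L, hL, hLx⟩ := hasFDerivAt_height (c := c) q
  have h1 : HasFDerivAt (stdIncl k c) _ q :=
    ((((toCLM (embSucc k)).hasFDerivAt.comp q hasFDerivAt_fst).prodMk
      (hasFDerivAt_const (0 : ℝ) q))).add
    ((hL.smul_const ((√(1 + c) • e₀ k, 1) : Mink (k + 1))).add_const (0, 1))
  rw [h1.fderiv, ← hLx]
  simp

theorem lorentz_fderiv_stdIncl (hc : -1 < c) (q x y : Euc k × ℝ) :
    lorentz (fderiv ℝ (stdIncl k c) q x) (fderiv ℝ (stdIncl k c) q y) = formOf c x y := by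
  have hr : √(1 + c) ^ 2 = 1 + c := Real.sq_sqrt (by linarith)
  rw [fderiv_stdIncl, fderiv_stdIncl]
  have h1 : Real.sign c * (x.2 * y.2) = c * (heightD c q x * heightD c q y) := by
    unfold heightD
    by_cases h : c = 0
    · simp [h]
    · simp only [h, if_false]
      have h3 := sqrt_abs_sq c
      have h4 := sign_mul_abs_eq c
      have h5 : Real.sign c = c * (√|c|)⁻¹ ^ 2 := by
        rw [inv_pow, h3]
        have := abs_ne_zero.2 h
        field_simp
        linarith
      rw [h5]; ring
  simp only [formOf, h1, lorentz, Prod.fst_add, Prod.snd_add, Prod.smul_fst, Prod.smul_snd,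
    inner_add_left, inner_add_right, real_inner_smul_left, real_inner_smul_right,
    inner_embSucc, inner_embSucc_e₀, real_inner_comm (embSucc k _) (e₀ k),
    real_inner_self_eq_norm_sq (e₀ k), norm_e₀, smul_eq_mul]
  linear_combination heightD c q x * heightD c q y * hr

theorem lorentz_stdIncl_fderiv (hc : -1 < c) {q x : Euc k × ℝ}
    (hx : x ∈ spaceFormTangent c q) :
    lorentz (stdIncl k c q) (fderiv ℝ (stdIncl k c) q x) = 0 := by
  have hr : √(1 + c) ^ 2 = 1 + c := Real.sq_sqrt (by linarith)
  have h1 : inner ℝ q.1 x.1 + c * height c q * heightD c q x - heightD c q x = 0 := by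
    unfold heightD height
    by_cases h : c = 0
    · simp [h]
    · simp only [h, if_false]
      have h3 := sqrt_abs_sq c
      have h4 := sign_mul_abs_eq c
      have h2 := hx.1 h
      have h5 : Real.sign c = c * (√|c|)⁻¹ ^ 2 := by
        rw [inv_pow, h3]
        have := abs_ne_zero.2 h
        field_simp
        linarith
      rw [formOf, h5] at h2
      have h6 : c * (1 / c) = 1 := by field_simp
      linear_combination h2 + ((√|c|)⁻¹ * x.2) * h6
  rw [fderiv_stdIncl, lorentz, stdIncl_fst, stdIncl_snd]
  simp only [Prod.fst_add, Prod.snd_add, Prod.smul_fst, Prod.smul_snd,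
    inner_add_left, inner_add_right, real_inner_smul_left, real_inner_smul_right,
    inner_embSucc, inner_embSucc_e₀, real_inner_comm (embSucc k _) (e₀ k),
    real_inner_self_eq_norm_sq (e₀ k), norm_e₀, smul_eq_mul]
  linear_combination h1 + height c q * heightD c q x * hr

/-- The image lies in a hyperplane with constant normal vector ξ; the field ξ - √(1 + c) X along it
is a unit normal, and its derivative is -√(1 + c) dX. -/
theorem isSphericalInclusion_stdIncl (hc : -1 < c) : IsSphericalInclusion k c (stdIncl k c) := by
  have hr : √(1 + c) ^ 2 = 1 + c := Real.sq_sqrt (by linarith)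
  refine ⟨contDiff_stdIncl, fun q hq => stdIncl_mem hc hq, fun q _ x _ y _ =>
    lorentz_fderiv_stdIncl hc q x y, fun q => stdVec k c - √(1 + c) • stdIncl k c q,
    contDiff_const.sub (contDiff_stdIncl.const_smul (√(1 + c))), fun q hq => ⟨?_, ?_, fun x hx => ⟨?_, ?_⟩⟩⟩
  · simp only [lorentz_sub_left, lorentz_sub_right, lorentz_smul_left, lorentz_smul_right,
      stdVec_norm hc, lorentz_stdIncl_self hc hq, lorentz_stdIncl_stdVec,
      lorentz_comm (stdVec k c) (stdIncl k c q)]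
    linear_combination hr
  · simp only [lorentz_sub_left, lorentz_smul_left, lorentz_stdIncl_self hc hq,
      lorentz_stdIncl_stdVec, lorentz_comm (stdVec k c) (stdIncl k c q)]
    ring
  · rw [lorentz_sub_left, lorentz_smul_left, lorentz_stdIncl_fderiv hc hx, fderiv_stdIncl]
    simp only [stdVec, lorentz, Prod.fst_add, Prod.snd_add, Prod.smul_fst, Prod.smul_snd,
      inner_add_right, real_inner_smul_right, real_inner_comm (embSucc k _) (e₀ k),
      inner_embSucc_e₀, real_inner_self_eq_norm_sq (e₀ k), norm_e₀, smul_eq_mul]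
    ring
  · have hd := (contDiff_stdIncl (k := k) (c := c)).differentiable (by simp) q
    have h : HasFDerivAt (fun q => stdVec k c - √(1 + c) • stdIncl k c q) _ q :=
      (hd.hasFDerivAt.const_smul (√(1 + c))).const_sub (stdVec k c)
    rw [h.fderiv, add_comm c 1]
    simp

/-- The standard inclusion fills the whole hyperplane section of hyperbolic space, and its inverse
is the restriction of a smooth map. This sends the hyperbolic part of a lift back to the space form.
-/
theorem stdInv_mem (hc : -1 < c) {X : Mink (k + 1)} (hX : X ∈ hyperbolic (k + 1))
    (hξ : lorentz X (stdVec k c) = -√(1 + c)) :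
    stdInv k c X ∈ spaceForm k c ∧ stdIncl k c (stdInv k c X) = X := by
  have hr : √(1 + c) ^ 2 = 1 + c := Real.sq_sqrt (by linarith)
  obtain ⟨h1, h2⟩ := hX
  set y := tailSucc k X.1 with hy
  -- The hyperplane equation determines the `e₀`-component from the time coordinate, and X.2 - 1
  -- will be the height.
  have h3 : inner ℝ X.1 (e₀ k) = √(1 + c) * (X.2 - 1) := by
    simp only [lorentz, stdVec] at hξ
    linear_combination hξ
  have h4 : X.1 = embSucc k y + (√(1 + c) * (X.2 - 1)) • e₀ k := by
    have h0 : inner ℝ X.1 (e₀ k) = X.1 0 := by simp [e₀, EuclideanSpace.inner_single_right]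
    rw [← h3, h0]; exact eq_embSucc_add X.1
  have h5 : inner ℝ y y + c * (X.2 - 1) ^ 2 - 2 * (X.2 - 1) = 0 := by
    rw [lorentz, h4] at h1
    simp only [inner_add_left, inner_add_right, real_inner_smul_left, real_inner_smul_right,
      inner_embSucc, inner_embSucc_e₀, real_inner_comm (embSucc k _) (e₀ k),
      real_inner_self_eq_norm_sq (e₀ k), norm_e₀] at h1
    linear_combination h1 - (X.2 - 1) ^ 2 * hr
  have hmem : stdInv k c X ∈ spaceForm k c := by
    refine ⟨fun h => ?_, fun h => ?_, fun h => ?_⟩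
    · simp only [formOf, stdInv, h, if_false, ← hy]
      have h7 : Real.sign c * (√|c| * (X.2 - 1 - 1 / c) * (√|c| * (X.2 - 1 - 1 / c))) =
          c * (X.2 - 1 - 1 / c) ^ 2 := by
        linear_combination Real.sign c * (X.2 - 1 - 1 / c) ^ 2 * sqrt_abs_sq c +
          (X.2 - 1 - 1 / c) ^ 2 * sign_mul_abs_eq c
      have h6 : c * (1 / c) = 1 := by field_simp
      rw [h7]
      linear_combination h5 + (1 / c - 2 * (X.2 - 1)) * h6
    · simp only [stdInv, h, if_true]
    · simp only [stdInv, h.ne, if_false]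
      refine mul_pos (Real.sqrt_pos.2 (abs_pos.2 h.ne)) ?_
      have h6 := real_inner_self_nonneg (x := y)
      have h7 : c * (1 / c) = 1 := by have := h.ne; field_simp
      have h8 : 1 / c < 0 := one_div_neg.2 h
      by_contra! h9
      have h10 : X.2 - 1 < 0 := by linarith
      nlinarith
  have hh : height c (stdInv k c X) = X.2 - 1 := by
    by_cases h : c = 0
    · simp only [height, h, if_true, stdInv, ← hy]
      rw [h] at h5
      linarith
    · simp only [height, h, if_false, stdInv]
      have h9 : √|c| ≠ 0 := (Real.sqrt_pos.2 (abs_pos.2 h)).ne'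
      rw [inv_mul_cancel_left₀ h9]
      ring
  refine ⟨hmem, Prod.ext ?_ ?_⟩
  · rw [stdIncl_fst, hh, h4]
    simp only [stdInv, ← hy]
  · rw [stdIncl_snd, hh]
    ring

end Standard

/-! ### The normal form in terms of products -/

section NormalForm

open Topology Filter

/-- The space form as a regular level set. -/
theorem exists_spaceForm_level {k : ℕ} {c : ℝ} {q : Euc k × ℝ} (hq : q ∈ spaceForm k c) :
    ∃ (Q : Euc k × ℝ → ℝ) (Q' : Euc k × ℝ →L[ℝ] ℝ) (b : ℝ), HasStrictFDerivAt Q Q' q ∧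
      (∀ y ∈ spaceForm k c, Q y = b) ∧ Function.Surjective Q' ∧
      ∀ x, Q' x = 0 → x ∈ spaceFormTangent c q := by
  by_cases h : c = 0
  · refine ⟨Prod.snd, ContinuousLinearMap.snd ℝ _ _, 0, hasStrictFDerivAt_snd, fun y hy => hy.2.1 h,
      fun a => ⟨(0, a), rfl⟩, fun x hx => ⟨fun h' => absurd h h', fun _ => hx⟩⟩
  · have h1 : HasFDerivAt (fun q : Euc k × ℝ => formOf c q q) _ q :=
      (hasFDerivAt_fst.inner ℝ hasFDerivAt_fst).add
        ((hasFDerivAt_snd.mul hasFDerivAt_snd).const_mul (Real.sign c))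
    have h2 : ContDiff ℝ ∞ (fun q : Euc k × ℝ => formOf c q q) :=
      (contDiff_fst.inner ℝ contDiff_fst).add (contDiff_const.mul (contDiff_snd.mul contDiff_snd))
    have h3 := h2.contDiffAt.hasStrictFDerivAt' h1 (by simp)
    set Q' := fderiv ℝ (fun q : Euc k × ℝ => formOf c q q) q with hQ'
    rw [← h1.fderiv] at h3
    have h4 : ∀ x, Q' x = 2 * formOf c q x := by
      intro x
      rw [hQ', h1.fderiv]
      simp [formOf, real_inner_comm]
      ring
    refine ⟨_, Q', 1 / c, h3, fun y hy => hy.1 h, fun a => ⟨(a * c / 2) • q, ?_⟩, fun x hx =>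
      ⟨fun _ => ?_, fun h' => absurd h' h⟩⟩
    · rw [map_smul, h4, hq.1 h, smul_eq_mul]; field_simp
    · have := h4 x
      rw [hx] at this
      linarith

theorem mem_spaceFormTangent_of_dif {M : Type u} [TopologicalSpace M] {n : ℕ}
    [ChartedSpace (Euc n) M] {k : ℕ} {c : ℝ} {g : M → Euc k × ℝ} {x : M} {g' : Euc n →L[ℝ] Euc k × ℝ}
    (hg : HasD n g x g') (hs : ∀ y, g y ∈ spaceForm k c) (t : Euc n) :
    g' t ∈ spaceFormTangent c (g x) := by
  obtain ⟨Q, Q', b, hQ, hb, -, h⟩ := exists_spaceForm_level (hs x)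
  apply h
  have h1 := (hg.comp hQ.hasFDerivAt).dif_eq
  have h2 : dif n (fun y => Q (g y)) x = 0 := by
    rw [dif_congr (g := fun _ => b) (Eventually.of_forall fun y => hb _ (hs y))]
    exact (hasD_const b x).dif_eq
  rw [h1] at h2
  exact DFunLike.congr_fun h2 t

variable {M : Type u} [TopologicalSpace M] {n : ℕ} [ChartedSpace (Euc n) M]

/-- The metric of a hypersurface in terms of any light cone lift. -/
theorem lorentz_dif_smul_psi {N : ℕ} {f : M → Euc N} {μ : M → ℝ} {x : M} (hf : SmAt n f x)
    (hμ : SmAt n μ x) (τ : LightConeModel N) (t : Euc n) :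
    lorentz (dif n (fun y => μ y • τ.psi (f y)) x t) (dif n (fun y => μ y • τ.psi (f y)) x t) =
      μ x ^ 2 * ‖dif n f x t‖ ^ 2 := by
  rw [(hμ.hasD.smul (hf.psi τ).hasD).dif_eq]
  simp only [_root_.add_apply, _root_.smul_apply, ContinuousLinearMap.smulRight_apply, dif_psi hf,
    lorentz_add_left, lorentz_add_right, lorentz_smul_left, lorentz_smul_right, τ.lorentz_tang,
    τ.lorentz_tang_psi, lorentz_comm (τ.psi _) (τ.tang _ _), τ.psi_null, real_inner_self_eq_norm_sq]
  ring

theorem ThetaMap.lift_eq_smul {N k m : ℕ} (Θ : ThetaMap N k m) {X : Mink (k + 1)} {Y : Euc (m + 1)}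
    (hX : X ∈ hyperbolic (k + 1)) (hY : Y ∈ unitSphere m) (h : Θ.DefinedAt X Y) :
    Θ.C X + Θ.D Y = lorentz (Θ.C X + Θ.D Y) Θ.w • Θ.psi (Θ.toFun X Y) := by
  rw [Θ.psi_toFun hX hY h, smul_smul, ThetaMap.lift,
    mul_inv_cancel₀ (a := lorentz (Θ.C X + Θ.D Y) Θ.w) h, one_smul]

/-- A map whose composition with an embedding is locally open onto the image is open. -/
theorem isOpenMap_of_map_nhds {A B E : Type*} [TopologicalSpace A] [TopologicalSpace B]
    [TopologicalSpace E] {ι : B → E} (hι : IsEmbedding ι) {φ : A → B}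
    (h : ∀ x, map (fun y => ι (φ y)) (𝓝 x) = 𝓝[Set.range ι] (ι (φ x))) : IsOpenMap φ := by
  refine IsOpenMap.of_nhds_le fun x => ?_
  rw [hι.nhds_eq_comap, ← comap_map (f := map φ (𝓝 x)) hι.injective, map_map]
  refine le_of_eq ?_
  rw [show map (ι ∘ φ) (𝓝 x) = 𝓝[Set.range ι] (ι (φ x)) from h x, nhdsWithin, comap_inf,
    comap_principal, Set.preimage_range, principal_univ, inf_top_eq]

/-- The differential of a spherical inclusion composed with a map. -/
theorem dif_spherical {k : ℕ} {f₁ : Euc k × ℝ → Mink (k + 1)} (hf₁ : ContDiff ℝ ∞ f₁)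
    {g : M → Euc k × ℝ} {x : M} (hg : SmAt n g x) :
    dif n (fun y => f₁ (g y)) x = (fderiv ℝ f₁ (g x)).comp (dif n g x) :=
  (hg.hasD.comp (hf₁.differentiable (by simp) (g x)).hasFDerivAt).dif_eq

/-- To bring a hypersurface into normal form it is enough to factor it through `Θ ∘ (f₁ × id)`. -/
theorem hasNormalForm_of [IsManifold (𝓡 n) ∞ M] {m k : ℕ} (hmk : m + k = n) {c : ℝ}
    {f : M → Euc (n + 1)} (hf : IsSmoothImmersion n f) (φ : M → spaceForm k c × unitSphere m)
    (h1 : ∀ x, SmAt n (fun p => ((φ p).1 : Euc k × ℝ)) x)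
    (h2 : ∀ x, SmAt n (fun p => ((φ p).2 : Euc (m + 1))) x)
    {f₁ : Euc k × ℝ → Mink (k + 1)} (hf₁ : IsSphericalInclusion k c f₁) (Θ : ThetaMap (n + 1) k m)
    (hΘ : ∀ p, Θ.DefinedAt (f₁ (φ p).1) (φ p).2 ∧ f p = Θ.toFun (f₁ (φ p).1) (φ p).2) :
    HasNormalForm n m k c f := by
  set g₁ : M → Euc k × ℝ := fun p => ((φ p).1 : Euc k × ℝ) with hg₁
  set g₂ : M → Euc (m + 1) := fun p => ((φ p).2 : Euc (m + 1)) with hg₂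
  set X : M → Mink (k + 1) := fun p => f₁ (g₁ p) with hX
  have sX : ∀ x, SmAt n X x := fun x => (h1 x).comp hf₁.1.contDiffAt
  set μ : M → ℝ := fun p => lorentz (Θ.C (X p) + Θ.D (g₂ p)) Θ.w with hμ
  have sZ : ∀ x, SmAt n (fun p => Θ.C (X p) + Θ.D (g₂ p)) x := fun x =>
    ((sX x).linear Θ.C).add ((h2 x).linear Θ.D)
  have sμ : ∀ x, SmAt n μ x := fun x => (sZ x).lorentz (smAt_const _ x)
  have hμ0 : ∀ x, μ x ≠ 0 := fun x => (hΘ x).1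
  have hZ : ∀ p, Θ.C (X p) + Θ.D (g₂ p) = μ p • Θ.psi (f p) := by
    intro p
    rw [(hΘ p).2]
    exact Θ.lift_eq_smul (hf₁.2.1 _ (φ p).1.2) (φ p).2.2 (hΘ p).1
  -- `C`, `D` and `f₁` preserve products, so the left side is the metric of the lift C X + D Y =
  -- μΨ(f), which is μ² times that of `f`. The conformal factor is |μ|.
  have key : ∀ p t, formOf c (dif n g₁ p t) (dif n g₁ p t) + ‖dif n g₂ p t‖ ^ 2 =
      |μ p| ^ 2 * ‖dif n f p t‖ ^ 2 := by
    intro p t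
    have e1 := lorentz_dif_smul_psi (hf.1 p) (sμ p) Θ.toLightConeModel t
    have e2 : dif n (fun y => μ y • Θ.psi (f y)) p t = Θ.C (dif n X p t) + Θ.D (dif n g₂ p t) := by
      rw [dif_congr (n := n) (Eventually.of_forall fun y => (hZ y).symm),
        (((sX p).hasD.linear Θ.C).add ((h2 p).hasD.linear Θ.D)).dif_eq]
      rfl
    have e3 : lorentz (dif n X p t) (dif n X p t) = formOf c (dif n g₁ p t) (dif n g₁ p t) := by
      rw [dif_spherical hf₁.1 (h1 p)]
      have h3 := mem_spaceFormTangent_of_dif (h1 p).hasD (fun y => (φ y).1.2) t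
      exact hf₁.2.2.1 _ (φ p).1.2 _ h3 _ h3
    rw [e2] at e1
    simp only [lorentz_add_left, lorentz_add_right, Θ.C_isometry, Θ.D_isometry, Θ.C_D,
      lorentz_comm (Θ.D _) (Θ.C _), e3, real_inner_self_eq_norm_sq] at e1
    rw [sq_abs]
    linarith
  -- The conformality just shown makes the differential injective, and the product of the space form
  -- and the sphere is a regular level set of dimension n.
  have hloc : ∀ x, map (fun y => (g₁ y, g₂ y)) (𝓝 x) =
      𝓝[spaceForm k c ×ˢ unitSphere m] (g₁ x, g₂ x) ∧
        ∃ V ∈ 𝓝 x, Set.InjOn (fun y => (g₁ y, g₂ y)) V := by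
    intro x
    obtain ⟨Q, Q', b, hQ, hb, hs, -⟩ := exists_spaceForm_level (φ x).1.2
    have hn : ‖g₂ x‖ = 1 := mem_sphere_zero_iff_norm.1 (φ x).2.2
    have hQ1 := hQ.comp (g₁ x, g₂ x) (f := fun s : (Euc k × ℝ) × Euc (m + 1) => s.1)
      hasStrictFDerivAt_fst
    let pY : (Euc k × ℝ) × Euc (m + 1) →L[ℝ] Euc (m + 1) := ContinuousLinearMap.snd ℝ _ _
    have hQ3 := ((innerSL ℝ (E := Euc (m + 1))).isBoundedBilinearMap.hasStrictFDerivAt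
      (g₂ x, g₂ x)).comp (g₁ x, g₂ x) (f := fun s : (Euc k × ℝ) × Euc (m + 1) => (s.2, s.2))
      (pY.prod pY).hasStrictFDerivAt
    have hQ4 := hQ1.prodMk hQ3
    refine map_nhds_eq_nhdsWithin ((h1 x).prodMk (h2 x)) ?_
      (Eventually.of_forall fun y => ⟨(φ y).1.2, (φ y).2.2⟩) hQ4 (c := (b, 1)) ?_ ?_
    · rw [((h1 x).hasD.prodMk (h2 x).hasD).dif_eq, injective_iff_map_eq_zero]
      intro t ht
      have k1 : dif n g₁ x t = 0 := congrArg Prod.fst ht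
      have k2 : dif n g₂ x t = 0 := congrArg Prod.snd ht
      have k3 := key x t
      rw [k1, k2] at k3
      simp only [formOf, Prod.fst_zero, Prod.snd_zero, inner_zero_left, norm_zero, mul_zero,
        add_zero, ne_eq, OfNat.ofNat_ne_zero, not_false_eq_true, zero_pow, sq_abs] at k3
      have k4 : ‖dif n f x t‖ ^ 2 = 0 := by
        rcases mul_eq_zero.1 k3.symm with h | h
        · exact absurd h (pow_ne_zero 2 (hμ0 x))
        · exact h
      exact hf.2 x ((norm_eq_zero.1 ((pow_eq_zero_iff two_ne_zero).1 k4)).trans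
        (map_zero (dif n f x)).symm)
    · rintro s ⟨hs1, hs2⟩
      refine Prod.ext (hb _ hs1) ?_
      change inner ℝ s.2 s.2 = 1
      have : ‖s.2‖ = 1 := by simpa using hs2
      rw [real_inner_self_eq_norm_sq, this]; norm_num
    · refine le_of_add_le_add_right (a := Module.finrank ℝ (ℝ × ℝ))
        ((finrank_ker_add_of_surjective ?_).trans_le ?_)
      · rintro ⟨a, d⟩
        obtain ⟨v, hv⟩ := hs a
        refine ⟨(v, (d / 2) • g₂ x), Prod.ext hv ?_⟩
        change inner ℝ (g₂ x) ((d / 2) • g₂ x) + inner ℝ ((d / 2) • g₂ x) (g₂ x) = d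
        rw [real_inner_smul_left, real_inner_smul_right, real_inner_self_eq_norm_sq, hn]
        ring
      · simp only [Module.finrank_prod, finrank_euclideanSpace, Fintype.card_fin,
          Module.finrank_self]
        omega
  have hφc : Continuous φ := by
    refine Continuous.prodMk ?_ ?_
    · exact Continuous.subtype_mk (continuous_iff_continuousAt.2 fun x => (h1 x).continuousAt) _
    · exact Continuous.subtype_mk (continuous_iff_continuousAt.2 fun x => (h2 x).continuousAt) _
  have hφo : IsOpenMap φ := by
    refine isOpenMap_of_map_nhds (ι := Prod.map Subtype.val Subtype.val)
      (IsEmbedding.subtypeVal.prodMap IsEmbedding.subtypeVal) fun x => ?_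
    rw [Set.range_prodMap, Subtype.range_val, Subtype.range_val]
    exact (hloc x).1
  have hφl : IsLocalHomeomorph φ := by
    rw [isLocalHomeomorph_iff_isOpenEmbedding_restrict]
    intro x
    obtain ⟨V, hV, hinj⟩ := (hloc x).2
    obtain ⟨V', hV', hV'o, hxV'⟩ := mem_nhds_iff.1 hV
    refine ⟨V', hV'o.mem_nhds hxV', IsOpenEmbedding.of_continuous_injective_isOpenMap
      (hφc.comp continuous_subtype_val) ?_ (hφo.domRestrict hV'o)⟩
    intro a b hab
    apply Subtype.ext
    apply hinj (hV' a.2) (hV' b.2)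
    have hab' : φ a = φ b := hab
    simp only [hg₁, hg₂, hab']
  refine ⟨φ, f₁, Θ, ⟨h1, h2, hφl, fun p => |μ p|, fun p => abs_pos.2 (hμ0 p), key⟩, fun hinj => ?_,
    hf₁, hΘ⟩
  -- `f` factors through `φ`, so `φ` is injective whenever `f` is.
  refine hφl.isOpenEmbedding_of_injective fun a b hab => hinj ?_
  rw [(hΘ a).2, (hΘ b).2, hab]

/-- The product immersion that underlies a normal form. -/
theorem HasNormalForm.exists_product [IsManifold (𝓡 n) ∞ M] {m k : ℕ} (hm : 0 < m) (hk : 0 < k)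
    (hmk : m + k = n) {c : ℝ} (hc : -1 < c) {f : M → Euc (n + 1)} (hf : IsSmoothImmersion n f)
    (h : HasNormalForm n m k c f) :
    ∃ (Θ : ThetaMap (n + 1) k m) (X : M → Mink (k + 1)) (Y : M → Euc (m + 1)),
      (∀ p, X p ∈ hyperbolic (k + 1) ∧ lorentz (Θ.C (X p) + Θ.D (Y p)) Θ.w ≠ 0 ∧
        Θ.C (X p) + Θ.D (Y p) = lorentz (Θ.C (X p) + Θ.D (Y p)) Θ.w • Θ.psi (f p)) ∧
      ∀ p, ∃ (U : Set M) (ξ : Mink (k + 1)), p ∈ U ∧ ProductImm n c ξ X Y U := by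
  obtain ⟨φ, f₁, Θ, ⟨h1, h2, -, ρ, hρ, hconf⟩, -, hf₁, hΘ⟩ := h
  obtain ⟨hf₁s, hf₁h, hf₁i, ν, hνs, hν⟩ := hf₁
  set g₁ : M → Euc k × ℝ := fun p => ((φ p).1 : Euc k × ℝ) with hg₁
  set g₂ : M → Euc (m + 1) := fun p => ((φ p).2 : Euc (m + 1)) with hg₂
  have sg₁ : ∀ x, SmAt n g₁ x := h1
  have sg₂ : ∀ x, SmAt n g₂ x := h2
  set X : M → Mink (k + 1) := fun p => f₁ (g₁ p) with hX
  have sX : ∀ x, SmAt n X x := fun x => (sg₁ x).comp hf₁s.contDiffAt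
  have sν : ∀ x, SmAt n (fun p => ν (g₁ p)) x := fun x => (sg₁ x).comp hνs.contDiffAt
  have htan : ∀ p t, dif n g₁ p t ∈ spaceFormTangent c (g₁ p) := fun p t =>
    mem_spaceFormTangent_of_dif (sg₁ p).hasD (fun y => (φ y).1.2) t
  refine ⟨Θ, X, g₂, fun p => ⟨hf₁h _ (φ p).1.2, (hΘ p).1, ?_⟩, fun p => ?_⟩
  · have := Θ.lift_eq_smul (hf₁h _ (φ p).1.2) (φ p).2.2 (hΘ p).1
    rw [← (hΘ p).2] at this
    exact this
  have hr : √(1 + c) ^ 2 = 1 + c := Real.sq_sqrt (by linarith)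
  have sξ : ∀ x, SmAt n (fun p => ν (g₁ p) + √(1 + c) • X p) x := fun x =>
    (sν x).add ((sX x).const_smul _)
  -- Umbilicity says that ν + √(1 + c) X has zero differential. Its local value is ξ, of square 1 -
  -- (1 + c) = -c.
  have hconst := eventually_eq_of_dif_eq_zero (n := n) (p := p)
    (g := fun p => ν (g₁ p) + √(1 + c) • X p) (Eventually.of_forall fun x => ⟨sξ x, by
      rw [((sν x).hasD.add ((sX x).hasD.const_smul _)).dif_eq]
      ext1 t
      rw [_root_.add_apply, _root_.smul_apply, dif_spherical hνs (sg₁ x),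
        dif_spherical hf₁s (sg₁ x)]
      have := ((hν _ (φ x).1.2).2.2 _ (htan x t)).2
      rw [ContinuousLinearMap.comp_apply, ContinuousLinearMap.comp_apply, this, add_comm c 1, neg_smul]
      exact neg_add_cancel _⟩)
  obtain ⟨U, hU, hUo, hpU⟩ := mem_nhds_iff.1 hconst
  have hξ : ∀ x ∈ U, ν (g₁ p) + √(1 + c) • X p = ν (g₁ x) + √(1 + c) • X x := fun x hx =>
    (hU hx).symm
  have hXX : ∀ x, lorentz (X x) (X x) = -1 := fun x => (hf₁h _ (φ x).1.2).1
  have hνX : ∀ x, lorentz (ν (g₁ x)) (X x) = 0 := fun x => (hν _ (φ x).1.2).2.1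
  have hνν : ∀ x, lorentz (ν (g₁ x)) (ν (g₁ x)) = 1 := fun x => (hν _ (φ x).1.2).1
  refine ⟨U, ν (g₁ p) + √(1 + c) • X p, hpU, hUo, hc, hmk, hm, hk, ?_, fun x _ => sX x,
    fun x _ => sg₂ x, fun x _ => hXX x, fun x hx => ?_, fun x _ => mem_sphere_zero_iff_norm.1 (φ x).2.2,
    fun x _ t ht1 ht2 => ?_⟩
  · simp only [lorentz_add_left, lorentz_add_right, lorentz_smul_left, lorentz_smul_right, hXX, hνX,
      hνν, lorentz_comm (X p) (ν (g₁ p))]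
    linear_combination -hr
  · rw [hξ x hx, lorentz_add_right, lorentz_smul_right, hXX, lorentz_comm (X x), hνX]
    ring
  · have k1 : formOf c (dif n g₁ x t) (dif n g₁ x t) + ‖dif n g₂ x t‖ ^ 2 =
        ρ x ^ 2 * ‖dif n f x t‖ ^ 2 := hconf x t
    have k2 : lorentz (dif n X x t) (dif n X x t) = formOf c (dif n g₁ x t) (dif n g₁ x t) := by
      rw [dif_spherical hf₁s (sg₁ x)]
      exact hf₁i _ (φ x).1.2 _ (htan x t) _ (htan x t)
    rw [← k2, ht1, ht2, lorentz_zero_left, norm_zero] at k1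
    have k4 : ‖dif n f x t‖ ^ 2 = 0 := by
      rcases mul_eq_zero.1 (k1.symm.trans (by norm_num)) with h | h
      · exact absurd h (pow_ne_zero 2 (hρ x).ne')
      · exact h
    exact hf.2 x ((norm_eq_zero.1 ((pow_eq_zero_iff two_ne_zero).1 k4)).trans
        (map_zero (dif n f x)).symm)

end NormalForm

/-! ### Existence of the normal form -/

section Existence

open Topology Filter

/-- Two orthogonal Euclidean subspaces and a vector orthogonal to both span the whole space if
their dimensions add up. -/
theorem exists_eq_add_add {d i j : ℕ} {D : Euc i →ₗ[ℝ] Mink d} {E : Euc j →ₗ[ℝ] Mink d}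
    {κ : Mink d} (hD : ∀ y y', lorentz (D y) (D y') = inner ℝ y y')
    (hE : ∀ y y', lorentz (E y) (E y') = inner ℝ y y') (hDE : ∀ y z, lorentz (D y) (E z) = 0)
    (hκD : ∀ y, lorentz κ (D y) = 0) (hκE : ∀ y, lorentz κ (E y) = 0) (hκ : κ ≠ 0)
    (hd : i + j = d) (v : Mink d) : ∃ y z, ∃ s : ℝ, v = D y + E z + s • κ := by
  let L : (Euc i × Euc j × ℝ) →ₗ[ℝ] Mink d :=
    D.coprod (E.coprod (LinearMap.toSpanSingleton ℝ _ κ))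
  have hL : ∀ y z s, L (y, z, s) = D y + E z + s • κ := by
    intro y z s
    simp [L, add_assoc]
  have hinj : Function.Injective L := by
    rw [← LinearMap.ker_eq_bot, LinearMap.ker_eq_bot']
    rintro ⟨y, z, s⟩ h
    rw [hL] at h
    have h1 : lorentz (D y + E z + s • κ) (D y) = 0 := by rw [h, lorentz_zero_left]
    have h2 : lorentz (D y + E z + s • κ) (E z) = 0 := by rw [h, lorentz_zero_left]
    simp only [lorentz_add_left, lorentz_smul_left, hD, hE, hDE, hκD, hκE,
      lorentz_comm (E z) (D y), mul_zero, add_zero, zero_add] at h1 h2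
    have hy : y = 0 := inner_self_eq_zero.1 h1
    have hz : z = 0 := inner_self_eq_zero.1 h2
    rw [hy, hz, map_zero, map_zero, zero_add, zero_add] at h
    have hs := (smul_eq_zero.1 h).resolve_right hκ
    simp [hy, hz, hs]
  have hdim : Module.finrank ℝ (Euc i × Euc j × ℝ) = Module.finrank ℝ (Mink d) := by
    simp [Module.finrank_prod]
    omega
  obtain ⟨⟨y, z, s⟩, h⟩ := (LinearMap.injective_iff_surjective_of_finrank_eq_finrank hdim).1 hinj v
  exact ⟨y, z, s, by rw [← h, hL]⟩

variable {M : Type u} [TopologicalSpace M] {n : ℕ} [ChartedSpace (Euc n) M]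

namespace Adapted

variable {F Ka Kb : M → Mink (n + 1 + 1)} {m k : ℕ} {δ : M → ℝ} {V : Set M}
  {D : Euc (m + 1) →ₗ[ℝ] Mink (n + 1 + 1)} {κ : Mink (n + 1 + 1)}

omit [TopologicalSpace M] [ChartedSpace (Euc n) M] in
theorem congr {U : Set M} {Ka' Kb' : M → Mink (n + 1 + 1)} {j : ℕ}
    {D : Euc j →ₗ[ℝ] Mink (n + 1 + 1)} (h : Adapted Ka Kb D κ U)
    (ha : ∀ x ∈ U, Ka' x = Ka x) (hb : ∀ x ∈ U, Kb' x = Kb x) : Adapted Ka' Kb' D κ U where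
  iso := h.iso
  perp := h.perp
  a_D x hx := by rw [ha x hx]; exact h.a_D x hx
  a_κ x hx := by rw [ha x hx]; exact h.a_κ x hx
  b_mem x hx := by rw [hb x hx]; exact h.b_mem x hx

/-- Unique continuation for the Euclidean subspace. -/
theorem extend (hc : CurvPair F m k Ka Kb δ V)
    (h : (∃ (E : Euc (m + 1) →ₗ[ℝ] Mink (n + 1 + 1)) (χ : Mink (n + 1 + 1)), Adapted Ka Kb E χ V) ∨
      ∃ (E : Euc (k + 1) →ₗ[ℝ] Mink (n + 1 + 1)) (χ : Mink (n + 1 + 1)),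
        Adapted (fun x => -Kb x) (fun x => -Ka x) E χ V)
    {x : M} (hx : x ∈ V) {U : Set M} (hU : IsOpen U) (hxU : x ∈ U)
    (h' : Adapted Ka Kb D κ U) : Adapted Ka Kb D κ V := by
  have hUn := hU.mem_nhds hxU
  have zD : ∀ y, ∀ᶠ p in 𝓝 x, lorentz (Ka p) (D y) = 0 := fun y =>
    eventually_of_mem hUn fun p hp => h'.a_D p hp y
  have zκ : ∀ᶠ p in 𝓝 x, lorentz (Ka p) κ = 1 := eventually_of_mem hUn fun p hp => h'.a_κ p hp
  rcases h with ⟨E, χ, hE⟩ | ⟨E, χ, hE⟩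
  · have hD : ∀ y, ∃ z, D y = E z := by
      intro y
      obtain ⟨z, hz⟩ := hE.mem_range_of_const_a hc hx (zD y)
      exact ⟨z, by rw [hz, zero_smul, zero_add]⟩
    obtain ⟨z₀, hz₀⟩ := hE.mem_range_of_const_a hc hx zκ
    -- If the same family is Euclidean on `V`, then range D is contained in range E and both have
    -- dimension m + 1; κ and χ then differ by an element of range E.
    have hrange : LinearMap.range D = LinearMap.range E := by
      apply Submodule.eq_of_le_of_finrank_le
      · rintro _ ⟨y, rfl⟩
        obtain ⟨z, hz⟩ := hD y
        exact ⟨z, hz.symm⟩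
      · rw [LinearMap.finrank_range_of_inj (isometry_injective hE.iso),
          LinearMap.finrank_range_of_inj (isometry_injective h'.iso)]
    refine ⟨h'.iso, h'.perp, fun p hp y => ?_, fun p hp => ?_, fun p hp => ?_⟩
    · obtain ⟨z, hz⟩ := hD y
      rw [hz]; exact hE.a_D p hp z
    · rw [hz₀, lorentz_add_right, one_smul, hE.a_κ p hp, hE.a_D p hp, add_zero]
    · obtain ⟨z, hz⟩ := hE.b_mem p hp
      have : E (z - z₀) ∈ LinearMap.range D := by rw [hrange]; exact ⟨_, rfl⟩
      obtain ⟨y, hy⟩ := this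
      refine ⟨y, ?_⟩
      rw [hy, hz₀, hz, map_sub]; module
  -- If instead the K_a span a Euclidean affine subspace on `V`, then constancy of the products near
  -- `x` makes range D orthogonal to range E and χ, and the same relations hold for all K_a on `V`.
  · have hs := hc.swap
    have hD : ∀ y, (∀ z, lorentz (D y) (E z) = 0) ∧ lorentz χ (D y) = 0 := fun y =>
      hE.perp_of_const_b hs hx ((zD y).mono fun p hp => by rw [lorentz_neg_left, hp, neg_zero])
    have hκ : (∀ z, lorentz κ (E z) = 0) ∧ lorentz χ κ = -1 :=
      hE.perp_of_const_b hs hx (zκ.mono fun p hp => by rw [lorentz_neg_left, hp])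
    have hχ : χ ≠ 0 := by
      intro h0
      have := hE.a_κ x hx
      rw [h0, lorentz_zero_right] at this
      norm_num at this
    have hKa : ∀ p ∈ V, ∃ z, Ka p = -(χ + E z) := fun p hp => by
      obtain ⟨z, hz⟩ := hE.b_mem p hp
      exact ⟨z, by rw [← hz, neg_neg]⟩
    refine ⟨h'.iso, h'.perp, fun p hp y => ?_, fun p hp => ?_, fun p hp => ?_⟩
    · obtain ⟨z, hz⟩ := hKa p hp
      rw [hz, lorentz_neg_left, lorentz_add_left, (hD y).2, lorentz_comm, (hD y).1]; ring
    · obtain ⟨z, hz⟩ := hKa p hp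
      rw [hz, lorentz_neg_left, lorentz_add_left, hκ.2, lorentz_comm, hκ.1]; ring
    · have hdim := hc.dim
      obtain ⟨y, z, s, hv⟩ := exists_eq_add_add h'.iso hE.iso (fun y => (hD y).1)
        (fun y => (hD y).2) hE.perp hχ (by omega) (Kb p - κ)
      have h1 : ∀ z, lorentz (Kb p - κ) (E z) = 0 := by
        intro z
        have h2 := hE.a_D p hp z
        rw [lorentz_neg_left] at h2
        rw [lorentz_sub_left, hκ.1]; linarith
      have h3 : lorentz (Kb p - κ) χ = 0 := by
        have h2 := hE.a_κ p hp
        rw [lorentz_neg_left] at h2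
        rw [lorentz_sub_left, lorentz_comm κ, hκ.2]; linarith
      -- range D, range E and χ span everything, as (m + 1) + (k + 1) = n + 2. The vector K_b - κ is
      -- orthogonal to the last two, hence in range D.
      have hw : Kb p - κ - D (coadj D (Kb p - κ)) = 0 := by
        apply lorentz_nondegenerate
        intro u
        obtain ⟨y', z', s', rfl⟩ := exists_eq_add_add h'.iso hE.iso (fun y => (hD y).1)
          (fun y => (hD y).2) hE.perp hχ (by omega) u
        simp only [lorentz_sub_left, lorentz_add_right, lorentz_smul_right, h'.iso, inner_coadj,
          (hD _).1, lorentz_comm (D _) χ, (hD _).2] at h1 h3 ⊢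
        rw [h1, h3]; ring
      exact ⟨coadj D (Kb p - κ), by rw [← sub_eq_zero, ← hw]; module⟩

end Adapted

theorem exists_lightConeModel (N : ℕ) : Nonempty (LightConeModel N) := by
  obtain ⟨τ, -⟩ := LightConeModel.exists_of_null (N := N) (p₀ := ((1 / 2 : ℝ) • e₀ N, 1 / 2))
    (w := (e₀ N, -1))
    (by
      simp only [lorentz, real_inner_self_eq_norm_sq, norm_smul, norm_e₀]
      norm_num)
    (by simp [lorentz, norm_e₀])
    (by simp [lorentz, real_inner_smul_left, norm_e₀]; norm_num)
  exact ⟨τ⟩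

/-- A pair of curvature spheres adapted to one Euclidean subspace gives the normal form. -/
theorem hasNormalForm_of_forall_adapted [IsManifold (𝓡 n) ∞ M] [PreconnectedSpace M] {m k : ℕ}
    {f : M → Euc (n + 1)} (hf : IsSmoothImmersion n f) (τ : LightConeModel (n + 1))
    {D : Euc (m + 1) →ₗ[ℝ] Mink (n + 1 + 1)} {κ : Mink (n + 1 + 1)}
    (h : ∀ p, ∃ (Ka Kb : M → Mink (n + 1 + 1)) (δ : M → ℝ) (U : Set M), p ∈ U ∧
      CurvPair (fun y => τ.psi (f y)) m k Ka Kb δ U ∧ (∀ x ∈ U, 0 < δ x) ∧ Adapted Ka Kb D κ U)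
    (p₀ : M) : ∃ c : ℝ, -1 < c ∧ HasNormalForm n m k c f := by
  obtain ⟨Ka₀, Kb₀, δ₀, U₀, hp₀, hc₀, hδ₀, hA₀⟩ := h p₀
  have hD := hA₀.iso
  have hdim := hc₀.dim
  set c := -lorentz κ κ with hcdef
  have hκκ : lorentz κ κ = -c := by rw [hcdef, neg_neg]
  have hc : -1 < c := by have := hA₀.radius_pos hc₀ hp₀; linarith
  set r := √(1 + c) with hrdef
  have hr : 0 < r := Real.sqrt_pos.2 (by linarith)
  have hr2 : r ^ 2 = 1 + c := Real.sq_sqrt (by linarith)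
  -- At the base point (κ - K_a)/r is time-like and K_a is a unit vector orthogonal to it. This
  -- choice makes C send the standard vector ξ to K_a + r · (κ - K_a)/r = κ.
  obtain ⟨C, hC, hCD, hC1, hC2⟩ := exists_frame (k := k) (m := m + 1) hD
    (X₀ := r⁻¹ • (κ - Ka₀ p₀)) (ν₀ := Ka₀ p₀) (by omega)
    (by
      simp only [lorentz_smul_left, lorentz_smul_right, lorentz_sub_left, lorentz_sub_right,
        hc₀.unit p₀ hp₀, lorentz_comm κ, hA₀.a_κ p₀ hp₀]
      rw [hκκ]
      field_simp
      linarith)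
    (hc₀.unit p₀ hp₀)
    (by
      simp only [lorentz_smul_right, lorentz_sub_right, hc₀.unit p₀ hp₀, hA₀.a_κ p₀ hp₀]; ring)
    (fun y => by
      rw [lorentz_smul_left, lorentz_sub_left, hA₀.perp, hA₀.a_D p₀ hp₀]; ring)
    (hA₀.a_D p₀ hp₀)
  have hCξ : C (stdVec k c) = κ := by
    have h1 : stdVec k c = (e₀ k, 0) + r • ((0, 1) : Mink (k + 1)) := by
      simp [stdVec, hrdef]
    rw [h1, map_add, map_smul, hC1, smul_smul, mul_inv_cancel₀ hr.ne']
    change C (EuclideanSpace.single 0 1, 0) + _ = _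
    rw [hC2]; module
  set F : M → Mink (n + 1 + 1) := fun y => τ.psi (f y) with hF
  have sF : ∀ x, SmAt n F x := fun x => SmAt.psi (hf.1 x) τ
  have sDF : ∀ x, SmAt n (fun p => coadj D (F p)) x := fun x => (sF x).linear (coadj D)
  have hloc : ∀ p, ∃ (Ka Kb : Mink (n + 1 + 1)) (y : Euc (m + 1)) (δ : ℝ), 0 < δ ∧
      Kb = Ka + δ • F p ∧ (∀ y, lorentz Ka (D y) = 0) ∧ lorentz Ka κ = 1 ∧ Kb = κ + D y ∧
      ‖coadj D Kb‖ ^ 2 = r ^ 2 := by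
    intro p
    obtain ⟨Ka, Kb, δ, U, hp, hc, hδ, hA⟩ := h p
    obtain ⟨y, hy⟩ := hA.b_mem p hp
    refine ⟨Ka p, Kb p, y, δ p, hδ p hp, hc.eq p hp, hA.a_D p hp, hA.a_κ p hp, hy, ?_⟩
    rw [hA.norm_sq hc hp, hr2, hκκ]; ring
  -- K_a has no component in range D, and that of K_b = K_a + δF has length r > 0.
  have hnorm : ∀ p, coadj D (F p) ≠ 0 := by
    intro p h0
    obtain ⟨Ka, Kb, y, δ, hδ, e1, e2, e3, e4, e5⟩ := hloc p
    rw [e1, map_add, map_smul, h0, coadj_eq_zero e2] at e5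
    rw [smul_zero, add_zero, norm_zero, zero_pow two_ne_zero] at e5
    exact (pow_pos hr 2).ne e5
  -- The lift is normalized globally so that its component in range D is a unit vector; the local
  -- curvature spheres are not involved in the definition.
  set l : M → ℝ := fun p => ‖coadj D (F p)‖⁻¹ with hl
  have hl0 : ∀ p, 0 < l p := fun p => inv_pos.2 (norm_pos_iff.2 (hnorm p))
  have sl : ∀ x, SmAt n l x := fun x =>
    ((sDF x).norm (hnorm x)).inv (norm_ne_zero_iff.2 (hnorm x))
  set Z : M → Mink (n + 1 + 1) := fun p => l p • F p with hZ
  have sZ : ∀ x, SmAt n Z x := fun x => (sl x).smul (sF x)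
  set X : M → Mink (k + 1) := fun p => coadjM C (Z p) with hX
  set Y : M → Euc (m + 1) := fun p => coadj D (Z p) with hY
  have hZXY : ∀ p, Z p = C (X p) + D (Y p) := fun p => eq_add_coadj hC hD hCD (by omega) _
  have hYn : ∀ p, ‖Y p‖ = 1 := by
    intro p
    simp only [hY, hZ, map_smul, norm_smul, hl, norm_inv, norm_norm]
    exact inv_mul_cancel₀ (norm_ne_zero_iff.2 (hnorm p))
  have hXX : ∀ p, lorentz (X p) (X p) = -1 := by
    intro p
    have h1 : lorentz (Z p) (Z p) = 0 := by
      simp only [hZ, lorentz_smul_left, lorentz_smul_right, hF, τ.psi_null, mul_zero]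
    rw [hZXY p] at h1
    simp only [lorentz_add_left, lorentz_add_right, hC, hD, hCD, lorentz_comm (D _) (C _),
      real_inner_self_eq_norm_sq, hYn] at h1
    linarith
  -- Comparing lengths in range D gives δ‖coadj D F‖ = r; positivity of δ excludes the other sign.
  have hZloc : ∀ p, ∀ (Ka Kb : Mink (n + 1 + 1)) (δ : ℝ), 0 < δ → Kb = Ka + δ • F p →
      (∀ y, lorentz Ka (D y) = 0) → ‖coadj D Kb‖ ^ 2 = r ^ 2 → r • Z p = Kb - Ka := by
    intro p Ka Kb δ hδ e1 e2 e5
    have e6 : δ * ‖coadj D (F p)‖ = r := by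
      rw [e1, map_add, map_smul, coadj_eq_zero e2, zero_add, norm_smul, Real.norm_eq_abs,
        abs_of_pos hδ] at e5
      exact (pow_left_inj₀ (by positivity) hr.le two_ne_zero).1 e5
    rw [e1, add_sub_cancel_left, hZ, smul_smul, ← e6, hl]
    have := norm_ne_zero_iff.2 (hnorm p)
    congr 1
    field_simp
  have hXξ : ∀ p, lorentz (X p) (stdVec k c) = -r := by
    intro p
    obtain ⟨Ka, Kb, y, δ, hδ, e1, e2, e3, e4, e5⟩ := hloc p
    have h1 := hZloc p Ka Kb δ hδ e1 e2 e5
    have h2 : lorentz (r • Z p) κ = -r ^ 2 := by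
      rw [h1, lorentz_sub_left, e3, e4, lorentz_add_left, lorentz_comm (D y), hA₀.perp, hκκ, hr2]
      ring
    rw [lorentz_smul_left] at h2
    rw [hX, lorentz_coadjM, hCξ]
    have h3 : r * (lorentz (Z p) κ + r) = 0 := by linear_combination h2
    have h4 := (mul_eq_zero.1 h3).resolve_left hr.ne'
    linarith
  have sX : ∀ x, SmAt n X x := fun x => (sZ x).linear (coadjM C)
  have sY : ∀ x, SmAt n Y x := fun x => (sZ x).linear (coadj D)
  have hXc : Continuous fun p => (X p).2 := continuous_snd.comp
    (continuous_iff_continuousAt.2 fun x => (sX x).continuousAt)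
  have hX0 : ∀ p, (X p).2 ≠ 0 := by
    intro p h0
    have h1 := hXX p
    rw [lorentz, h0, mul_zero, sub_zero] at h1
    have := real_inner_self_nonneg (x := (X p).1)
    linarith
  have hXp₀ : 0 < (X p₀).2 := by
    -- At the base point Z = (K_b - K_a)/r has product -1 with C (0, 1) = (κ - K_a)/r, so the time
    -- coordinate of X is 1 there.
    have h1 := hZloc p₀ _ _ _ (hδ₀ p₀ hp₀) (hc₀.eq p₀ hp₀) (hA₀.a_D p₀ hp₀) (by
      rw [hA₀.norm_sq hc₀ hp₀, hr2, hκκ]; ring)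
    have h2 : (X p₀).2 = -lorentz (X p₀) (0, 1) := by simp [lorentz]
    have h3 : lorentz (X p₀) (0, 1) = lorentz (Z p₀) (r⁻¹ • (κ - Ka₀ p₀)) := by
      rw [hX, lorentz_coadjM, hC1]
    obtain ⟨y, hy⟩ := hA₀.b_mem p₀ hp₀
    have h4 : lorentz (r • Z p₀) (κ - Ka₀ p₀) = -r ^ 2 := by
      have h5 := hc₀.lorentz_ab hp₀
      have h6 := hA₀.a_κ p₀ hp₀
      have h7 : lorentz (Kb₀ p₀) κ = -c := by
        rw [hy, lorentz_add_left, lorentz_comm (D y), hA₀.perp, hκκ, add_zero]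
      rw [h1]
      simp only [lorentz_sub_left, lorentz_sub_right, h6, h7, hc₀.unit p₀ hp₀,
        lorentz_comm (Kb₀ p₀) (Ka₀ p₀), h5, hr2]
      ring
    rw [lorentz_smul_left] at h4
    rw [lorentz_smul_right] at h3
    have h8 : lorentz (X p₀) (0, 1) = -1 := by
      rw [h3]
      field_simp
      have h9 : r * (lorentz (Z p₀) (κ - Ka₀ p₀) + r) = 0 := by linear_combination h4
      have := (mul_eq_zero.1 h9).resolve_left hr.ne'
      linarith
    rw [h2, h8]; norm_num
  -- The time coordinate of a time-like vector does not vanish; on a connected manifold it keeps the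
  -- sign that it has at the base point.
  have hXpos : ∀ p, 0 < (X p).2 := by
    have hcl : IsClopen {p | 0 < (X p).2} := by
      refine ⟨?_, isOpen_lt continuous_const hXc⟩
      have : {p | 0 < (X p).2} = {p | 0 ≤ (X p).2} :=
        Set.ext fun p => (lt_iff_le_and_ne.trans (and_iff_left (hX0 p).symm))
      rw [this]
      exact isClosed_le continuous_const hXc
    have := hcl.eq_univ ⟨p₀, hXp₀⟩
    intro p
    have hp : p ∈ {p | 0 < (X p).2} := by rw [this]; trivial
    exact hp
  have hXm : ∀ p, X p ∈ hyperbolic (k + 1) := fun p => ⟨hXX p, hXpos p⟩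
  let Θ : ThetaMap (n + 1) k m :=
    { toLightConeModel := τ, C := C, D := D, C_isometry := hC, D_isometry := hD, C_D := hCD }
  refine ⟨c, hc, hasNormalForm_of hdim hf
    (fun p => (⟨stdInv k c (X p), (stdInv_mem hc (hXm p) (hXξ p)).1⟩,
      ⟨Y p, mem_sphere_zero_iff_norm.2 (hYn p)⟩))
    (fun x => (sX x).comp contDiff_stdInv.contDiffAt) sY (isSphericalInclusion_stdIncl hc) Θ
    fun p => ?_⟩
  simp only [(stdInv_mem hc (hXm p) (hXξ p)).2]
  have h1 : Θ.lift (X p) (Y p) = l p • τ.psi (f p) := (hZXY p).symm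
  refine ⟨?_, ?_⟩
  · change lorentz (Θ.lift (X p) (Y p)) τ.w ≠ 0
    rw [h1, lorentz_smul_left, τ.psi_w, mul_one]
    exact (hl0 p).ne'
  · change f p = τ.proj (Θ.lift (X p) (Y p))
    rw [h1, τ.proj_smul (hl0 p).ne', τ.proj_psi]

/-- The Euclidean subspace of one adapted pair serves everywhere. -/
theorem hasNormalForm_of_adapted [IsManifold (𝓡 n) ∞ M] [PreconnectedSpace M] {m k : ℕ}
    {f : M → Euc (n + 1)} (hf : IsSmoothImmersion n f) (τ : LightConeModel (n + 1))
    (h : ∀ p, ∃ (Ka Kb : M → Mink (n + 1 + 1)) (δ : M → ℝ) (U : Set M), p ∈ U ∧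
      CurvPair (fun y => τ.psi (f y)) m k Ka Kb δ U ∧ ∀ x ∈ U, 0 < δ x)
    {D : Euc (m + 1) →ₗ[ℝ] Mink (n + 1 + 1)} {κ : Mink (n + 1 + 1)} {p₀ : M}
    {Ka₀ Kb₀ : M → Mink (n + 1 + 1)} {δ₀ : M → ℝ} {U₀ : Set M} (hp₀ : p₀ ∈ U₀)
    (hc₀ : CurvPair (fun y => τ.psi (f y)) m k Ka₀ Kb₀ δ₀ U₀) (hδ₀ : ∀ x ∈ U₀, 0 < δ₀ x)
    (hA₀ : Adapted Ka₀ Kb₀ D κ U₀) : ∃ c : ℝ, -1 < c ∧ HasNormalForm n m k c f := by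
  set G : Set M := {p | ∃ (Ka Kb : M → Mink (n + 1 + 1)) (δ : M → ℝ) (U : Set M), p ∈ U ∧
      CurvPair (fun y => τ.psi (f y)) m k Ka Kb δ U ∧ (∀ x ∈ U, 0 < δ x) ∧ Adapted Ka Kb D κ U}
    with hG
  have hGo : IsOpen G := by
    rw [isOpen_iff_mem_nhds]
    rintro p ⟨Ka, Kb, δ, U, hp, hc, hδ, hA⟩
    exact mem_of_superset (hc.isOpen.mem_nhds hp) fun x hx => ⟨Ka, Kb, δ, U, hx, hc, hδ, hA⟩
  have hGc : IsClosed G := by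
    rw [← closure_subset_iff_isClosed]
    intro p hp
    obtain ⟨Ka, Kb, δ, U, hpU, hc, hδ⟩ := h p
    obtain ⟨V, hVo, hpV, hVU, had⟩ := hc.exists_adapted hpU
    have hcV := hc.mono hVU hVo
    obtain ⟨x, hxV, Ka', Kb', δ', U', hxU', hc', hδ', hA'⟩ :=
      mem_closure_iff.1 hp V hVo hpV
    have hW : IsOpen (V ∩ U') := hVo.inter hc'.isOpen
    have hF : τ.psi (f x) ≠ 0 := τ.psi_ne_zero _
    have e1 := hc.eq x (hVU hxV)
    have e2 := hc'.eq x hxU'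
    have hδx := hδ x (hVU hxV)
    have hδx' := hδ' x hxU'
    obtain ⟨ε, hε, ⟨-, hu⟩ | ⟨hmk, hu⟩⟩ := (hcV.mono Set.inter_subset_left hW).unique
      (hc'.mono Set.inter_subset_right hW) ⟨hxV, hxU'⟩
    -- Both δ and δ' are positive; with ε = -1 the two relations K_b = K_a + δF would give (δ + δ')F
    -- = 0.
    · have hε1 : ε = 1 := by
        rcases hε with h0 | h0
        · exact h0
        · exfalso
          obtain ⟨ha, hb⟩ := hu.self_of_nhds
          rw [ha, hb, e1, h0] at e2
          have : (δ x + δ' x) • τ.psi (f x) = 0 := by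
            rw [← sub_eq_zero.2 e2.symm]; module
          have := (smul_eq_zero.1 this).resolve_right hF
          linarith
      obtain ⟨W, hW1, hWo, hxW⟩ := mem_nhds_iff.1
        (inter_mem (hW.mem_nhds ⟨hxV, hxU'⟩) hu)
      refine ⟨Ka, Kb, δ, V, hpV, hcV, fun y hy => hδ y (hVU hy),
        Adapted.extend hcV had hxV hWo hxW
        ((hA'.mono fun y hy => (hW1 hy).1.2).congr (fun y hy => ?_) fun y hy => ?_)⟩
      · rw [(hW1 hy).2.1, hε1, one_smul]
      · rw [(hW1 hy).2.2, hε1, one_smul]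
    -- The families are exchanged, which needs m = k. Positivity now forces the opposite sign, so
    -- the pair agrees with the swapped pair (-K_b, -K_a), to which the extension applies.
    · have hε1 : ε = -1 := by
        rcases hε with h0 | h0
        · exfalso
          obtain ⟨ha, hb⟩ := hu.self_of_nhds
          rw [ha, hb, e1, h0] at e2
          have : (δ x + δ' x) • τ.psi (f x) = 0 := by
            rw [← sub_eq_zero.2 e2.symm]; module
          have := (smul_eq_zero.1 this).resolve_right hF
          linarith
        · exact h0
      obtain ⟨W, hW1, hWo, hxW⟩ := mem_nhds_iff.1
        (inter_mem (hW.mem_nhds ⟨hxV, hxU'⟩) hu)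
      subst hmk
      have had' : (∃ (E : Euc (m + 1) →ₗ[ℝ] Mink (n + 1 + 1)) (χ : Mink (n + 1 + 1)),
          Adapted (fun x => -Kb x) (fun x => -Ka x) E χ V) ∨
          ∃ (E : Euc (m + 1) →ₗ[ℝ] Mink (n + 1 + 1)) (χ : Mink (n + 1 + 1)),
          Adapted (fun x => -(-Ka x)) (fun x => -(-Kb x)) E χ V := by
        simpa only [neg_neg] using had.symm
      refine ⟨_, _, δ, V, hpV, hcV.swap, fun y hy => hδ y (hVU hy),
        Adapted.extend hcV.swap had' hxV hWo hxW
        ((hA'.mono fun y hy => (hW1 hy).1.2).congr (fun y hy => ?_) fun y hy => ?_)⟩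
      · rw [(hW1 hy).2.1, hε1, neg_smul, one_smul]
      · rw [(hW1 hy).2.2, hε1, neg_smul, one_smul]
  have hGu : G = Set.univ :=
    IsClopen.eq_univ ⟨hGc, hGo⟩ ⟨p₀, Ka₀, Kb₀, δ₀, U₀, hp₀, hc₀, hδ₀, hA₀⟩
  refine hasNormalForm_of_forall_adapted hf τ (D := D) (κ := κ) (fun p => ?_) p₀
  have : p ∈ G := by rw [hGu]; trivial
  exact this

/-- Every cyclide of Dupin has a normal form, up to the order of the principal curvatures. -/
theorem IsDupinCyclide.hasNormalForm [IsManifold (𝓡 n) ∞ M] [ConnectedSpace M] {m k : ℕ}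
    {f : M → Euc (n + 1)} (h : IsDupinCyclide n m k f) :
    ∃ c : ℝ, -1 < c ∧ (HasNormalForm n m k c f ∨ HasNormalForm n k m c f) := by
  obtain ⟨τ⟩ := exists_lightConeModel (n + 1)
  have hf := h.2.2.2.1
  have hp := fun p => h.exists_curvPair τ p
  let p₀ : M := Classical.arbitrary M
  obtain ⟨Ka, Kb, δ, U, hpU, hc, hδ⟩ := hp p₀
  obtain ⟨V, hVo, hpV, hVU, ⟨D, κ, hA⟩ | ⟨D, κ, hA⟩⟩ := hc.exists_adapted hpU
  · obtain ⟨c, hc1, hn⟩ := hasNormalForm_of_adapted hf τ hp hpV (hc.mono hVU hVo)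
      (fun x hx => hδ x (hVU hx)) hA
    exact ⟨c, hc1, Or.inl hn⟩
  · obtain ⟨c, hc1, hn⟩ := hasNormalForm_of_adapted hf τ
      (fun p => by
        obtain ⟨Ka, Kb, δ, U, hpU, hc, hδ⟩ := hp p
        exact ⟨_, _, δ, U, hpU, hc.swap, hδ⟩) hpV (hc.mono hVU hVo).swap
      (fun x hx => hδ x (hVU hx)) hA
    exact ⟨c, hc1, Or.inr hn⟩

end Existence

/-! ### Existence of cyclides with a given normal form -/

section Examples

open Topology Filter

theorem SmAt.of_contDiff {n : ℕ} {F : Type*} [NormedAddCommGroup F] [NormedSpace ℝ F]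
    {g : Euc n → F} (h : ContDiff ℝ ∞ g) (x : Euc n) : SmAt n g x := h.contDiffAt.contMDiffAt

theorem HasD.of_hasFDerivAt {n : ℕ} {F : Type*} [NormedAddCommGroup F] [NormedSpace ℝ F]
    {g : Euc n → F} {x : Euc n} {g' : Euc n →L[ℝ] F} (h : HasFDerivAt g g' x) : HasD n g x g' :=
  h.hasMFDerivAt

/-- The function `1 / √(1 + a |u|²)`. -/
theorem contDiff_inv_sqrt {d : ℕ} {a : ℝ} (ha : 0 ≤ a) :
    ContDiff ℝ ∞ (fun u : Euc d => (√(1 + a * ‖u‖ ^ 2))⁻¹) := by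
  have h : ∀ u : Euc d, 0 < 1 + a * ‖u‖ ^ 2 := fun u => by positivity
  exact ((contDiff_const.add (contDiff_const.mul (contDiff_norm_sq ℝ))).sqrt
    fun u => (h u).ne').inv fun u => (Real.sqrt_pos.2 (h u)).ne'

theorem inv_sqrt_pos {d : ℕ} {a : ℝ} (ha : 0 ≤ a) (u : Euc d) : 0 < (√(1 + a * ‖u‖ ^ 2))⁻¹ := by
  have h : 0 < 1 + a * ‖u‖ ^ 2 := by positivity
  exact inv_pos.2 (Real.sqrt_pos.2 h)

theorem inv_sqrt_sq {d : ℕ} {a : ℝ} (ha : 0 ≤ a) (u : Euc d) :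
    (√(1 + a * ‖u‖ ^ 2))⁻¹ ^ 2 * (1 + a * ‖u‖ ^ 2) = 1 := by
  have h : 0 < 1 + a * ‖u‖ ^ 2 := by positivity
  rw [inv_pow, Real.sq_sqrt h.le, inv_mul_cancel₀ h.ne']

/-- An immersion of `ℝ^k` into the space form of curvature `c`. -/
theorem exists_spaceForm_chart (k : ℕ) (c : ℝ) : ∃ q : Euc k → Euc k × ℝ, ContDiff ℝ ∞ q ∧
    (∀ u, q u ∈ spaceForm k c) ∧
    ∀ u x, (fderiv ℝ q u x).1 = 0 → (c ≠ 0 → (fderiv ℝ q u x).2 = 0) → x = 0 := by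
  rcases lt_trichotomy c 0 with hc | hc | hc
  · have hc' : 0 < -c⁻¹ := neg_pos.2 (inv_lt_zero.2 hc)
    have h : ∀ u : Euc k, 0 < ‖u‖ ^ 2 + -c⁻¹ := fun u => by positivity
    have hs : ContDiff ℝ ∞ (fun u : Euc k => √(‖u‖ ^ 2 + -c⁻¹)) :=
      ((contDiff_norm_sq ℝ).add contDiff_const).sqrt fun u => (h u).ne'
    refine ⟨fun u => (u, √(‖u‖ ^ 2 + -c⁻¹)), contDiff_id.prodMk hs, fun u => ⟨fun _ => ?_,
      fun h0 => absurd h0 hc.ne, fun _ => Real.sqrt_pos.2 (h u)⟩, fun u x hx _ => ?_⟩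
    · simp only [formOf, Real.sign_of_neg hc, real_inner_self_eq_norm_sq, Real.mul_self_sqrt (h u).le]
      ring
    · have hd : HasFDerivAt (fun u : Euc k => (u, √(‖u‖ ^ 2 + -c⁻¹))) _ u :=
        (hasFDerivAt_id (𝕜 := ℝ) u).prodMk (hs.differentiable (by simp) u).hasFDerivAt
      rw [hd.fderiv] at hx
      exact hx
  · refine ⟨fun u => (u, 0), contDiff_id.prodMk contDiff_const, fun u => ⟨fun h => absurd hc h,
      fun _ => rfl, fun h => absurd hc h.ne⟩, fun u x hx _ => ?_⟩
    have hd : HasFDerivAt (fun u : Euc k => (u, (0 : ℝ))) _ u :=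
      (hasFDerivAt_id (𝕜 := ℝ) u).prodMk (hasFDerivAt_const 0 u)
    rw [hd.fderiv] at hx
    exact hx
  -- Central projection of a hyperplane onto an open hemisphere.
  · set s : Euc k → ℝ := fun u => (√(1 + c * ‖u‖ ^ 2))⁻¹ with hs
    have sc : ContDiff ℝ ∞ s := contDiff_inv_sqrt hc.le
    have hr : 0 < √c := Real.sqrt_pos.2 hc
    refine ⟨fun u => (s u • u, (√c)⁻¹ * s u), (sc.smul contDiff_id).prodMk (contDiff_const.mul sc),
      fun u => ⟨fun _ => ?_, fun h0 => absurd h0 hc.ne', fun h0 => absurd h0 hc.le.not_gt⟩,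
      fun u x hx1 hx2 => ?_⟩
    · simp only [formOf, Real.sign_of_pos hc, real_inner_self_eq_norm_sq, norm_smul, mul_pow,
        Real.norm_eq_abs, sq_abs]
      have h1 : s u ^ 2 * (1 + c * ‖u‖ ^ 2) = 1 := inv_sqrt_sq hc.le u
      have h2 : (√c)⁻¹ ^ 2 = 1 / c := by rw [inv_pow, Real.sq_sqrt hc.le, one_div]
      have h3 : c * (1 / c) = 1 := by field_simp
      linear_combination (1 / c) * h1 + s u ^ 2 * h2 - s u ^ 2 * ‖u‖ ^ 2 * h3
    · have hsd := (sc.differentiable (by simp) u).hasFDerivAt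
      have hd : HasFDerivAt (fun u : Euc k => (s u • u, (√c)⁻¹ * s u)) _ u :=
        (hsd.smul (hasFDerivAt_id (𝕜 := ℝ) u)).prodMk (hsd.const_mul ((√c)⁻¹))
      rw [hd.fderiv] at hx1 hx2
      have h2 : (√c)⁻¹ * fderiv ℝ s u x = 0 := hx2 hc.ne'
      have h3 : fderiv ℝ s u x = 0 := (mul_eq_zero.1 h2).resolve_left (inv_ne_zero hr.ne')
      have h1 : s u • x + fderiv ℝ s u x • u = 0 := hx1
      rw [h3, zero_smul, add_zero] at h1
      exact (smul_eq_zero.1 h1).resolve_left (inv_sqrt_pos hc.le u).ne'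

theorem fderiv_stdIncl_eq_zero {k : ℕ} {c : ℝ} {q x : Euc k × ℝ}
    (h : fderiv ℝ (stdIncl k c) q x = 0) : x.1 = 0 ∧ (c ≠ 0 → x.2 = 0) := by
  rw [fderiv_stdIncl] at h
  have h2 : heightD c q x = 0 := by
    have := congrArg Prod.snd h
    simpa using this
  have h1 : embSucc k x.1 = 0 := by
    have := congrArg Prod.fst h
    rw [h2] at this
    simpa using this
  refine ⟨by rw [← tailSucc_embSucc x.1, h1, map_zero], fun hc => ?_⟩
  simp only [heightD, hc, if_false] at h2
  exact (mul_eq_zero.1 h2).resolve_left (inv_ne_zero (Real.sqrt_pos.2 (abs_pos.2 hc)).ne')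

/-- Orthogonal isometric embeddings of a Minkowski space and a Euclidean space. -/
theorem exists_isometries (d i j : ℕ) (h : i + j = d) :
    ∃ (C : Mink i →ₗ[ℝ] Mink d) (D : Euc j →ₗ[ℝ] Mink d),
      (∀ X X', lorentz (C X) (C X') = lorentz X X') ∧
      (∀ Y Y', lorentz (D Y) (D Y') = inner ℝ Y Y') ∧ ∀ X Y, lorentz (C X) (D Y) = 0 := by
  let b : OrthonormalBasis (Fin i ⊕ Fin j) ℝ (Euc d) :=
    (EuclideanSpace.basisFun (Fin d) ℝ).reindex
      ((finCongr h.symm).trans finSumFinEquiv.symm)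
  have hb := b.orthonormal
  have h1 : Orthonormal ℝ (fun x : Fin i => b (Sum.inl x)) := hb.comp _ Sum.inl_injective
  have h2 : Orthonormal ℝ (fun x : Fin j => b (Sum.inr x)) := hb.comp _ Sum.inr_injective
  let P : Euc i →ₗ[ℝ] Euc d :=
    ∑ x, (LinearMap.toSpanSingleton ℝ _ (b (Sum.inl x))) ∘ₗ
      (EuclideanSpace.proj x : Euc i →L[ℝ] ℝ).toLinearMap
  let Q : Euc j →ₗ[ℝ] Euc d :=
    ∑ x, (LinearMap.toSpanSingleton ℝ _ (b (Sum.inr x))) ∘ₗ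
      (EuclideanSpace.proj x : Euc j →L[ℝ] ℝ).toLinearMap
  have hP : ∀ v, P v = ∑ x, v x • b (Sum.inl x) := fun v => by simp [P]
  have hQ : ∀ v, Q v = ∑ x, v x • b (Sum.inr x) := fun v => by simp [Q]
  have hPP : ∀ v v', inner ℝ (P v) (P v') = inner ℝ v v' := by
    intro v v'
    rw [hP, hP, h1.inner_sum]
    simp [PiLp.inner_apply, mul_comm]
  have hQQ : ∀ v v', inner ℝ (Q v) (Q v') = inner ℝ v v' := by
    intro v v'
    rw [hQ, hQ, h2.inner_sum]
    simp [PiLp.inner_apply, mul_comm]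
  have hPQ : ∀ v v', inner ℝ (P v) (Q v') = 0 := by
    intro v v'
    rw [hP, hQ, sum_inner]
    refine Finset.sum_eq_zero fun x _ => ?_
    rw [inner_sum]
    refine Finset.sum_eq_zero fun y _ => ?_
    rw [real_inner_smul_left, real_inner_smul_right, hb.inner_eq_zero (by simp), mul_zero, mul_zero]
  refine ⟨P.prodMap LinearMap.id, LinearMap.inl ℝ _ _ ∘ₗ Q, fun X X' => ?_, fun Y Y' => ?_,
    fun X Y => ?_⟩
  · simp [lorentz, hPP]
  · simp [lorentz, hQQ]
  · simp [lorentz, hPQ]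

/-- Smoothness of the stereographic projection of a smooth map. -/
theorem SmAt.proj {M : Type u} [TopologicalSpace M] {n : ℕ} [ChartedSpace (Euc n) M] {N : ℕ}
    {Z : M → Mink (N + 1)} {x : M} (hZ : SmAt n Z x) (τ : LightConeModel N)
    (h : DupinCyclide.lorentz (Z x) τ.w ≠ 0) : SmAt n (fun y => τ.proj (Z y)) x := by
  refine hZ.comp (P := τ.proj) ?_
  unfold LightConeModel.proj
  refine contDiffAt_euclidean.2 fun i => ?_
  refine ContDiffAt.div ?_ ?_ h
  · exact (contDiff_lorentz.comp (contDiff_id.prodMk contDiff_const)).contDiffAt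
  · exact (contDiff_lorentz.comp (contDiff_id.prodMk contDiff_const)).contDiffAt

/-- Every normal form occurs on `ℝ^n`. -/
theorem exists_isDupinCyclide {n m k : ℕ} (hm : 0 < m) (hk : 0 < k) (hmk : m + k = n) {c : ℝ}
    (hc : -1 < c) :
    ∃ f : Euc n → Euc (n + 1), IsDupinCyclide n m k f ∧ HasNormalForm n m k c f := by
  obtain ⟨C, D, hC, hD, hCD⟩ := exists_isometries (n + 1 + 1) (k + 1) (m + 1) (by omega)
  have hDC : ∀ Y X, lorentz (D Y) (C X) = 0 := fun Y X => by rw [lorentz_comm, hCD]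
  -- With this `w` one has ⟨C X + D Y, w⟩ = X.2 + ⟨Y, e₀⟩. It is positive on hyperbolic space times
  -- the open hemisphere, so nothing goes to infinity.
  obtain ⟨τ, -, hτ⟩ := LightConeModel.exists_of_null (N := n + 1)
    (p₀ := (1 / 2 : ℝ) • (C (0, 1) + D (e₀ m))) (w := C (0, -1) + D (e₀ m))
    (by
      simp only [lorentz_smul_left, lorentz_smul_right, lorentz_add_left, lorentz_add_right, hC, hD,
        hCD, hDC, real_inner_self_eq_norm_sq, norm_e₀]
      simp [lorentz])
    (by
      simp only [lorentz_add_left, lorentz_add_right, hC, hD, hCD, hDC, real_inner_self_eq_norm_sq,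
        norm_e₀]
      simp [lorentz])
    (by
      simp only [lorentz_smul_left, lorentz_add_left, lorentz_add_right, hC, hD, hCD, hDC,
        real_inner_self_eq_norm_sq, norm_e₀]
      simp [lorentz]
      norm_num)
  let Θ : ThetaMap (n + 1) k m :=
    { toLightConeModel := τ, C := C, D := D, C_isometry := hC, D_isometry := hD, C_D := hCD }
  let ℓ : Euc n ≃ₗ[ℝ] Euc k × Euc m := LinearEquiv.ofFinrankEq _ _ (by
    simp [Module.finrank_prod]; omega)
  let a : Euc n →L[ℝ] Euc k := toCLM (LinearMap.fst ℝ _ _ ∘ₗ ℓ.toLinearMap)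
  let b : Euc n →L[ℝ] Euc m := toCLM (LinearMap.snd ℝ _ _ ∘ₗ ℓ.toLinearMap)
  have hab : ∀ t, a t = 0 → b t = 0 → t = 0 := fun t h1 h2 =>
    ℓ.map_eq_zero_iff.1 (Prod.ext h1 h2)
  obtain ⟨q, hqs, hq, hqd⟩ := exists_spaceForm_chart k c
  set s : Euc m → ℝ := fun v => (√(1 + 1 * ‖v‖ ^ 2))⁻¹ with hs
  have ss : ContDiff ℝ ∞ s := contDiff_inv_sqrt zero_le_one
  -- Central projection onto the open hemisphere ⟨y, e₀⟩ > 0.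
  set y : Euc m → Euc (m + 1) := fun v => s v • (embSucc m v + e₀ m) with hy
  have sy : ContDiff ℝ ∞ y := ss.smul ((toCLM (embSucc m)).contDiff.add contDiff_const)
  have hyn : ∀ v, ‖y v‖ = 1 := by
    intro v
    have h1 : ‖y v‖ ^ 2 = 1 := by
      have h2 : s v ^ 2 * (1 + 1 * ‖v‖ ^ 2) = 1 := inv_sqrt_sq zero_le_one v
      have h3 : ‖embSucc m v + e₀ m‖ ^ 2 = ‖v‖ ^ 2 + 1 := by
        rw [norm_add_sq_real, inner_embSucc_e₀, norm_e₀, ← real_inner_self_eq_norm_sq,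
          inner_embSucc, real_inner_self_eq_norm_sq]
        ring
      simp only [hy, norm_smul, mul_pow, Real.norm_eq_abs, sq_abs, h3]
      linear_combination h2
    exact (pow_eq_one_iff_of_nonneg (norm_nonneg _) two_ne_zero).1 h1
  have hye : ∀ v, 0 < inner ℝ (y v) (e₀ m) := by
    intro v
    rw [hy, real_inner_smul_left, inner_add_left, inner_embSucc_e₀, real_inner_self_eq_norm_sq,
      norm_e₀]
    have : 0 < s v := inv_sqrt_pos zero_le_one v
    linarith
  set X : Euc n → Mink (k + 1) := fun t => stdIncl k c (q (a t)) with hX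
  set Y : Euc n → Euc (m + 1) := fun t => y (b t) with hY
  have sq : ∀ x, SmAt n (fun t => q (a t)) x := SmAt.of_contDiff (hqs.comp a.contDiff)
  have sX : ∀ x, SmAt n X x := fun x => (sq x).comp contDiff_stdIncl.contDiffAt
  have sY : ∀ x, SmAt n Y x := SmAt.of_contDiff (sy.comp b.contDiff)
  have hP : ProductImm n c (stdVec k c) X Y Set.univ := by
    refine ⟨isOpen_univ, hc, hmk, hm, hk, stdVec_norm hc, fun x _ => sX x, fun x _ => sY x,
      fun x _ => lorentz_stdIncl_self hc (hq _), fun x _ => lorentz_stdIncl_stdVec _,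
      fun x _ => hyn _, fun x _ t h1 h2 => hab t ?_ ?_⟩
    · rw [hX, dif_spherical contDiff_stdIncl (sq x)] at h1
      obtain ⟨h3, h4⟩ := fderiv_stdIncl_eq_zero h1
      have h5 : HasFDerivAt (fun t => q (a t)) ((fderiv ℝ q (a x)).comp a) x :=
        (hqs.differentiable (by simp) (a x)).hasFDerivAt.comp x a.hasFDerivAt
      rw [(HasD.of_hasFDerivAt h5).dif_eq] at h3 h4
      exact hqd _ _ h3 h4
    · have h6 : HasFDerivAt y _ (b x) := (ss.differentiable (by simp) (b x)).hasFDerivAt.smul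
        ((toCLM (embSucc m)).hasFDerivAt.add_const (e₀ m))
      have h5 : HasFDerivAt (fun t => y (b t)) _ x := h6.comp x b.hasFDerivAt
      rw [(HasD.of_hasFDerivAt h5).dif_eq] at h2
      have h7 : s (b x) • embSucc m (b t) + fderiv ℝ s (b x) (b t) • (embSucc m (b x) + e₀ m) = 0 := h2
      -- The `e₀`-component isolates the derivative of the scale factor `s`.
      have h8 := congrArg (fun v => inner ℝ v (e₀ m)) h7
      simp only [inner_add_left, real_inner_smul_left, inner_embSucc_e₀, real_inner_self_eq_norm_sq,
        norm_e₀, inner_zero_left] at h8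
      have h9 : fderiv ℝ s (b x) (b t) = 0 := by linarith
      rw [h9, zero_smul, add_zero] at h7
      have h10 := (smul_eq_zero.1 h7).resolve_left (inv_sqrt_pos zero_le_one (b x)).ne'
      rw [← tailSucc_embSucc (b t), h10, map_zero]
  have hXm : ∀ x, X x ∈ hyperbolic (k + 1) := fun x => stdIncl_mem hc (hq _)
  have hYm : ∀ x, Y x ∈ unitSphere m := fun x => mem_sphere_zero_iff_norm.2 (hyn _)
  set μ : Euc n → ℝ := fun x => lorentz (C (X x) + D (Y x)) τ.w with hμ
  have sμ : ∀ x, SmAt n μ x := fun x =>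
    (hP.smAt_lift (C := C) (D := D) (Set.mem_univ x)).lorentz (smAt_const _ x)
  have hμ0 : ∀ x, μ x ≠ 0 := by
    intro x
    have h1 : μ x = (X x).2 + inner ℝ (Y x) (e₀ m) := by
      simp only [hμ, hτ, lorentz_add_left, lorentz_add_right, hC, hD, hCD, hDC]
      simp [lorentz]
    rw [h1]
    exact (add_pos (hXm x).2 (hye (b x))).ne'
  set f : Euc n → Euc (n + 1) := fun x => Θ.toFun (X x) (Y x) with hf
  have sf : ∀ x, SmAt n f x := fun x =>
    SmAt.proj (hP.smAt_lift (C := C) (D := D) (Set.mem_univ x)) τ (hμ0 x)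
  have hZ : ∀ x, C (X x) + D (Y x) = μ x • τ.psi (f x) := fun x =>
    Θ.lift_eq_smul (hXm x) (hYm x) (hμ0 x)
  have hL := hP.isLift hC hD hCD
  have hfi : IsSmoothImmersion n f := by
    refine ⟨sf, fun x => ?_⟩
    refine (injective_iff_map_eq_zero (dif n f x)).2 fun t ht => ?_
    by_contra h0
    have h1 := hL.pos x (Set.mem_univ x) t h0
    rw [dif_congr (n := n) (Eventually.of_forall hZ), lorentz_dif_smul_psi (sf x) (sμ x), ht] at h1
    simp at h1
  refine ⟨f, isDupinCyclide_of_curvPair hfi τ hm hk hmk fun p => ⟨_, _, _, Set.univ,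
    Set.mem_univ p, (hP.curvPair hC hD hCD).smul_lift (μ := fun x => (μ x)⁻¹)
      (fun x _ => (sμ x).inv (hμ0 x)) (fun x _ => inv_ne_zero (hμ0 x)) fun x _ => ?_⟩,
    hasNormalForm_of hmk hfi (fun x => (⟨q (a x), hq _⟩, ⟨Y x, hYm x⟩)) sq sY
      (isSphericalInclusion_stdIncl hc) Θ fun x => ⟨hμ0 x, rfl⟩⟩
  rw [hZ, smul_smul, inv_mul_cancel₀ (hμ0 x), one_smul]

end Examples

/-! ### Invariance of the parameters -/

section Invariance

open Topology Filter

variable {M : Type u} [TopologicalSpace M] {n : ℕ} [ChartedSpace (Euc n) M]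

/-- The parameters of two adapted pairs of the same lift agree, up to the interchange of the two
curvature spheres. -/
theorem eq_or_mul_eq_one_of_adapted {F Ka Kb Ka' Kb' : M → Mink (n + 1 + 1)} {m k m' k' : ℕ}
    {δ δ' : M → ℝ} {U : Set M} {D : Euc (m + 1) →ₗ[ℝ] Mink (n + 1 + 1)}
    {D' : Euc (m' + 1) →ₗ[ℝ] Mink (n + 1 + 1)} {κ κ' : Mink (n + 1 + 1)}
    (h : CurvPair F m k Ka Kb δ U) (hA : Adapted Ka Kb D κ U)
    (h' : CurvPair F m' k' Ka' Kb' δ' U) (hA' : Adapted Ka' Kb' D' κ' U) {p : M} (hp : p ∈ U) :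
    (m = m' ∧ lorentz κ κ = lorentz κ' κ') ∨ (m = k' ∧ lorentz κ κ * lorentz κ' κ' = 1) := by
  have hUp := h.isOpen.mem_nhds hp
  obtain ⟨ε, hε, ⟨hm, hu⟩ | ⟨hm, hu⟩⟩ := h.unique h' hp
  -- κ' is constant on the family K_a, hence κ' = εκ + D y and ⟨κ', κ'⟩ ≥ ⟨κ, κ⟩; the roles are
  -- symmetric.
  · refine Or.inl ⟨hm.symm, ?_⟩
    have hεε : ε * ε = 1 := by rcases hε with rfl | rfl <;> norm_num
    have h1 : ∀ᶠ x in 𝓝 p, lorentz (Ka x) κ' = ε := by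
      filter_upwards [hu, hUp] with x hx hxU
      have h2 := hA'.a_κ x hxU
      rw [hx.1, lorentz_smul_left] at h2
      linear_combination ε * h2 - lorentz (Ka x) κ' * hεε
    have h2 : ∀ᶠ x in 𝓝 p, lorentz (Ka' x) κ = ε := by
      filter_upwards [hu, hUp] with x hx hxU
      rw [hx.1, lorentz_smul_left, hA.a_κ x hxU, mul_one]
    obtain ⟨y, hy⟩ := hA.mem_range_of_const_a h hp h1
    obtain ⟨z, hz⟩ := hA'.mem_range_of_const_a h' hp h2
    have e1 : lorentz κ' κ' = lorentz κ κ + inner ℝ y y := by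
      rw [hy]
      simp only [lorentz_add_left, lorentz_add_right, lorentz_smul_left, lorentz_smul_right, hA.perp,
        lorentz_comm (D y) κ, hA.iso]
      linear_combination lorentz κ κ * hεε
    have e2 : lorentz κ κ = lorentz κ' κ' + inner ℝ z z := by
      rw [hz]
      simp only [lorentz_add_left, lorentz_add_right, lorentz_smul_left, lorentz_smul_right,
        hA'.perp, lorentz_comm (D' z) κ', hA'.iso]
      linear_combination lorentz κ' κ' * hεε
    have e3 := real_inner_self_nonneg (x := y)
    have e4 := real_inner_self_nonneg (x := z)
    linarith
  · have hd := h.dim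
    have hd' := h'.dim
    refine Or.inr ⟨by omega, ?_⟩
    have hεε : ε * ε = 1 := by rcases hε with rfl | rfl <;> norm_num
    have hD : ∀ y', (∀ y, lorentz (D' y') (D y) = 0) ∧ lorentz κ (D' y') = 0 := by
      intro y'
      refine hA.perp_of_const_b h hp ?_
      filter_upwards [hu, hUp] with x hx hxU
      have h2 := hA'.a_D x hxU y'
      rw [hx.1, lorentz_smul_left] at h2
      linear_combination ε * h2 - lorentz (Kb x) (D' y') * hεε
    have hκ : (∀ y, lorentz κ' (D y) = 0) ∧ lorentz κ κ' = ε := by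
      refine hA.perp_of_const_b h hp ?_
      filter_upwards [hu, hUp] with x hx hxU
      have h2 := hA'.a_κ x hxU
      rw [hx.1, lorentz_smul_left] at h2
      linear_combination ε * h2 - lorentz (Kb x) κ' * hεε
    have hκ0 : κ ≠ 0 := by
      intro h0
      have := hκ.2
      rw [h0, lorentz_zero_left] at this
      rw [← this] at hεε
      norm_num at hεε
    -- κ' is orthogonal to range D and range D', which together with κ span the space; so κ' = sκ.
    -- With s⟨κ, κ⟩ = ε the product of the two squares is ε² = 1.
    obtain ⟨y, z, s, hs⟩ := exists_eq_add_add hA.iso hA'.iso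
      (fun y z => (lorentz_comm _ _).trans ((hD z).1 y)) hA.perp (fun z => (hD z).2) hκ0
      (by omega) κ'
    have hy : y = 0 := by
      have h1 := hκ.1 y
      rw [hs] at h1
      simp only [lorentz_add_left, lorentz_smul_left, hA.iso, (hD z).1 y, hA.perp] at h1
      exact inner_self_eq_zero.1 (by linarith : inner ℝ y y = (0 : ℝ))
    have hz : z = 0 := by
      have h1 := hA'.perp z
      rw [hs] at h1
      simp only [lorentz_add_left, lorentz_smul_left, hA'.iso, lorentz_comm (D y) (D' z),
        (hD z).1 y, (hD z).2] at h1
      exact inner_self_eq_zero.1 (by linarith : inner ℝ z z = (0 : ℝ))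
    rw [hy, hz, map_zero, map_zero, zero_add, zero_add] at hs
    have h1 := hκ.2
    rw [hs, lorentz_smul_right] at h1
    rw [hs, lorentz_smul_left, lorentz_smul_right]
    rw [← h1] at hεε
    linear_combination hεε

/-- A factorization of a light cone lift into a hyperbolic and a spherical part is smooth. -/
theorem productImm_of_lift {F : M → Mink (n + 1 + 1)} {U : Set M} (hU : IsOpen U) (hF : IsLift F U)
    {m k : ℕ} (hm : 0 < m) (hk : 0 < k) (hmk : m + k = n) {c : ℝ} (hc : -1 < c)
    {C : Mink (k + 1) →ₗ[ℝ] Mink (n + 1 + 1)} {D : Euc (m + 1) →ₗ[ℝ] Mink (n + 1 + 1)}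
    (hC : ∀ v v', lorentz (C v) (C v') = lorentz v v')
    (hD : ∀ v v', lorentz (D v) (D v') = inner ℝ v v') (hCD : ∀ v v', lorentz (C v) (D v') = 0)
    {X : M → Mink (k + 1)} {Y : M → Euc (m + 1)} {μ : M → ℝ} (hμ : ∀ x ∈ U, ContinuousAt μ x)
    (hμ0 : ∀ x ∈ U, μ x ≠ 0) (hZ : ∀ x ∈ U, C (X x) + D (Y x) = μ x • F x) {ξ : Mink (k + 1)}
    (hξ : lorentz ξ ξ = -c) (hXX : ∀ x ∈ U, lorentz (X x) (X x) = -1)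
    (hXξ : ∀ x ∈ U, lorentz (X x) ξ = -√(1 + c)) (hYY : ∀ x ∈ U, ‖Y x‖ = 1) :
    ProductImm n c ξ X Y U := by
  have hY : ∀ x ∈ U, Y x = μ x • coadj D (F x) := by
    intro x hx
    rw [← map_smul, ← hZ x hx, map_add, coadj_apply_self hD, coadj_eq_zero (hCD _), zero_add]
  have hDF : ∀ x ∈ U, coadj D (F x) ≠ 0 := by
    intro x hx h0
    have h1 := hYY x hx
    rw [hY x hx, h0, smul_zero, norm_zero] at h1
    norm_num at h1
  have habs : ∀ x ∈ U, |μ x| = ‖coadj D (F x)‖⁻¹ := by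
    intro x hx
    have h1 := hYY x hx
    rw [hY x hx, norm_smul, Real.norm_eq_abs] at h1
    exact eq_inv_of_mul_eq_one_left h1
  have sl : ∀ x ∈ U, SmAt n (fun y => ‖coadj D (F y)‖⁻¹) x := fun x hx =>
    (((hF.smooth x hx).linear (coadj D)).norm (hDF x hx)).inv (norm_ne_zero_iff.2 (hDF x hx))
  -- Up to sign μ is the inverse length of the component of `F` in range D, which is smooth, and
  -- continuity fixes the sign locally. Thus continuity of the factor is enough, as is needed for a
  -- congruence that is only a homeomorphism.
  have sμ : ∀ x ∈ U, SmAt n μ x := by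
    intro x hx
    rcases lt_or_gt_of_ne (hμ0 x hx) with h0 | h0
    · refine (sl x hx).neg.congr ?_
      filter_upwards [(hμ x hx).eventually (gt_mem_nhds h0), hU.mem_nhds hx] with y hy hyU
      rw [← habs y hyU, abs_of_neg hy, neg_neg]
    · refine (sl x hx).congr ?_
      filter_upwards [(hμ x hx).eventually (lt_mem_nhds h0), hU.mem_nhds hx] with y hy hyU
      rw [← habs y hyU, abs_of_pos hy]
  have sZ : ∀ x ∈ U, SmAt n (fun y => C (X y) + D (Y y)) x := fun x hx =>
    ((sμ x hx).smul (hF.smooth x hx)).congr (eventually_of_mem (hU.mem_nhds hx) hZ)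
  have sX : ∀ x ∈ U, SmAt n X x := fun x hx =>
    ((sZ x hx).linear (coadjM C)).congr (Eventually.of_forall fun y => by
      have h1 : coadjM C (D (Y y)) = 0 := by
        apply lorentz_nondegenerate
        intro z
        rw [lorentz_coadjM, lorentz_comm, hCD]
      change X y = coadjM C (C (X y) + D (Y y))
      rw [map_add, coadjM_apply_self hC, h1, add_zero])
  have sY : ∀ x ∈ U, SmAt n Y x := fun x hx =>
    ((sZ x hx).linear (coadj D)).congr (Eventually.of_forall fun y => by
      change Y y = coadj D (C (X y) + D (Y y))
      rw [map_add, coadj_apply_self hD, coadj_eq_zero (hCD _), zero_add])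
  refine ⟨hU, hc, hmk, hm, hk, hξ, sX, sY, hXX, hXξ, hYY, fun x hx t h1 h2 => ?_⟩
  by_contra h0
  have h3 := (hF.smul hU sμ hμ0).pos x hx t h0
  rw [← dif_congr (n := n) (eventually_of_mem (hU.mem_nhds hx) hZ),
    (((sX x hx).hasD.linear C).add ((sY x hx).hasD.linear D)).dif_eq] at h3
  have h4 : ((toCLM C).comp (dif n X x) + (toCLM D).comp (dif n Y x)) t =
      C (dif n X x t) + D (dif n Y x t) := rfl
  rw [h4, h1, h2, map_zero, map_zero, zero_add, lorentz_zero_left] at h3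
  exact lt_irrefl _ h3

theorem LightConeModel.eq_smul_of_proj_eq {N : ℕ} (τ : LightConeModel N) {Z F : Mink (N + 1)}
    (hZ : lorentz Z Z = 0) (hF : lorentz F F = 0) (hZw : lorentz Z τ.w ≠ 0)
    (hFw : lorentz F τ.w ≠ 0) (h : τ.proj Z = τ.proj F) :
    Z = (lorentz Z τ.w * (lorentz F τ.w)⁻¹) • F := by
  have h1 := τ.psi_proj Z hZ hZw
  rw [h, τ.psi_proj F hF hFw] at h1
  rw [mul_smul, h1, smul_smul, mul_inv_cancel₀ hZw, one_smul]

/-- Conformally congruent normal forms have the same parameters, up to order. -/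
theorem eq_or_mul_eq_one_of_conformallyCongruent {M' : Type v} [TopologicalSpace M']
    [ChartedSpace (Euc n) M'] [IsManifold (𝓡 n) ∞ M] [IsManifold (𝓡 n) ∞ M'] {m k m' k' : ℕ}
    {c c' : ℝ} (hc : -1 < c) (hc' : -1 < c') {f : M → Euc (n + 1)} {f' : M' → Euc (n + 1)}
    (hf : IsDupinCyclide n m k f) (hn : HasNormalForm n m k c f) (hf' : IsDupinCyclide n m' k' f')
    (hn' : HasNormalForm n m' k' c' f') (h : ConformallyCongruent f f') :
    (m = m' ∧ c = c') ∨ (m = k' ∧ c * c' = 1) := by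
  obtain ⟨e, T, ⟨p, hp⟩, hT, hfe⟩ := h
  obtain ⟨Θ, X, Y, hΘ, hloc⟩ := hn.exists_product hf.1 hf.2.1 hf.2.2.1 hc hf.2.2.2.1
  obtain ⟨Θ', X', Y', hΘ', hloc'⟩ := hn'.exists_product hf'.1 hf'.2.1 hf'.2.2.1 hc' hf'.2.2.2.1
  obtain ⟨τ, hτ⟩ := Θ.toLightConeModel.exists_of_isMoebiusOn hT
  -- `τ` describes `T` in the Minkowski space of the first hypersurface; `L` moves the lift of the
  -- second one there.
  obtain ⟨L, hL, hLw, hLp⟩ := LightConeModel.exists_transport τ Θ'.toLightConeModel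
  obtain ⟨U₁, ξ, hpU₁, hP⟩ := hloc p
  obtain ⟨U₂, ξ', hpU₂, hP'⟩ := hloc' (e p)
  set F : M → Mink (n + 1 + 1) := fun x => Θ.psi (f x) with hF
  set U : Set M := U₁ ∩ (e.source ∩ e ⁻¹' U₂) with hU
  have hUo : IsOpen U := hP.isOpen.inter (e.isOpen_inter_preimage hP'.isOpen)
  have hpU : p ∈ U := ⟨hpU₁, hp, hpU₂⟩
  have hFl : IsLift F U := (isLift_psi hf.2.2.2.1 Θ.toLightConeModel).mono (Set.subset_univ _)
  have hPU := hP.mono Set.inter_subset_left hUo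
  have hpair := (hPU.curvPair Θ.C_isometry Θ.D_isometry Θ.C_D).smul_lift (F' := F)
    (μ := fun x => (lorentz (Θ.C (X x) + Θ.D (Y x)) Θ.w)⁻¹)
    (fun x hx => SmAt.inv ((hPU.smAt_lift hx).lorentz (smAt_const _ x)) (hΘ x).2.1)
    (fun x _ => inv_ne_zero (hΘ x).2.1) (fun x _ => by
      rw [hF]
      conv_rhs => rw [(hΘ x).2.2]
      rw [lorentz_smul_left, Θ.psi_w, mul_one, smul_smul, inv_mul_cancel₀ (hΘ x).2.1, one_smul])
  have hA := hPU.adapted Θ.C_isometry Θ.D_isometry Θ.C_D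
  -- In the model `τ` both `Z` and `F` represent the point T (f x), so they are proportional: the
  -- second normal form provides a further product decomposition of the same lift.
  set Z : M → Mink (n + 1 + 1) := fun x => L (Θ'.C (X' (e x)) + Θ'.D (Y' (e x))) with hZ
  have hC' : ∀ v v', lorentz ((L ∘ₗ Θ'.C) v) ((L ∘ₗ Θ'.C) v') = lorentz v v' := fun v v' =>
    (hL _ _).trans (Θ'.C_isometry _ _)
  have hD' : ∀ v v', lorentz ((L ∘ₗ Θ'.D) v) ((L ∘ₗ Θ'.D) v') = inner ℝ v v' := fun v v' =>
    (hL _ _).trans (Θ'.D_isometry _ _)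
  have hCD' : ∀ v v', lorentz ((L ∘ₗ Θ'.C) v) ((L ∘ₗ Θ'.D) v') = 0 := fun v v' =>
    (hL _ _).trans (Θ'.C_D _ _)
  have hZe : ∀ x, Z x = (L ∘ₗ Θ'.C) (X' (e x)) + (L ∘ₗ Θ'.D) (Y' (e x)) := fun x =>
    map_add L _ _
  have hZw : ∀ x, lorentz (Z x) τ.w ≠ 0 := fun x => by rw [hZ, hLw]; exact (hΘ' (e x)).2.1
  have hFw : ∀ x ∈ U, lorentz (F x) τ.w ≠ 0 := fun x hx => (hτ _ ⟨x, hx.2.1, rfl⟩).1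
  have hZF : ∀ x ∈ U, Z x = (lorentz (Z x) τ.w * (lorentz (F x) τ.w)⁻¹) • F x := by
    intro x hx
    refine τ.eq_smul_of_proj_eq ?_ (hFl.null x hx) (hZw x) (hFw x hx) ?_
    · rw [hZ, hL, (hΘ' (e x)).2.2, lorentz_smul_left, lorentz_smul_right, Θ'.psi_null]
      ring
    · rw [hZ, hLp, (hΘ' (e x)).2.2, Θ'.proj_smul (hΘ' (e x)).2.1, Θ'.proj_psi, hfe x hx.2.1]
      exact (hτ _ ⟨x, hx.2.1, rfl⟩).2
  have hμc : ∀ x ∈ U, ContinuousAt (fun x => lorentz (Z x) τ.w * (lorentz (F x) τ.w)⁻¹) x := by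
    intro x hx
    have hec : ContinuousAt e x := e.continuousAt hx.2.1
    have hlor : Continuous fun v : Mink (n + 1 + 1) => lorentz v τ.w :=
      (contDiff_lorentz.comp (contDiff_id.prodMk contDiff_const)).continuous
    have h1 : ContinuousAt (fun x => Θ'.C (X' (e x)) + Θ'.D (Y' (e x))) x :=
      ContinuousAt.comp (g := fun y => Θ'.C (X' y) + Θ'.D (Y' y))
        (hP'.smAt_lift hx.2.2).continuousAt hec
    have h2 : ContinuousAt Z x := (toCLM L).continuous.continuousAt.comp h1
    have h3 : ContinuousAt (fun x => lorentz (Z x) τ.w) x := hlor.continuousAt.comp h2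
    have h4 : ContinuousAt (fun x => lorentz (F x) τ.w) x :=
      hlor.continuousAt.comp (hFl.smooth x hx).continuousAt
    exact h3.mul (h4.inv₀ (hFw x hx))
  have hPU' : ProductImm n c' ξ' (fun x => X' (e x)) (fun x => Y' (e x)) U :=
    productImm_of_lift hUo hFl hf'.1 hf'.2.1 hf'.2.2.1 hc' hC' hD' hCD' hμc
      (fun x hx => mul_ne_zero (hZw x) (inv_ne_zero (hFw x hx)))
      (fun x hx => by rw [← hZF x hx, hZe]) hP'.norm_ξ
      (fun x hx => hP'.XX _ hx.2.2) (fun x hx => hP'.Xξ _ hx.2.2) fun x hx => hP'.YY _ hx.2.2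
  have hpair' := (hPU'.curvPair hC' hD' hCD').smul_lift (F' := F)
    (μ := fun x => (lorentz (Z x) τ.w * (lorentz (F x) τ.w)⁻¹)⁻¹)
    (fun x hx => SmAt.inv (SmAt.smul (((hPU'.smAt_lift hx).congr
      (Eventually.of_forall hZe)).lorentz (smAt_const _ x))
      (SmAt.inv ((hFl.smooth x hx).lorentz (smAt_const _ x)) (hFw x hx)))
        (mul_ne_zero (hZw x) (inv_ne_zero (hFw x hx))))
    (fun x hx => inv_ne_zero (mul_ne_zero (hZw x) (inv_ne_zero (hFw x hx))))
    (fun x hx => by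
      have h2 := mul_ne_zero (hZw x) (inv_ne_zero (hFw x hx))
      rw [← hZe]
      conv_rhs => rw [hZF x hx]
      rw [smul_smul, ← hZF x hx, inv_mul_cancel₀ h2, one_smul])
  have hA' := hPU'.adapted hC' hD' hCD'
  have := eq_or_mul_eq_one_of_adapted hpair hA hpair' hA' hpU
  rw [Θ.C_isometry, hC', hPU.norm_ξ, hPU'.norm_ξ, neg_mul_neg, neg_inj] at this
  exact this

end Invariance

/-! ### Construction of conformal congruences -/

section Congruence

open Topology Filter

/-- Both maps are open onto the same set `S`, so the points that `g` sends into g'(N) form a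
neighbourhood. This gives openness of the overlap and, with injectivity of `g'`, continuity of the
transition map. -/
theorem continuousOn_of_map_nhds {A B E : Type*} [TopologicalSpace A] [TopologicalSpace B]
    [TopologicalSpace E] {g : A → E} {g' : B → E} {S : Set E} {V : Set A} {V' : Set B}
    (hV : IsOpen V) (hV' : IsOpen V') (hg' : Set.InjOn g' V')
    (h : ∀ x ∈ V, map g (𝓝 x) = 𝓝[S] (g x)) (h' : ∀ x ∈ V', map g' (𝓝 x) = 𝓝[S] (g' x))
    {u : A → B} (hu : ∀ x ∈ V ∩ g ⁻¹' (g' '' V'), u x ∈ V' ∧ g' (u x) = g x) :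
    IsOpen (V ∩ g ⁻¹' (g' '' V')) ∧ ContinuousOn u (V ∩ g ⁻¹' (g' '' V')) := by
  have key : ∀ x ∈ V ∩ g ⁻¹' (g' '' V'), ∀ N ∈ 𝓝 (u x), g ⁻¹' (g' '' N) ∈ 𝓝 x := by
    intro x hx N hN
    have h1 : g' '' N ∈ map g (𝓝 x) := by
      rw [h x hx.1, ← (hu x hx).2, ← h' _ (hu x hx).1]
      exact image_mem_map hN
    exact h1
  have hopen : IsOpen (V ∩ g ⁻¹' (g' '' V')) := isOpen_iff_mem_nhds.2 fun x hx =>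
    inter_mem (hV.mem_nhds hx.1) (key x hx V' (hV'.mem_nhds (hu x hx).1))
  refine ⟨hopen, fun x hx => ContinuousAt.continuousWithinAt fun N hN => ?_⟩
  have hN' : N ∩ V' ∈ 𝓝 (u x) := inter_mem hN (hV'.mem_nhds (hu x hx).1)
  rw [Filter.mem_map]
  filter_upwards [key x hx _ hN', hopen.mem_nhds hx] with z ⟨y, hy, hyz⟩ hz
  have : u z = y := hg' (hu z hz).1 hy.2 ((hu z hz).2.trans hyz.symm)
  change u z ∈ N
  rw [this]
  exact hy.1

/-- Two injective parametrizations of neighbourhoods in the same set differ by a homeomorphism. -/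
theorem exists_openPartialHomeomorph {A B E : Type*} [TopologicalSpace A] [TopologicalSpace B]
    [TopologicalSpace E] {g : A → E} {g' : B → E} {S : Set E} {V : Set A} {V' : Set B}
    (hV : IsOpen V) (hV' : IsOpen V') (hg : Set.InjOn g V) (hg' : Set.InjOn g' V')
    (h : ∀ x ∈ V, map g (𝓝 x) = 𝓝[S] (g x)) (h' : ∀ x ∈ V', map g' (𝓝 x) = 𝓝[S] (g' x))
    {p : A} {p' : B} (hp : p ∈ V) (hp' : p' ∈ V') (hpp : g p = g' p') :
    ∃ e : OpenPartialHomeomorph A B, p ∈ e.source ∧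
      ∀ x ∈ e.source, x ∈ V ∧ e x ∈ V' ∧ g' (e x) = g x := by
  have : Nonempty A := ⟨p⟩
  have : Nonempty B := ⟨p'⟩
  set u : A → B := fun x => Function.invFunOn g' V' (g x) with hu
  set v : B → A := fun y => Function.invFunOn g V (g' y) with hv
  have hu' : ∀ x ∈ V ∩ g ⁻¹' (g' '' V'), u x ∈ V' ∧ g' (u x) = g x := fun x hx =>
    ⟨Function.invFunOn_mem hx.2, Function.invFunOn_eq hx.2⟩
  have hv' : ∀ y ∈ V' ∩ g' ⁻¹' (g '' V), v y ∈ V ∧ g (v y) = g' y := fun y hy =>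
    ⟨Function.invFunOn_mem hy.2, Function.invFunOn_eq hy.2⟩
  have h1 := continuousOn_of_map_nhds hV hV' hg' h h' hu'
  have h2 := continuousOn_of_map_nhds hV' hV hg h' h hv'
  have hmu : ∀ x ∈ V ∩ g ⁻¹' (g' '' V'), u x ∈ V' ∩ g' ⁻¹' (g '' V) := fun x hx =>
    ⟨(hu' x hx).1, x, hx.1, (hu' x hx).2.symm⟩
  have hmv : ∀ y ∈ V' ∩ g' ⁻¹' (g '' V), v y ∈ V ∩ g ⁻¹' (g' '' V') := fun y hy =>
    ⟨(hv' y hy).1, y, hy.1, (hv' y hy).2.symm⟩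
  let e : OpenPartialHomeomorph A B :=
    { toFun := u
      invFun := v
      source := V ∩ g ⁻¹' (g' '' V')
      target := V' ∩ g' ⁻¹' (g '' V)
      map_source' := hmu
      map_target' := hmv
      left_inv' := fun x hx => hg (hv' _ (hmu x hx)).1 hx.1
        ((hv' _ (hmu x hx)).2.trans (hu' x hx).2)
      right_inv' := fun y hy => hg' (hu' _ (hmv y hy)).1 hy.1
        ((hu' _ (hmv y hy)).2.trans (hv' y hy).2)
      open_source := h1.1
      open_target := h2.1
      continuousOn_toFun := h1.2
      continuousOn_invFun := h2.2 }
  exact ⟨e, ⟨hp, p', hp', hpp.symm⟩, fun x hx => ⟨hx.1, hu' x hx⟩⟩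

theorem IsMoebiusOn.mono {d : ℕ} {T : Euc d → Euc d} {S S' : Set (Euc d)} (h : IsMoebiusOn T S)
    (hS : S' ⊆ S) : IsMoebiusOn T S' := by
  obtain ⟨r, U, b, hr, h | ⟨a, ha, h⟩⟩ := h
  · exact ⟨r, U, b, hr, Or.inl fun x hx => h x (hS hx)⟩
  · exact ⟨r, U, b, hr, Or.inr ⟨a, fun h' => ha (hS h'), fun x hx => h x (hS hx)⟩⟩

variable {M : Type u} [TopologicalSpace M] {n : ℕ} [ChartedSpace (Euc n) M]

/-- Hypersurfaces with isometric light cone lifts are conformally congruent. -/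
theorem conformallyCongruent_of_lift {M' : Type v} [TopologicalSpace M'] {N : ℕ}
    {f : M → Euc N} {f' : M' → Euc N} (τ τ' : LightConeModel N) {Z : M → Mink (N + 1)}
    {Z' : M' → Mink (N + 1)} {μ : M → ℝ} {μ' : M' → ℝ} {K : Mink (N + 1) →ₗ[ℝ] Mink (N + 1)}
    (hK : ∀ v v', lorentz (K v) (K v') = lorentz v v') (e : OpenPartialHomeomorph M M')
    (he : e.source.Nonempty)
    (hZ : ∀ x ∈ e.source, μ x ≠ 0 ∧ Z x = μ x • τ.psi (f x))
    (hZ' : ∀ x ∈ e.source, μ' (e x) ≠ 0 ∧ Z' (e x) = μ' (e x) • τ'.psi (f' (e x)))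
    (hKZ : ∀ x ∈ e.source, K (Z' (e x)) = Z x) : ConformallyCongruent f f' := by
  have h1 : ∀ x ∈ e.source, τ.psi (f x) = ((μ x)⁻¹ * μ' (e x)) • K (τ'.psi (f' (e x))) := by
    intro x hx
    rw [mul_smul, ← map_smul, ← (hZ' x hx).2, hKZ x hx, (hZ x hx).2, smul_smul,
      inv_mul_cancel₀ (hZ x hx).1, one_smul]
  have h0 : ∀ x ∈ e.source, (μ x)⁻¹ * μ' (e x) ≠ 0 := fun x hx =>
    mul_ne_zero (inv_ne_zero (hZ x hx).1) (hZ' x hx).1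
  refine ⟨e, _, he, (LightConeModel.isMoebiusOn τ (τ'.map K hK)).mono ?_, fun x hx => ?_⟩
  · rintro _ ⟨x, hx, rfl⟩
    change lorentz (τ.psi (f x)) (K τ'.w) ≠ 0
    rw [h1 x hx, lorentz_smul_left, hK, τ'.psi_w, mul_one]
    exact h0 x hx
  · rw [h1 x hx, LightConeModel.proj_smul _ (h0 x hx)]
    symm
    apply LightConeModel.proj_eq_of_forall
    intro v
    change lorentz (K (τ'.psi (f' (e x)))) (K (τ'.A v)) /
      lorentz (K (τ'.psi (f' (e x)))) (K τ'.w) = inner ℝ (f' (e x)) v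
    rw [hK, hK, τ'.psi_A, τ'.psi_w, div_one]

/-- A light cone lift `C X + D Y` of a multiple of `Z` in standard position at `p`. -/
def StandardAt (n m k : ℕ) [ChartedSpace (Euc n) M] (c : ℝ) (F : M → Mink (n + 1 + 1)) (p : M) :
    Prop :=
  ∃ (C : Mink (k + 1) →ₗ[ℝ] Mink (n + 1 + 1)) (D : Euc (m + 1) →ₗ[ℝ] Mink (n + 1 + 1))
    (X : M → Mink (k + 1)) (Y : M → Euc (m + 1)) (μ : M → ℝ) (U : Set M),
    (∀ v v', lorentz (C v) (C v') = lorentz v v') ∧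
    (∀ v v', lorentz (D v) (D v') = inner ℝ v v') ∧ (∀ v v', lorentz (C v) (D v') = 0) ∧
    p ∈ U ∧ ProductImm n c (stdVec k c) X Y U ∧ X p = (0, 1) ∧ Y p = e₀ m ∧
    ∀ x ∈ U, μ x ≠ 0 ∧ C (X x) + D (Y x) = μ x • F x

/-- Both maps (X, Y) are local parametrizations of the same `productSet` near the same point, which
yields the reparametrization `e`. The linear isometry with C' ↦ C and D' ↦ D then carries one lift
to the other. -/
theorem StandardAt.conformallyCongruent [IsManifold (𝓡 n) ∞ M] {M' : Type v} [TopologicalSpace M']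
    [ChartedSpace (Euc n) M'] [IsManifold (𝓡 n) ∞ M'] {m k : ℕ} {c : ℝ} {f : M → Euc (n + 1)}
    {f' : M' → Euc (n + 1)} {τ τ' : LightConeModel (n + 1)} {p : M} {p' : M'}
    (h : StandardAt n m k c (fun x => τ.psi (f x)) p)
    (h' : StandardAt n m k c (fun x => τ'.psi (f' x)) p') : ConformallyCongruent f f' := by
  obtain ⟨C, D, X, Y, μ, U, hC, hD, hCD, hp, hP, hX, hY, hZ⟩ := h
  obtain ⟨C', D', X', Y', μ', U', hC', hD', hCD', hp', hP', hX', hY', hZ'⟩ := h'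
  obtain ⟨V, hV, hinj⟩ := (hP.map_nhds hp).2
  obtain ⟨V', hV', hinj'⟩ := (hP'.map_nhds hp').2
  obtain ⟨W, hWV, hWo, hpW⟩ := mem_nhds_iff.1 (inter_mem hV (hP.isOpen.mem_nhds hp))
  obtain ⟨W', hWV', hWo', hpW'⟩ := mem_nhds_iff.1 (inter_mem hV' (hP'.isOpen.mem_nhds hp'))
  obtain ⟨e, hpe, he⟩ := exists_openPartialHomeomorph hWo hWo'
    (hinj.mono fun x hx => (hWV hx).1) (hinj'.mono fun x hx => (hWV' hx).1)
    (fun x hx => (hP.map_nhds (hWV hx).2).1) (fun x hx => (hP'.map_nhds (hWV' hx).2).1)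
    hpW hpW' (by rw [hX, hX', hY, hY'])
  let K : Mink (n + 1 + 1) →ₗ[ℝ] Mink (n + 1 + 1) := C ∘ₗ coadjM C' + D ∘ₗ coadj D'
  have hKC : ∀ v, K (C' v) = C v := fun v => by
    change C (coadjM C' (C' v)) + D (coadj D' (C' v)) = C v
    rw [coadjM_apply_self hC', coadj_eq_zero (hCD' v), map_zero, add_zero]
  have hKD : ∀ v, K (D' v) = D v := fun v => by
    change C (coadjM C' (D' v)) + D (coadj D' (D' v)) = D v
    have h1 : coadjM C' (D' v) = 0 := by
      apply lorentz_nondegenerate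
      intro z
      rw [lorentz_coadjM, lorentz_comm, hCD']
    rw [coadj_apply_self hD', h1, map_zero, zero_add]
  have hdim := hP.dim
  have hK : ∀ v v', lorentz (K v) (K v') = lorentz v v' := by
    intro v v'
    have e1 := eq_add_coadj hC' hD' hCD' (by omega) v
    have e2 := eq_add_coadj hC' hD' hCD' (by omega) v'
    rw [e1, e2]
    simp only [map_add, hKC, hKD, lorentz_add_left, lorentz_add_right, hC, hD, hCD, hC', hD', hCD',
      lorentz_comm (D _) (C _), lorentz_comm (D' _) (C' _)]
  refine conformallyCongruent_of_lift τ τ' hK e ⟨p, hpe⟩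
    (Z := fun x => C (X x) + D (Y x)) (Z' := fun x => C' (X' x) + D' (Y' x)) (μ := μ) (μ' := μ')
    (fun x hx => hZ x (hWV (he x hx).1).2) (fun x hx => hZ' _ (hWV' (he x hx).2.1).2)
    fun x hx => ?_
  have h1 : X' (e x) = X x := congrArg Prod.fst (he x hx).2.2
  have h2 : Y' (e x) = Y x := congrArg Prod.snd (he x hx).2.2
  rw [map_add, hKC, hKD, h1, h2]

/-- An adapted pair of curvature spheres can be brought into standard position. -/
theorem Adapted.standardAt {F Ka Kb : M → Mink (n + 1 + 1)} {m k : ℕ} {δ : M → ℝ} {U : Set M}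
    {D : Euc (m + 1) →ₗ[ℝ] Mink (n + 1 + 1)} {κ : Mink (n + 1 + 1)} (hA : Adapted Ka Kb D κ U)
    (h : CurvPair F m k Ka Kb δ U) {p : M} (hp : p ∈ U) {c : ℝ} (hκκ : lorentz κ κ = -c) :
    StandardAt n m k c F p := by
  have hdim := h.dim
  have hc : -1 < c := by have := hA.radius_pos h hp; linarith
  set r := √(1 + c) with hrdef
  have hr : 0 < r := Real.sqrt_pos.2 (by linarith)
  have hr2 : r ^ 2 = 1 + c := Real.sq_sqrt (by linarith)
  have hnorm : ∀ x ∈ U, ‖r⁻¹ • coadj D (Kb x)‖ = 1 := by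
    intro x hx
    have h1 := hA.norm_sq h hx
    have h2 : ‖r⁻¹ • coadj D (Kb x)‖ ^ 2 = 1 := by
      rw [norm_smul, mul_pow, h1, hκκ, Real.norm_eq_abs, sq_abs, inv_pow, hr2]
      have : 1 + c ≠ 0 := by linarith
      field_simp
      ring
    exact (pow_eq_one_iff_of_nonneg (norm_nonneg _) two_ne_zero).1 h2
  -- `D` is rotated so that the spherical component at `p` becomes `e₀`. The frame `C` is chosen as
  -- for the normal form and puts the hyperbolic component at (0, 1).
  obtain ⟨R, hR⟩ := exists_linearIsometryEquiv_apply_eq (a := e₀ m) (b := r⁻¹ • coadj D (Kb p))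
    (by rw [norm_e₀, hnorm p hp])
  let D₁ : Euc (m + 1) →ₗ[ℝ] Mink (n + 1 + 1) := D ∘ₗ R.toLinearEquiv.toLinearMap
  have hD₁ : ∀ y, D₁ y = D (R y) := fun y => rfl
  have hD₁i : ∀ y y', lorentz (D₁ y) (D₁ y') = inner ℝ y y' := fun y y' => by
    rw [hD₁, hD₁, hA.iso, R.inner_map_map]
  have hco : ∀ v, coadj D₁ v = R.symm (coadj D v) := by
    intro v
    apply ext_inner_right ℝ
    intro z
    rw [inner_coadj, hD₁, ← inner_coadj, ← R.inner_map_map (R.symm _), R.apply_symm_apply]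
  obtain ⟨C, hC, hCD, hC1, hC2⟩ := exists_frame (k := k) (m := m + 1) hD₁i
    (X₀ := r⁻¹ • (κ - Ka p)) (ν₀ := Ka p) (by omega)
    (by
      simp only [lorentz_smul_left, lorentz_smul_right, lorentz_sub_left, lorentz_sub_right,
        h.unit p hp, lorentz_comm κ, hA.a_κ p hp]
      rw [hκκ]
      field_simp
      linarith)
    (h.unit p hp)
    (by
      simp only [lorentz_smul_right, lorentz_sub_right, h.unit p hp, hA.a_κ p hp]; ring)
    (fun y => by
      rw [hD₁, lorentz_smul_left, lorentz_sub_left, hA.perp, hA.a_D p hp]; ring)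
    (fun y => hA.a_D p hp _)
  have hCξ : C (stdVec k c) = κ := by
    have h1 : stdVec k c = (e₀ k, 0) + r • ((0, 1) : Mink (k + 1)) := by
      simp [stdVec, hrdef]
    rw [h1, map_add, map_smul, hC1, smul_smul, mul_inv_cancel₀ hr.ne']
    change C (EuclideanSpace.single 0 1, 0) + _ = _
    rw [hC2]; module
  set Z : M → Mink (n + 1 + 1) := fun x => r⁻¹ • (Kb x - Ka x) with hZ
  have hZF : ∀ x ∈ U, Z x = (r⁻¹ * δ x) • F x := by
    intro x hx
    rw [hZ]
    simp only [h.eq x hx, add_sub_cancel_left, smul_smul]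
  have hZXY : ∀ x, C (coadjM C (Z x)) + D₁ (coadj D₁ (Z x)) = Z x := fun x =>
    (eq_add_coadj hC hD₁i hCD (by omega) _).symm
  have hYn : ∀ x ∈ U, ‖coadj D₁ (Z x)‖ = 1 := by
    intro x hx
    rw [hco, R.symm.norm_map, hZ]
    simp only [map_smul, map_sub, coadj_eq_zero (hA.a_D x hx), sub_zero]
    rw [← map_smul, map_smul]
    exact hnorm x hx
  have hXX : ∀ x ∈ U, lorentz (coadjM C (Z x)) (coadjM C (Z x)) = -1 := by
    intro x hx
    have h1 : lorentz (Z x) (Z x) = 0 := by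
      rw [hZF x hx, lorentz_smul_left, lorentz_smul_right, h.lift.null x hx, mul_zero, mul_zero]
    rw [← hZXY x] at h1
    simp only [lorentz_add_left, lorentz_add_right, hC, hD₁i, hCD, lorentz_comm (D₁ _) (C _),
      real_inner_self_eq_norm_sq, hYn x hx] at h1
    linarith
  have hXξ : ∀ x ∈ U, lorentz (coadjM C (Z x)) (stdVec k c) = -r := by
    intro x hx
    obtain ⟨y, hy⟩ := hA.b_mem x hx
    rw [lorentz_coadjM, hCξ, hZ, lorentz_smul_left, lorentz_sub_left, hA.a_κ x hx, hy,
      lorentz_add_left, lorentz_comm (D y), hA.perp, hκκ]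
    field_simp
    linarith
  have hP : ProductImm n c (stdVec k c) (fun x => coadjM C (Z x)) (fun x => coadj D₁ (Z x)) U :=
    productImm_of_lift h.isOpen h.lift h.m_pos h.k_pos h.dim hc hC hD₁i hCD
      (μ := fun x => r⁻¹ * δ x)
      (fun x hx => continuousAt_const.mul (h.smooth_δ x hx).continuousAt)
      (fun x hx => mul_ne_zero (inv_ne_zero hr.ne') (h.ne x hx))
      (fun x hx => (hZXY x).trans (hZF x hx)) (stdVec_norm hc) hXX hXξ hYn
  have hZp : Z p = C (0, 1) + D₁ (e₀ m) := by
    rw [hC1, hD₁, hR, map_smul, hZ]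
    beta_reduce
    conv_lhs => rw [hA.eq_b hp]
    module
  refine ⟨C, D₁, _, _, _, U, hC, hD₁i, hCD, hp, hP, ?_, ?_, fun x hx =>
    ⟨mul_ne_zero (inv_ne_zero hr.ne') (h.ne x hx), (hZXY x).trans (hZF x hx)⟩⟩
  · have h1 : coadjM C (D₁ (e₀ m)) = 0 := by
      apply lorentz_nondegenerate
      intro z
      rw [lorentz_coadjM, lorentz_comm, hCD]
    change coadjM C (Z p) = _
    rw [hZp, map_add, coadjM_apply_self hC, h1, add_zero]
  · rw [hZp, map_add, coadj_apply_self hD₁i, coadj_eq_zero (hCD _), zero_add]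

/-- If `κ` is time-like, then the other curvature sphere is adapted as well. -/
theorem Adapted.exists_swap {F Ka Kb : M → Mink (n + 1 + 1)} {m k : ℕ} {δ : M → ℝ} {U : Set M}
    {D : Euc (m + 1) →ₗ[ℝ] Mink (n + 1 + 1)} {κ : Mink (n + 1 + 1)} (hA : Adapted Ka Kb D κ U)
    (h : CurvPair F m k Ka Kb δ U) {c : ℝ} (hc : 0 < c) (hκκ : lorentz κ κ = -c) :
    ∃ E : Euc (k + 1) →ₗ[ℝ] Mink (n + 1 + 1),
      Adapted (fun x => -Kb x) (fun x => -Ka x) E (c⁻¹ • κ) U := by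
  have hdim := h.dim
  -- The kernel is the complement of range D and κ. It has dimension k + 1 and is Euclidean because
  -- κ is time-like.
  let L : Mink (n + 1 + 1) →ₗ[ℝ] Euc (m + 1) × ℝ := (coadj D).prod (lorentzForm _ κ)
  have hL : ∀ v, v ∈ LinearMap.ker L ↔ coadj D v = 0 ∧ lorentz κ v = 0 := fun v => Prod.ext_iff
  have hLs : Function.Surjective L := by
    rintro ⟨y, s⟩
    refine ⟨D y + (-(c⁻¹ * s)) • κ, Prod.ext ?_ ?_⟩
    · change coadj D (D y + _) = y
      rw [map_add, map_smul, hA.coadj_κ, coadj_apply_self hA.iso, smul_zero, add_zero]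
    · change lorentz κ (D y + _) = s
      rw [lorentz_add_right, lorentz_smul_right, hA.perp, hκκ]
      field_simp
      ring
  have hfin := finrank_ker_add_of_surjective hLs
  obtain ⟨E, hE, hEr⟩ := exists_isometry_of_pos (j := k + 1) (LinearMap.ker L)
    (by
      simp only [Module.finrank_prod, finrank_euclideanSpace, Fintype.card_fin,
        Module.finrank_self] at hfin
      omega)
    (fun w hw hw0 => lorentz_pos_of_orthogonal (T := κ) (by rw [hκκ]; linarith)
      (by rw [lorentz_comm]; exact ((hL w).1 hw).2) hw0)
  have hEm : ∀ y, coadj D (E y) = 0 ∧ lorentz κ (E y) = 0 := fun y =>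
    (hL _).1 (hEr ▸ LinearMap.mem_range_self E y)
  have hc1 : c⁻¹ * c = 1 := inv_mul_cancel₀ hc.ne'
  refine ⟨E, hE, fun y => by rw [lorentz_smul_left, (hEm y).2, mul_zero], fun x hx y => ?_,
    fun x hx => ?_, fun x hx => ?_⟩
  · obtain ⟨z, hz⟩ := hA.b_mem x hx
    rw [hz, lorentz_neg_left, lorentz_add_left, (hEm y).2, lorentz_comm (D z), ← inner_coadj,
      (hEm y).1, inner_zero_left]
    ring
  · obtain ⟨z, hz⟩ := hA.b_mem x hx
    rw [hz, lorentz_neg_left, lorentz_smul_right, lorentz_add_left, lorentz_comm (D z), hA.perp,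
      hκκ]
    linear_combination hc1
  -- The factor 1/c is what makes this difference orthogonal to κ, as ⟨K_a, κ⟩ = 1 and ⟨κ, κ⟩ = -c.
  · have hmem : -Ka x - c⁻¹ • κ ∈ LinearMap.range E := by
      rw [hEr, hL]
      refine ⟨?_, ?_⟩
      · rw [map_sub, map_neg, map_smul, hA.coadj_κ, coadj_eq_zero (hA.a_D x hx)]
        simp
      · rw [lorentz_sub_right, lorentz_smul_right, lorentz_neg_right, lorentz_comm κ (Ka x),
          hA.a_κ x hx, hκκ]
        linear_combination hc1
    obtain ⟨y, hy⟩ := hmem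
    exact ⟨y, by rw [hy]; module⟩

/-- A hypersurface in normal form has an adapted pair of curvature spheres. -/
theorem HasNormalForm.exists_adapted [IsManifold (𝓡 n) ∞ M] {m k : ℕ} {c : ℝ} (hc : -1 < c)
    {f : M → Euc (n + 1)} (hf : IsDupinCyclide n m k f) (h : HasNormalForm n m k c f) (p : M) :
    ∃ (τ : LightConeModel (n + 1)) (Ka Kb : M → Mink (n + 1 + 1)) (δ : M → ℝ) (U : Set M)
      (D : Euc (m + 1) →ₗ[ℝ] Mink (n + 1 + 1)) (κ : Mink (n + 1 + 1)), p ∈ U ∧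
      CurvPair (fun x => τ.psi (f x)) m k Ka Kb δ U ∧ Adapted Ka Kb D κ U ∧ lorentz κ κ = -c := by
  obtain ⟨Θ, X, Y, hΘ, hloc⟩ := h.exists_product hf.1 hf.2.1 hf.2.2.1 hc hf.2.2.2.1
  obtain ⟨U, ξ, hp, hP⟩ := hloc p
  refine ⟨Θ.toLightConeModel, _, _, _, U, Θ.D, Θ.C ξ, hp,
    (hP.curvPair Θ.C_isometry Θ.D_isometry Θ.C_D).smul_lift
    (μ := fun x => (lorentz (Θ.C (X x) + Θ.D (Y x)) Θ.w)⁻¹)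
    (fun x hx => SmAt.inv ((hP.smAt_lift hx).lorentz (smAt_const _ x)) (hΘ x).2.1)
    (fun x _ => inv_ne_zero (hΘ x).2.1) (fun x _ => ?_),
    hP.adapted Θ.C_isometry Θ.D_isometry Θ.C_D, by rw [Θ.C_isometry, hP.norm_ξ]⟩
  conv_rhs => rw [(hΘ x).2.2]
  rw [lorentz_smul_left, Θ.psi_w, mul_one, smul_smul, inv_mul_cancel₀ (hΘ x).2.1, one_smul]

/-- Normal forms with the same parameters, up to order, are conformally congruent. -/
theorem conformallyCongruent_of_eq_or_mul_eq_one [IsManifold (𝓡 n) ∞ M] [Nonempty M]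
    {M' : Type v} [TopologicalSpace M'] [ChartedSpace (Euc n) M'] [IsManifold (𝓡 n) ∞ M']
    [Nonempty M'] {m k m' k' : ℕ} {c c' : ℝ} (hc : -1 < c) (hc' : -1 < c') {f : M → Euc (n + 1)}
    {f' : M' → Euc (n + 1)} (hf : IsDupinCyclide n m k f) (hn : HasNormalForm n m k c f)
    (hf' : IsDupinCyclide n m' k' f') (hn' : HasNormalForm n m' k' c' f')
    (h : (m = m' ∧ c = c') ∨ (m = k' ∧ c * c' = 1)) : ConformallyCongruent f f' := by
  obtain ⟨τ, Ka, Kb, δ, U, D, κ, hp, hP, hA, hκ⟩ :=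
    hn.exists_adapted hc hf (Classical.arbitrary M)
  obtain ⟨τ', Ka', Kb', δ', U', D', κ', hp', hP', hA', hκ'⟩ :=
    hn'.exists_adapted hc' hf' (Classical.arbitrary M')
  have d1 := hP.dim
  have d2 := hP'.dim
  have hs := hA.standardAt hP hp hκ
  rcases h with ⟨rfl, rfl⟩ | ⟨rfl, hcc⟩
  · obtain rfl : k = k' := by omega
    exact hs.conformallyCongruent (hA'.standardAt hP' hp' hκ')
  · obtain rfl : k = m' := by omega
    -- Both parameters exceed -1, so two nonpositive ones would have product less than 1.
    have hc0' : 0 < c' := by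
      by_contra! h0
      have h1 : c ≤ 0 := by
        by_contra! h2
        nlinarith
      nlinarith
    obtain ⟨E, hE⟩ := hA'.exists_swap hP' hc0' hκ'
    refine hs.conformallyCongruent (hE.standardAt hP'.swap hp' ?_)
    rw [lorentz_smul_left, lorentz_smul_right, hκ', eq_comm]
    have : c = c'⁻¹ := eq_inv_of_mul_eq_one_left hcc
    rw [this]
    field_simp

end Congruence

end

end DupinCyclide

theorem corollary4p6 (n : ℕ) :
    -- every cyclide of Dupin has the normal form, up to the order of its principal curvatures
    (∀ (m k : ℕ) (M : Type u) [TopologicalSpace M] [T2Space M] [SecondCountableTopology M]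
      [ConnectedSpace M] [ChartedSpace (DupinCyclide.Euc n) M] [IsManifold (𝓡 n) ∞ M]
      (f : M → DupinCyclide.Euc (n + 1)),
      DupinCyclide.IsDupinCyclide n m k f →
        ∃ c : ℝ, -1 < c ∧
          (DupinCyclide.HasNormalForm n m k c f ∨ DupinCyclide.HasNormalForm n k m c f)) ∧
    -- every value of the parameters occurs
    (∀ m k : ℕ, 0 < m → 0 < k → m + k = n → ∀ c : ℝ, -1 < c →
      ∃ f : DupinCyclide.Euc n → DupinCyclide.Euc (n + 1),
        DupinCyclide.IsDupinCyclide n m k f ∧ DupinCyclide.HasNormalForm n m k c f) ∧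
    -- the parameters determine the class up to conformal congruence, and vice versa
    (∀ (m k m' k' : ℕ) (c c' : ℝ), -1 < c → -1 < c' →
      ∀ (M : Type u) [TopologicalSpace M] [T2Space M] [SecondCountableTopology M]
        [ConnectedSpace M] [ChartedSpace (DupinCyclide.Euc n) M] [IsManifold (𝓡 n) ∞ M]
        (M' : Type v) [TopologicalSpace M'] [T2Space M'] [SecondCountableTopology M']
        [ConnectedSpace M'] [ChartedSpace (DupinCyclide.Euc n) M'] [IsManifold (𝓡 n) ∞ M']
        (f : M → DupinCyclide.Euc (n + 1)) (f' : M' → DupinCyclide.Euc (n + 1)),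
        DupinCyclide.IsDupinCyclide n m k f → DupinCyclide.HasNormalForm n m k c f →
        DupinCyclide.IsDupinCyclide n m' k' f' → DupinCyclide.HasNormalForm n m' k' c' f' →
          (DupinCyclide.ConformallyCongruent f f' ↔
            (m = m' ∧ c = c') ∨ (m = k' ∧ c * c' = 1))) := by
  refine ⟨fun m k M _ _ _ _ _ _ f h => h.hasNormalForm, fun m k hm hk hmk c hc =>
    DupinCyclide.exists_isDupinCyclide hm hk hmk hc, ?_⟩
  intro m k m' k' c c' hc hc' M _ _ _ _ _ _ M' _ _ _ _ _ _ f f' hf hn hf' hn'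
  exact ⟨DupinCyclide.eq_or_mul_eq_one_of_conformallyCongruent hc hc' hf hn hf' hn',
    DupinCyclide.conformallyCongruent_of_eq_or_mul_eq_one hc hc' hf hn hf' hn'⟩
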